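/- Let $d\ge 1$, let $K\subseteq\mathbb{R}^{2d}$ be a compact domain with smooth boundary, let $\Omega=\mathbb{R}^{2d}\setminus K$, and let $\partial\Omega$ carry its surface measure. Write $\Psi^t(\partial\Omega)$ for the pseudodifferential operators of order $t\in\mathbb{R}$ on the closed $(2d-1)$-dimensional manifold $\partial\Omega$ (with symbols in the class $S^t_{1,0}$), and let the Sobolev spaces $H^s(\partial\Omega)$, $s\in\mathbb{R}$, be normed by means of a fixed finite atlas and a subordinate smooth partition of unity. Let $D$ be a self-adjoint elliptic pseudodifferential operator of positive order on $\partial\Omega$. Then for every $t_0\in\mathbb{R}$ there is a constant $C>0$, depending only on $D$ (hence on $\partial\Omega$), on the chosen Sobolev norms and on $t_0$, such that the following holds. Let $(e_k)_{k\in\mathbb{N}}$ (where $0\in\mathbb{N}$) be any orthonormal basis of $L^2(\partial\Omega)$ of smooth eigenfunctions, $De_k=\lambda_ke_k$, enumerated such that $|\lambda_0|\le|\lambda_1|\le|\lambda_2|\le\cdots$, and for an operator $\tau$ and $N\in\mathbb{N}$ put $$T_{(N)}(\tau)f:=\sum_{j,k=0}^N\langle\tau e_k,e_j\rangle_{L^2(\partial\Omega)}\,\langle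 f,e_k\rangle_{L^2(\partial\Omega)}\,e_j .$$ Then for all $t$ with $t_0\le t\le 1$, all $\tau\in\Psi^t(\partial\Omega)$ and all integers $N\ge 1$, $$\|\tau-T_{(N)}(\tau)\|_{\mathcal{B}(H^{3/2}(\partial\Omega),H^{1/2}(\partial\Omega))}\le C\left(\|\tau\|_{\mathcal{B}(H^{3/2}(\partial\Omega),H^{3/2-t}(\partial\Omega))}+\|\tau\|_{\mathcal{B}(H^{1/2+t}(\partial\Omega),H^{1/2}(\partial\Omega))}\right)N^{-\frac{1-t}{2d-1}},$$ where both norms on the right-hand side are finite. -/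

import Mathlib

open MeasureTheory Set Filter Topology
open scoped ContDiff ENNReal FourierTransform ComplexConjugate

noncomputable section

/-- `ℝⁿ` with its Euclidean norm. -/
abbrev Euc (n : ℕ) : Type := EuclideanSpace ℝ (Fin n)

/-- A compact domain with smooth boundary in `ℝᵐ`: a compact set which near each of its boundary
points is a sublevel set `{ρ ≤ 0}` of a smooth function with nonvanishing differential there. -/
def IsSmoothCompactDomain {m : ℕ} (K : Set (Euc m)) : Prop :=
  IsCompact K ∧ ∀ p ∈ frontier K, ∃ ρ : Euc m → ℝ,
    ContDiff ℝ ∞ ρ ∧ fderiv ℝ ρ p ≠ 0 ∧ ∀ᶠ x in 𝓝 p, (x ∈ K ↔ ρ x ≤ 0)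

/-- `C^∞(M)` for a closed (compact, embedded) submanifold `M` of `ℝᵐ`: the complex functions on `M`
that extend to smooth functions on `ℝᵐ`. -/
def SmoothFun {m : ℕ} (M : Set (Euc m)) : Subalgebra ℂ (M → ℂ) where
  carrier := {f | ∃ F : Euc m → ℂ, ContDiff ℝ ∞ F ∧ ∀ x : M, F x = f x}
  mul_mem' := by
    rintro f g ⟨F, hF, hFf⟩ ⟨G, hG, hGg⟩
    exact ⟨fun x => F x * G x, hF.mul hG, fun x => by simp [hFf, hGg]⟩
  add_mem' := by
    rintro f g ⟨F, hF, hFf⟩ ⟨G, hG, hGg⟩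
    exact ⟨fun x => F x + G x, hF.add hG, fun x => by simp [hFf, hGg]⟩
  algebraMap_mem' := fun c => ⟨fun _ => c, contDiff_const, fun _ => rfl⟩

/-- A smooth coordinate chart `κ : M ⊇ U → V ⊆ ℝⁿ` (with `U`, `V` open, not necessarily connected):
a homeomorphism whose inverse is a smooth immersion `V → ℝᵐ`. -/
def IsSmoothChart {m n : ℕ} {M : Set (Euc m)} (κ : OpenPartialHomeomorph M (Euc n)) : Prop :=
  ContDiffOn ℝ ∞ (fun y => (κ.symm y : Euc m)) κ.target ∧
    ∀ y ∈ κ.target, Function.Injective (fderiv ℝ (fun z => (κ.symm z : Euc m)) y)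

/-- The function `f ∘ κ⁻¹` on the target of the chart `κ`, extended by zero to `ℝⁿ`. -/
def chartPull {m n : ℕ} {M : Set (Euc m)} (κ : OpenPartialHomeomorph M (Euc n))
    (f : SmoothFun M) : Euc n → ℂ :=
  κ.target.indicator fun y => (f : M → ℂ) (κ.symm y)

/-- The (Hörmander, type `(1,0)`) symbol class `S^t(ℝⁿ × ℝⁿ)`. -/
def IsSymbol {n : ℕ} (t : ℝ) (a : Euc n → Euc n → ℂ) : Prop :=
  ContDiff ℝ ∞ (Function.uncurry a) ∧
    ∀ i j : ℕ, ∃ C : ℝ, ∀ x ξ : Euc n,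
      ‖iteratedFDeriv ℝ i (fun x' => iteratedFDeriv ℝ j (a x') ξ) x‖ ≤ C * (1 + ‖ξ‖) ^ (t - j)

/-- The operator `Op(a) u (y) = ∫ exp(2πi⟨ξ, y⟩) a(y, ξ) û(ξ) dξ`, where
`û(ξ) = ∫ exp(-2πi⟨x, ξ⟩) u(x) dx`. -/
def symbolOp {n : ℕ} (a : Euc n → Euc n → ℂ) (u : Euc n → ℂ) (y : Euc n) : ℂ :=
  ∫ ξ : Euc n, Complex.exp (2 * Real.pi * Complex.I * (inner ℝ ξ y : ℝ)) * a y ξ * 𝓕 u ξ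

/-- The localization `v ↦ φ A (ψ v)` of `A` is, in the chart `κ`, the operator `Op(a)`. -/
def IsLocalSymbol {m n : ℕ} {M : Set (Euc m)} (A : SmoothFun M →ₗ[ℂ] SmoothFun M)
    (κ : OpenPartialHomeomorph M (Euc n)) (φ ψ : SmoothFun M) (a : Euc n → Euc n → ℂ) : Prop :=
  ∀ v : SmoothFun M, chartPull κ (φ * A (ψ * v)) = symbolOp a (chartPull κ (ψ * v))

/-- Pseudodifferential operators of order `t` on the closed `n`-dimensional manifold `M`: in every
chart, and for all cutoffs `φ`, `ψ` supported in it, `φ A ψ` is the operator of a symbol of order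
`t`. Charts may have several components, so that the smoothness of the Schwartz kernel off the
diagonal is included. -/
def IsPseudoDiff {m : ℕ} (n : ℕ) {M : Set (Euc m)} (t : ℝ)
    (A : SmoothFun M →ₗ[ℂ] SmoothFun M) : Prop :=
  ∀ κ : OpenPartialHomeomorph M (Euc n), IsSmoothChart κ → ∀ φ ψ : SmoothFun M,
    tsupport (φ : M → ℂ) ⊆ κ.source → tsupport (ψ : M → ℂ) ⊆ κ.source →
      ∃ a : Euc n → Euc n → ℂ, IsSymbol t a ∧ IsLocalSymbol A κ φ ψ a

/-- Ellipticity of a pseudodifferential operator of order `t`: every local symbol of order `t` is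
bounded below by a multiple of `(1 + |ξ|)^t`, for large `ξ`, locally uniformly near all points at
which the cutoffs do not vanish. -/
def IsEllipticOp {m : ℕ} (n : ℕ) {M : Set (Euc m)} (t : ℝ)
    (A : SmoothFun M →ₗ[ℂ] SmoothFun M) : Prop :=
  ∀ κ : OpenPartialHomeomorph M (Euc n), IsSmoothChart κ → ∀ φ ψ : SmoothFun M,
    tsupport (φ : M → ℂ) ⊆ κ.source → tsupport (ψ : M → ℂ) ⊆ κ.source →
      ∀ a : Euc n → Euc n → ℂ, IsSymbol t a → IsLocalSymbol A κ φ ψ a →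
        ∀ p ∈ κ.source, (φ : M → ℂ) p ≠ 0 → (ψ : M → ℂ) p ≠ 0 →
          ∃ c > (0 : ℝ), ∃ R : ℝ, ∀ᶠ y in 𝓝 (κ p), ∀ ξ : Euc n, R ≤ ‖ξ‖ →
            c * (1 + ‖ξ‖) ^ t ≤ ‖a y ξ‖

/-- The surface measure of an `n`-dimensional submanifold `M` of `ℝᵐ`: the `n`-dimensional Hausdorff
measure, normalized as Lebesgue measure. -/
def surfaceMeasure {m : ℕ} (n : ℕ) (M : Set (Euc m)) : Measure M :=
  Measure.euclideanHausdorffMeasure n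

/-- The inner product `⟨f, g⟩ = ∫ f \bar g` of `L²(M)` on smooth functions. -/
def innerL2 {m : ℕ} (n : ℕ) {M : Set (Euc m)} (f g : SmoothFun M) : ℂ :=
  ∫ x, (f : M → ℂ) x * conj ((g : M → ℂ) x) ∂(surfaceMeasure n M)

/-- (Formal) self-adjointness of an operator on `C^∞(M)` with respect to `L²(M)`. -/
def IsSelfAdjointOp {m : ℕ} (n : ℕ) {M : Set (Euc m)} (A : SmoothFun M →ₗ[ℂ] SmoothFun M) : Prop :=
  ∀ f g : SmoothFun M, innerL2 n (A f) g = innerL2 n f (A g)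

/-- `e` is an orthonormal basis of `L²(M)` consisting of (smooth) eigenfunctions of `D`, with
eigenvalues `ev k` enumerated, with multiplicity, by nondecreasing absolute value. -/
structure IsEigenbasis {m : ℕ} (n : ℕ) {M : Set (Euc m)} (D : SmoothFun M →ₗ[ℂ] SmoothFun M)
    (e : ℕ → SmoothFun M) (ev : ℕ → ℝ) : Prop where
  eigen : ∀ k, D (e k) = (ev k : ℂ) • e k
  mono : Monotone fun k => |ev k|
  basis : ∃ b : HilbertBasis ℕ ℂ (Lp ℂ 2 (surfaceMeasure n M)),
    ∀ k, (b k : M → ℂ) =ᵐ[surfaceMeasure n M] (e k : M → ℂ)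

/-- The finite-rank operator `T_{(N)}(τ) f = ∑_{j,k=0}^N ⟨τ e_k, e_j⟩ ⟨f, e_k⟩ e_j`. -/
def truncation {m : ℕ} (n : ℕ) {M : Set (Euc m)} (e : ℕ → SmoothFun M) (N : ℕ)
    (τ : SmoothFun M →ₗ[ℂ] SmoothFun M) (f : SmoothFun M) : SmoothFun M :=
  ∑ j ∈ Finset.range (N + 1), ∑ k ∈ Finset.range (N + 1),
    (innerL2 n (τ (e k)) (e j) * innerL2 n f (e k)) • e j

/-- A finite atlas of `M` with a subordinate smooth partition of unity: the data which determine the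
norms of the Sobolev spaces `H^s(M)`. -/
structure SobolevAtlas {m : ℕ} (n : ℕ) (M : Set (Euc m)) where
  size : ℕ
  chart : Fin size → OpenPartialHomeomorph M (Euc n)
  smooth : ∀ i, IsSmoothChart (chart i)
  cutoff : Fin size → SmoothFun M
  subordinate : ∀ i, tsupport (cutoff i : M → ℂ) ⊆ (chart i).source
  unit_interval : ∀ i x, ∃ r ∈ Icc (0 : ℝ) 1, (cutoff i : M → ℂ) x = r
  partition : ∀ x, ∑ i, (cutoff i : M → ℂ) x = 1

/-- The norm of `H^s(ℝⁿ)`: `‖u‖² = ∫ (1 + |ξ|²)^s |û(ξ)|² dξ`. -/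
def sobolevNormEuc {n : ℕ} (s : ℝ) (u : Euc n → ℂ) : ℝ≥0∞ :=
  (∫⁻ ξ : Euc n, ENNReal.ofReal ((1 + ‖ξ‖ ^ 2) ^ s * ‖𝓕 u ξ‖ ^ 2)) ^ (1 / 2 : ℝ)

/-- The norm of `H^s(M)` on the dense subspace `C^∞(M)`:
`‖f‖² = ∑ᵢ ‖(χᵢ f) ∘ κᵢ⁻¹‖²_{H^s(ℝⁿ)}`. -/
def sobolevNorm {m n : ℕ} {M : Set (Euc m)} (𝒜 : SobolevAtlas n M) (s : ℝ) (f : SmoothFun M) :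
    ℝ≥0∞ :=
  (∑ i, sobolevNormEuc s (chartPull (𝒜.chart i) (𝒜.cutoff i * f)) ^ 2) ^ (1 / 2 : ℝ)

/-- The norm in `𝓑(H^s(M), H^r(M))` of (the continuous extension of) an operator `A` on the dense
subspace `C^∞(M)`; it is `⊤` exactly when `A` has no bounded extension. -/
def opNorm {m n : ℕ} {M : Set (Euc m)} (𝒜 : SobolevAtlas n M) (s r : ℝ)
    (A : SmoothFun M → SmoothFun M) : ℝ≥0∞ :=
  sInf {C : ℝ≥0∞ | ∀ f : SmoothFun M, sobolevNorm 𝒜 r (A f) ≤ C * sobolevNorm 𝒜 s f}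

end

open scoped NNReal SchwartzMap

noncomputable section

/-! ### Weighted `L²` norms and dominated kernels -/

section Weights

variable {n : ℕ}

/-! Put `n = 2d - 1`, let `μ` be the order of `D`, and let `P` be the orthogonal projection to the
span of `e 0, …, e N`. Then `T_(N)(τ) = PτP`, and `τ - PτP = (1 - P)τ + Pτ(1 - P)`. In the first
term `1 - P` acts from `H^{3/2-t}` to `H^{1/2}`, in the second from `H^{3/2}` to `H^{1/2+t}`. Both
times `1 - t` orders are given away, so its norm is `O((1 + |λ_N|)^{-(1-t)/μ})`; moreover `P` is
bounded on `H^{1/2}`. Weyl's bound `N + 1 ≤ C (1 + |λ_N|)^{n/μ}` turns this into `N^{-(1-t)/n}`. All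
constants must be uniform in the eigenbasis.

The estimates of `P` and `1 - P` compare the norm of `H^s` with the spectral norm `(∑ (1 +
|λ_k|)^{2s/μ} |⟨f, e_k⟩|²)^{1/2}`. `exists_sobolevNorm_sq_le_specSq` bounds the first by the second
for all `s` in a bounded range; `exists_specSq_le_sobolevNorm_sq` gives the converse for `s > 0`
only. This suffices, because the possibly negative order `1/2 + t` occurs only as a target order of
`1 - P`. At the orders `±kμ` and `0` the comparison comes from the elliptic estimate, from the
boundedness of powers of `D`, and from inverting `(D + i)^k` on eigenfunctions. The orders in
between follow by quadratic interpolation (`lintegral_interp_le`), which for weighted `L²` norms is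
an explicit computation.

Weyl's bound (`exists_le_mul_rpow_eigenvalue`) comes from a scaled Sobolev embedding applied to `∑
conj (e_k x) e_k`, whose value at `x` is `∑ |e_k x|²`, followed by integration over `x`.

The pseudodifferential calculus needed is boundedness on Sobolev spaces, the gain of one order in
commutators with functions, and the elliptic estimate. All of it follows from one observation: on
the Fourier side `b Op(a)` has the kernel `𝓕(b a(·, ξ))(η - ξ)`, and replacing `a(·, ξ)` by `a(·,
η)` costs only an operator of order `t - 1` (`IsSymbol.exists_enorm_fourier_sub_le`). With the
frequency frozen at the output `η`, the operator is a multiplication, so commutators cancel and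
elliptic symbols can be divided by. Neither a composition formula nor a parametrix is needed.

To pass to the manifold, Sobolev norms must be invariant under changes of charts (`pullBounded`).
Any two points must lie in one, possibly disconnected, chart, so that an operator is a finite sum of
pieces `Op(a)`. Finally, the surface measure must be comparable with Lebesgue measure in charts,
which identifies `L²` with `H⁰`. -/

theorem one_add_norm_pos (ξ : Euc n) : 0 < 1 + ‖ξ‖ := by positivity

theorem one_add_norm_sq_pos (ξ : Euc n) : 0 < 1 + ‖ξ‖ ^ 2 := by positivity

/-- Peetre's inequality. -/
theorem one_add_norm_rpow_le (r : ℝ) (η ξ : Euc n) :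
    (1 + ‖η‖) ^ r ≤ (1 + ‖ξ‖) ^ r * (1 + ‖η - ξ‖) ^ |r| := by
  have key : ∀ a b : Euc n, 1 + ‖a‖ ≤ (1 + ‖b‖) * (1 + ‖a - b‖) := by
    intro a b
    have : ‖a‖ ≤ ‖b‖ + ‖a - b‖ := by
      simpa using norm_add_le b (a - b)
    nlinarith [norm_nonneg b, norm_nonneg (a - b)]
  rcases le_total 0 r with hr | hr
  · rw [abs_of_nonneg hr, ← Real.mul_rpow (by positivity) (by positivity)]
    exact Real.rpow_le_rpow (by positivity) (key η ξ) hr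
  · rw [abs_of_nonpos hr, Real.rpow_neg (by positivity), ← div_eq_mul_inv,
      le_div_iff₀ (by positivity), ← Real.mul_rpow (by positivity) (by positivity)]
    refine Real.rpow_le_rpow_of_nonpos (by positivity) ?_ hr
    simpa [norm_sub_rev] using key ξ η

theorem one_add_norm_sq_rpow_le (s : ℝ) (ξ : Euc n) :
    (1 + ‖ξ‖ ^ 2) ^ s ≤ 2 ^ |s| * (1 + ‖ξ‖) ^ (2 * s) := by
  have h1 : 1 + ‖ξ‖ ^ 2 ≤ (1 + ‖ξ‖) ^ 2 := by nlinarith [norm_nonneg ξ]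
  have h2 : (1 + ‖ξ‖) ^ 2 ≤ 2 * (1 + ‖ξ‖ ^ 2) := by nlinarith [sq_nonneg (1 - ‖ξ‖)]
  rw [Real.rpow_mul (by positivity), Real.rpow_two]
  rcases le_total 0 s with hs | hs
  · calc (1 + ‖ξ‖ ^ 2) ^ s ≤ ((1 + ‖ξ‖) ^ 2) ^ s := Real.rpow_le_rpow (by positivity) h1 hs
      _ ≤ _ := le_mul_of_one_le_left (by positivity) (Real.one_le_rpow (by norm_num) (abs_nonneg s))
  · rw [abs_of_nonpos hs, Real.rpow_neg (by norm_num), inv_mul_eq_div, le_div_iff₀ (by positivity),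
      mul_comm, ← Real.mul_rpow (by positivity) (by positivity)]
    exact Real.rpow_le_rpow_of_nonpos (by positivity) h2 hs

theorem one_add_norm_rpow_le_sq (s : ℝ) (ξ : Euc n) :
    (1 + ‖ξ‖) ^ (2 * s) ≤ 2 ^ |s| * (1 + ‖ξ‖ ^ 2) ^ s := by
  have h := one_add_norm_sq_rpow_le (-s) ξ
  rw [abs_neg, Real.rpow_neg (by positivity), mul_neg, Real.rpow_neg (by positivity)] at h
  have p1 : 0 < (1 + ‖ξ‖ ^ 2) ^ s := by positivity
  have p2 : 0 < (1 + ‖ξ‖) ^ (2 * s) := by positivity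
  rw [← div_eq_mul_inv, inv_eq_one_div, div_le_div_iff₀ p1 p2] at h
  linarith

/-- The square of the weighted `L²` norm with weight `(1 + ‖ξ‖²)^s`. -/
def wsq (s : ℝ) (U : Euc n → ℝ≥0∞) : ℝ≥0∞ :=
  ∫⁻ ξ, ENNReal.ofReal ((1 + ‖ξ‖ ^ 2) ^ s) * U ξ ^ 2

/-- The weighted `L²` norm with weight `(1 + ‖ξ‖²)^s`. -/
def wnorm (s : ℝ) (U : Euc n → ℝ≥0∞) : ℝ≥0∞ := wsq s U ^ (1 / 2 : ℝ)

theorem sq_rpow_half (x : ℝ≥0∞) : (x ^ 2) ^ (1 / 2 : ℝ) = x := by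
  rw [← ENNReal.rpow_natCast, ← ENNReal.rpow_mul]; norm_num

theorem rpow_half_sq (x : ℝ≥0∞) : (x ^ (1 / 2 : ℝ)) ^ 2 = x := by
  rw [← ENNReal.rpow_natCast, ← ENNReal.rpow_mul]; norm_num

theorem wnorm_sq (s : ℝ) (U : Euc n → ℝ≥0∞) : wnorm s U ^ 2 = wsq s U := rpow_half_sq _

theorem measurable_weight (s : ℝ) :
    Measurable fun ξ : Euc n => ENNReal.ofReal ((1 + ‖ξ‖ ^ 2) ^ s) := by fun_prop

theorem wnorm_mono {s : ℝ} {U V : Euc n → ℝ≥0∞} (h : ∀ ξ, U ξ ≤ V ξ) : wnorm s U ≤ wnorm s V := by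
  unfold wnorm wsq
  gcongr with ξ
  exact h ξ

theorem wnorm_mono_left {s r : ℝ} (h : s ≤ r) (U : Euc n → ℝ≥0∞) : wnorm s U ≤ wnorm r U := by
  unfold wnorm wsq
  gcongr with ξ
  nlinarith [sq_nonneg ‖ξ‖]

theorem wnorm_const_mul {s : ℝ} (c : ℝ≥0) (U : Euc n → ℝ≥0∞) :
    wnorm s (fun ξ => c * U ξ) = c * wnorm s U := by
  unfold wnorm wsq
  have : ∀ ξ, ENNReal.ofReal ((1 + ‖ξ‖ ^ 2) ^ s) * (c * U ξ) ^ 2 =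
      (c : ℝ≥0∞) ^ 2 * (ENNReal.ofReal ((1 + ‖ξ‖ ^ 2) ^ s) * U ξ ^ 2) := fun ξ => by ring
  simp_rw [this]
  rw [lintegral_const_mul' _ _ (by simp), ENNReal.mul_rpow_of_nonneg _ _ (by norm_num), sq_rpow_half]

theorem rpow_sq_eq {x : ℝ} (hx : 0 ≤ x) (s : ℝ) : (x ^ s) ^ 2 = x ^ (2 * s) := by
  rw [← Real.rpow_natCast, ← Real.rpow_mul hx, mul_comm]; norm_num

theorem wnorm_eq_Lp (s : ℝ) (U : Euc n → ℝ≥0∞) :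
    wnorm s U = (∫⁻ ξ, (ENNReal.ofReal ((1 + ‖ξ‖ ^ 2) ^ (s / 2)) * U ξ) ^ (2 : ℝ)) ^ (1 / 2 : ℝ) := by
  unfold wnorm wsq
  congr 2 with ξ
  rw [ENNReal.rpow_two, mul_pow, ← ENNReal.ofReal_pow (by positivity), rpow_sq_eq (by positivity),
    mul_div_cancel₀ _ two_ne_zero]

theorem wnorm_add_le {s : ℝ} {U V : Euc n → ℝ≥0∞} (hU : Measurable U) (hV : Measurable V) :
    wnorm s (fun ξ => U ξ + V ξ) ≤ wnorm s U + wnorm s V := by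
  simp only [wnorm_eq_Lp, mul_add]
  exact ENNReal.lintegral_Lp_add_le ((measurable_weight _).mul hU).aemeasurable
    ((measurable_weight _).mul hV).aemeasurable (by norm_num)

/-- Cauchy–Schwarz for a convolution. -/
theorem sq_lintegral_mul_le {α : Type*} [MeasurableSpace α] {ν : Measure α} {k V : α → ℝ≥0∞}
    (hk : Measurable k) (hV : Measurable V) :
    (∫⁻ x, k x * V x ∂ν) ^ 2 ≤ (∫⁻ x, k x ∂ν) * ∫⁻ x, k x * V x ^ 2 ∂ν := by
  have h := ENNReal.lintegral_mul_le_Lp_mul_Lq ν (p := 2) (q := 2)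
    (f := fun x => k x ^ (1 / 2 : ℝ)) (g := fun x => k x ^ (1 / 2 : ℝ) * V x)
    (by constructor <;> norm_num) (by fun_prop) (by fun_prop)
  have e1 : ∀ x, ((fun x => k x ^ (1 / 2 : ℝ)) * fun x => k x ^ (1 / 2 : ℝ) * V x) x = k x * V x := by
    intro x
    simp only [Pi.mul_apply, ← mul_assoc]
    rw [← sq, rpow_half_sq]
  simp_rw [e1, ENNReal.rpow_two, mul_pow, rpow_half_sq] at h
  calc _ ≤ _ := pow_le_pow_left₀ (by positivity) h 2
    _ = _ := by rw [mul_pow, rpow_half_sq, rpow_half_sq]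

/-- Young's inequality for an `L¹` kernel on `L²`: Cauchy–Schwarz for the measure `k(η - ξ) dξ`,
then Tonelli and translation invariance. -/
theorem sq_convolution_le {k V : Euc n → ℝ≥0∞} (hk : Measurable k) (hV : Measurable V) :
    ∫⁻ η, (∫⁻ ξ, k (η - ξ) * V ξ) ^ 2 ≤ (∫⁻ ξ, k ξ) ^ 2 * ∫⁻ ξ, V ξ ^ 2 := by
  calc ∫⁻ η, (∫⁻ ξ, k (η - ξ) * V ξ) ^ 2
      ≤ ∫⁻ η, (∫⁻ ξ, k ξ) * ∫⁻ ξ, k (η - ξ) * V ξ ^ 2 := by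
        gcongr with η
        refine (sq_lintegral_mul_le (by fun_prop) hV).trans_eq ?_
        rw [lintegral_sub_left_eq_self k η]
    _ = (∫⁻ ξ, k ξ) * ∫⁻ ξ, ∫⁻ η, k (η - ξ) * V ξ ^ 2 := by
        rw [lintegral_const_mul _ (by fun_prop)]
        rw [lintegral_lintegral_swap (by fun_prop)]
    _ = _ := by
        have : ∀ ξ : Euc n, ∫⁻ η, k (η - ξ) * V ξ ^ 2 = (∫⁻ ξ, k ξ) * V ξ ^ 2 := by
          intro ξ
          rw [lintegral_mul_const _ (by fun_prop), lintegral_sub_right_eq_self k ξ]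
        simp_rw [this]
        rw [lintegral_const_mul _ (by fun_prop)]
        ring

/-- An operator whose Fourier kernel is `O((1 + ‖η - ξ‖)^{-N} (1 + ‖ξ‖)^t)` has order `t`. -/
theorem exists_wnorm_le_of_kernel_le (r t N C : ℝ) (hN : (n : ℝ) + |r| < N) :
    ∃ C' : ℝ≥0, ∀ g U : Euc n → ℝ≥0∞, Measurable U →
      (∀ η, g η ≤ ∫⁻ ξ, ENNReal.ofReal (C * (1 + ‖η - ξ‖) ^ (-N) * (1 + ‖ξ‖) ^ t) * U ξ) →
      wnorm r g ≤ C' * wnorm (r + t) U := by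
  have hint : Integrable fun ξ : Euc n => (1 + ‖ξ‖) ^ (-(N - |r|)) :=
    integrable_one_add_norm (by simp; linarith)
  set k : Euc n → ℝ≥0∞ := fun ξ => ENNReal.ofReal (|C| * (1 + ‖ξ‖) ^ (-(N - |r|))) with hk
  have hkm : Measurable k := by fun_prop
  have hkfin : ∫⁻ ξ, k ξ ≠ ⊤ := (hint.const_mul |C|).lintegral_lt_top.ne
  set c : ℝ := 2 ^ |r| * 2 ^ |r + t|
  refine ⟨((ENNReal.ofReal c) ^ (1 / 2 : ℝ) * ∫⁻ ξ, k ξ).toNNReal, fun g U hU hg => ?_⟩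
  rw [ENNReal.coe_toNNReal (ENNReal.mul_ne_top (by simp) hkfin)]
  set V : Euc n → ℝ≥0∞ := fun ξ => ENNReal.ofReal ((1 + ‖ξ‖) ^ (r + t)) * U ξ with hV
  have hVm : Measurable V := by fun_prop
  -- Peetre's inequality moves the weight from `η` to `ξ` at the price of `(1 + ‖η - ξ‖) ^ |r|`. The
  -- kernel stays integrable because `n + |r| < N`.
  have h1 : ∀ η, ENNReal.ofReal ((1 + ‖η‖) ^ r) * g η ≤ ∫⁻ ξ, k (η - ξ) * V ξ := by
    intro η
    calc _ ≤ ENNReal.ofReal ((1 + ‖η‖) ^ r) *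
          ∫⁻ ξ, ENNReal.ofReal (C * (1 + ‖η - ξ‖) ^ (-N) * (1 + ‖ξ‖) ^ t) * U ξ := by
          gcongr; exact hg η
      _ = ∫⁻ ξ, ENNReal.ofReal ((1 + ‖η‖) ^ r) *
          (ENNReal.ofReal (C * (1 + ‖η - ξ‖) ^ (-N) * (1 + ‖ξ‖) ^ t) * U ξ) := by
          rw [lintegral_const_mul' _ _ (by simp)]
      _ ≤ _ := by
          refine lintegral_mono fun ξ => ?_
          simp only [hk, hV]
          rw [← mul_assoc, ← mul_assoc, ← ENNReal.ofReal_mul (by positivity),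
            ← ENNReal.ofReal_mul (by positivity)]
          refine mul_le_mul_left (ENNReal.ofReal_le_ofReal ?_) _
          have p1 : 0 < (1 + ‖η - ξ‖) ^ (-N) := by positivity
          have p2 : 0 < (1 + ‖ξ‖) ^ t := by positivity
          calc (1 + ‖η‖) ^ r * (C * (1 + ‖η - ξ‖) ^ (-N) * (1 + ‖ξ‖) ^ t)
              ≤ (1 + ‖η‖) ^ r * (|C| * (1 + ‖η - ξ‖) ^ (-N) * (1 + ‖ξ‖) ^ t) := by
                gcongr; exact le_abs_self C
            _ ≤ ((1 + ‖ξ‖) ^ r * (1 + ‖η - ξ‖) ^ |r|) *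
                (|C| * (1 + ‖η - ξ‖) ^ (-N) * (1 + ‖ξ‖) ^ t) := by
                gcongr; exact one_add_norm_rpow_le r η ξ
            _ = |C| * ((1 + ‖η - ξ‖) ^ |r| * (1 + ‖η - ξ‖) ^ (-N)) *
                ((1 + ‖ξ‖) ^ r * (1 + ‖ξ‖) ^ t) := by ring
            _ = _ := by
                rw [← Real.rpow_add (by positivity), ← Real.rpow_add (by positivity)]
                congr 3
                ring
  have h2 : wsq r g ≤ ENNReal.ofReal (2 ^ |r|) *
      ∫⁻ η, (ENNReal.ofReal ((1 + ‖η‖) ^ r) * g η) ^ 2 := by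
    unfold wsq
    rw [← lintegral_const_mul' _ _ (by simp)]
    refine lintegral_mono fun η => ?_
    rw [mul_pow, ← mul_assoc, ← ENNReal.ofReal_pow (by positivity),
      ← ENNReal.ofReal_mul (by positivity)]
    rw [rpow_sq_eq (by positivity)]
    gcongr
    exact one_add_norm_sq_rpow_le r η
  have h3 : ∫⁻ ξ, V ξ ^ 2 ≤ ENNReal.ofReal (2 ^ |r + t|) * wsq (r + t) U := by
    unfold wsq
    rw [← lintegral_const_mul' _ _ (by simp)]
    refine lintegral_mono fun ξ => ?_
    simp only [hV]
    rw [mul_pow, ← mul_assoc, ← ENNReal.ofReal_pow (by positivity),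
      ← ENNReal.ofReal_mul (by positivity)]
    rw [rpow_sq_eq (by positivity)]
    gcongr
    exact one_add_norm_rpow_le_sq (r + t) ξ
  have h4 : wsq r g ≤ ENNReal.ofReal c * (∫⁻ ξ, k ξ) ^ 2 * wsq (r + t) U := by
    calc wsq r g ≤ ENNReal.ofReal (2 ^ |r|) * ∫⁻ η, (∫⁻ ξ, k (η - ξ) * V ξ) ^ 2 := by
          refine h2.trans ?_
          gcongr with η
          exact h1 η
      _ ≤ ENNReal.ofReal (2 ^ |r|) * ((∫⁻ ξ, k ξ) ^ 2 *
          (ENNReal.ofReal (2 ^ |r + t|) * wsq (r + t) U)) := by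
          gcongr
          exact (sq_convolution_le hkm hVm).trans (by gcongr)
      _ = _ := by
          simp only [c]
          rw [ENNReal.ofReal_mul (by positivity)]; ring
  unfold wnorm
  calc _ ≤ _ := ENNReal.rpow_le_rpow h4 (by norm_num)
    _ = _ := by
      rw [ENNReal.mul_rpow_of_nonneg _ _ (by norm_num), ENNReal.mul_rpow_of_nonneg _ _ (by norm_num),
        sq_rpow_half]

end Weights

/-! ### Decay of Fourier transforms and symbols -/

section FourierDecay

variable {n : ℕ}

/-- `b` is smooth, supported in the ball of radius `ρ`, with derivatives up to order `N` bounded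
by `B`. -/
structure IsBump (ρ : ℝ) (N : ℕ) (B : ℝ) (b : Euc n → ℂ) : Prop where
  smooth : ContDiff ℝ ∞ b
  supp : Function.support b ⊆ Metric.closedBall 0 ρ
  bound : ∀ i ≤ N, ∀ x, ‖iteratedFDeriv ℝ i b x‖ ≤ B

theorem IsBump.nonneg {ρ B : ℝ} {N : ℕ} {b : Euc n → ℂ} (h : IsBump ρ N B b) : 0 ≤ B :=
  (norm_nonneg _).trans (h.bound 0 (Nat.zero_le _) 0)

theorem IsBump.hasCompactSupport {ρ B : ℝ} {N : ℕ} {b : Euc n → ℂ} (h : IsBump ρ N B b) :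
    HasCompactSupport b :=
  HasCompactSupport.of_support_subset_isCompact (isCompact_closedBall 0 ρ) h.supp

theorem IsBump.tsupport_subset {ρ B : ℝ} {N : ℕ} {b : Euc n → ℂ} (h : IsBump ρ N B b) :
    tsupport b ⊆ Metric.closedBall 0 ρ :=
  closure_minimal h.supp Metric.isClosed_closedBall

theorem IsBump.integral_norm_iteratedFDeriv_le {ρ B : ℝ} {N : ℕ} {b : Euc n → ℂ}
    (h : IsBump ρ N B b) {i : ℕ} (hi : i ≤ N) :
    ∫ x, ‖iteratedFDeriv ℝ i b x‖ ≤ B * (volume (Metric.closedBall (0 : Euc n) ρ)).toReal := by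
  have hs : Function.support (fun x => ‖iteratedFDeriv ℝ i b x‖) ⊆ Metric.closedBall 0 ρ := by
    intro x hx
    exact h.tsupport_subset (support_iteratedFDeriv_subset i (norm_ne_zero_iff.1 hx))
  rw [← setIntegral_eq_integral_of_forall_compl_eq_zero (s := Metric.closedBall (0 : Euc n) ρ)
    (fun x hx => by by_contra h0; exact hx (hs h0))]
  have := norm_setIntegral_le_of_norm_le_const (f := fun x => ‖iteratedFDeriv ℝ i b x‖)
    (μ := volume) (s := Metric.closedBall (0 : Euc n) ρ) (C := B)
    measure_closedBall_lt_top (fun x _ => by simpa using h.bound i hi x)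
  exact (le_abs_self _).trans this

/-- Integration by parts `N` times. The constant depends on the radius and on `N` only, and the
bound is linear in `B`; this uniformity is needed because the cutoffs of the elliptic estimate vary
with the frequency. -/
theorem exists_norm_fourier_le (ρ : ℝ) (N : ℕ) : ∃ C : ℝ, 0 ≤ C ∧ ∀ (b : Euc n → ℂ) (B : ℝ),
    IsBump ρ N B b → ∀ ζ, ‖𝓕 b ζ‖ ≤ C * B * (1 + ‖ζ‖) ^ (-(N : ℝ)) := by
  set v := (volume (Metric.closedBall (0 : Euc n) ρ)).toReal
  have hv : 0 ≤ v := ENNReal.toReal_nonneg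
  refine ⟨2 ^ N * (2 ^ N * ((N + 1) * v) + v), by positivity, fun b B hb ζ => ?_⟩
  have hB := hb.nonneg
  have key : ∀ j ≤ N, ‖ζ‖ ^ j * ‖𝓕 b ζ‖ ≤ 2 ^ j * ((j + 1) * (B * v)) := by
    intro j hj
    have hint : ∀ (k i : ℕ), (k : ℕ∞) ≤ 0 → (i : ℕ∞) ≤ (N : ℕ∞) →
        Integrable fun x => ‖x‖ ^ k * ‖iteratedFDeriv ℝ i b x‖ := by
      intro k i _ _
      apply Continuous.integrable_of_hasCompactSupport
      · have := hb.smooth.continuous_iteratedFDeriv (m := i) (by exact_mod_cast le_top)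
        fun_prop
      · exact (hb.hasCompactSupport.iteratedFDeriv (𝕜 := ℝ) i).norm.mul_left
    have h := Real.pow_mul_norm_iteratedFDeriv_fourier_le (K := 0) (N := (N : ℕ∞)) (f := b)
      (hb.smooth.of_le (by exact_mod_cast le_top)) hint (k := 0) (n := j) le_rfl
      (by exact_mod_cast hj) ζ
    simp only [norm_iteratedFDeriv_zero, pow_zero, Nat.cast_zero, mul_zero, zero_add, one_mul,
      Finset.sum_product, Finset.range_one, Finset.sum_singleton] at h
    refine h.trans ?_
    gcongr
    calc _ ≤ ∑ _i ∈ Finset.range (j + 1), B * v := by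
          refine Finset.sum_le_sum fun i hi => hb.integral_norm_iteratedFDeriv_le ?_
          have := Finset.mem_range.1 hi
          omega
      _ = _ := by simp
  have h0 := key 0 (Nat.zero_le _)
  have hN := key N le_rfl
  simp only [pow_zero, one_mul, Nat.cast_zero, zero_add] at h0
  rw [Real.rpow_neg (by positivity), ← div_eq_mul_inv, le_div_iff₀ (by positivity),
    Real.rpow_natCast]
  have h1 : (1 + ‖ζ‖) ^ N ≤ 2 ^ N * (1 + ‖ζ‖ ^ N) := by
    calc (1 + ‖ζ‖) ^ N ≤ 2 ^ (N - 1) * (1 ^ N + ‖ζ‖ ^ N) :=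
          add_pow_le (by norm_num) (norm_nonneg _) N
      _ ≤ _ := by
          rw [one_pow]; gcongr
          · norm_num
          · omega
  calc ‖𝓕 b ζ‖ * (1 + ‖ζ‖) ^ N ≤ ‖𝓕 b ζ‖ * (2 ^ N * (1 + ‖ζ‖ ^ N)) := by gcongr
    _ = 2 ^ N * (‖ζ‖ ^ N * ‖𝓕 b ζ‖ + ‖𝓕 b ζ‖) := by ring
    _ ≤ 2 ^ N * (2 ^ N * ((N + 1) * (B * v)) + B * v) := by gcongr
    _ = _ := by ring

theorem IsBump.mul {ρ A B : ℝ} {N : ℕ} {b f : Euc n → ℂ} (hb : IsBump ρ N B b)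
    (hf : ContDiff ℝ ∞ f) (hA : ∀ i ≤ N, ∀ x, ‖iteratedFDeriv ℝ i f x‖ ≤ A) :
    IsBump ρ N (2 ^ N * B * A) (fun x => b x * f x) where
  smooth := hb.smooth.mul hf
  supp := (Function.support_mul_subset_left _ _).trans hb.supp
  bound i hi x := by
    have hB := hb.nonneg
    have hA0 : 0 ≤ A := (norm_nonneg _).trans (hA 0 (Nat.zero_le _) 0)
    calc _ ≤ ∑ j ∈ Finset.range (i + 1), (i.choose j : ℝ) * ‖iteratedFDeriv ℝ j b x‖ *
          ‖iteratedFDeriv ℝ (i - j) f x‖ :=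
          norm_iteratedFDeriv_mul_le hb.smooth hf x (by exact_mod_cast le_top)
      _ ≤ ∑ j ∈ Finset.range (i + 1), (i.choose j : ℝ) * B * A := by
          refine Finset.sum_le_sum fun j hj => ?_
          have := Finset.mem_range.1 hj
          gcongr
          · exact hb.bound j (by omega) x
          · exact hA (i - j) (by omega) x
      _ = 2 ^ i * B * A := by
          rw [← Finset.sum_mul, ← Finset.sum_mul]
          congr 2
          exact_mod_cast Nat.sum_range_choose i
      _ ≤ _ := by gcongr; norm_num

theorem exists_forall_le_of_forall_exists {P : ℕ → ℝ → Prop}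
    (mono : ∀ i C C', C ≤ C' → P i C → P i C') (h : ∀ i, ∃ C, P i C) (N : ℕ) :
    ∃ C, 0 ≤ C ∧ ∀ i ≤ N, P i C := by
  choose C hC using h
  refine ⟨∑ i ∈ Finset.range (N + 1), |C i|, by positivity, fun i hi => mono i _ _ ?_ (hC i)⟩
  exact (le_abs_self _).trans (Finset.single_le_sum (f := fun i => |C i|) (fun _ _ => abs_nonneg _)
    (Finset.mem_range.2 (by omega)))

theorem exists_isBump {b : Euc n → ℂ} (hb : ContDiff ℝ ∞ b) (hc : HasCompactSupport b) :
    ∃ ρ, ∀ N, ∃ B, IsBump ρ N B b := by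
  obtain ⟨ρ, hρ⟩ := hc.isCompact.isBounded.subset_closedBall (0 : Euc n)
  refine ⟨ρ, fun N => ?_⟩
  obtain ⟨B, -, hB⟩ := exists_forall_le_of_forall_exists
    (P := fun i C => ∀ x, ‖iteratedFDeriv ℝ i b x‖ ≤ C)
    (fun i C C' h hC x => (hC x).trans h) (fun i => by
      have h1 := hb.continuous_iteratedFDeriv (m := i) (by exact_mod_cast le_top)
      exact (hc.iteratedFDeriv (𝕜 := ℝ) i).exists_bound_of_continuous h1) N
  exact ⟨B, hb, (subset_tsupport b).trans hρ, hB⟩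

end FourierDecay

/-! ### Fourier decay of localized symbols. -/

section Symbols

variable {n : ℕ} {t : ℝ} {a : Euc n → Euc n → ℂ}

theorem IsSymbol.smooth_left (ha : IsSymbol t a) (ξ : Euc n) : ContDiff ℝ ∞ fun x => a x ξ :=
  ha.1.comp (contDiff_id.prodMk contDiff_const)

theorem IsSymbol.smooth_right (ha : IsSymbol t a) (x : Euc n) : ContDiff ℝ ∞ (a x) :=
  ha.1.comp (contDiff_const.prodMk contDiff_id)

theorem IsSymbol.continuous (ha : IsSymbol t a) : Continuous (Function.uncurry a) := ha.1.continuous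

theorem IsSymbol.fderiv_eq (ha : IsSymbol t a) (x ξ v : Euc n) :
    fderiv ℝ (a x) ξ v = fderiv ℝ (Function.uncurry a) (x, ξ) (0, v) := by
  have h1 : HasFDerivAt (Function.uncurry a) (fderiv ℝ (Function.uncurry a) (x, ξ)) (x, ξ) :=
    (ha.1.differentiable (by simp)).differentiableAt.hasFDerivAt
  have h2 := h1.comp ξ ((hasFDerivAt_const x ξ).prodMk (hasFDerivAt_id ξ))
  have h3 : a x = Function.uncurry a ∘ fun y => (x, y) := rfl
  rw [h3, h2.fderiv]
  simp

theorem IsSymbol.smooth_fderiv (ha : IsSymbol t a) (ξ v : Euc n) :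
    ContDiff ℝ ∞ fun x => fderiv ℝ (a x) ξ v := by
  simp_rw [ha.fderiv_eq]
  have h : ContDiff ℝ ∞ (fderiv ℝ (Function.uncurry a)) := ha.1.fderiv_right (by simp)
  exact (h.comp (contDiff_id.prodMk contDiff_const)).clm_apply contDiff_const

theorem IsSymbol.exists_bound (ha : IsSymbol t a) (N : ℕ) : ∃ C, 0 ≤ C ∧ ∀ i ≤ N, ∀ x ξ,
    ‖iteratedFDeriv ℝ i (fun x' => a x' ξ) x‖ ≤ C * (1 + ‖ξ‖) ^ t := by
  refine exists_forall_le_of_forall_exists (P := fun i C => ∀ x ξ,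
    ‖iteratedFDeriv ℝ i (fun x' => a x' ξ) x‖ ≤ C * (1 + ‖ξ‖) ^ t)
    (fun i C C' h hC x ξ => (hC x ξ).trans (by gcongr)) (fun i => ?_) N
  obtain ⟨C, hC⟩ := ha.2 i 0
  refine ⟨C, fun x ξ => ?_⟩
  have := hC x ξ
  simp only [Nat.cast_zero, sub_zero] at this
  refine le_trans (le_of_eq ?_) this
  -- For `j = 0` the symbol estimate concerns a function with values in multilinear maps in no
  -- variables; an isometry identifies these with numbers.
  have e : (fun x' => iteratedFDeriv ℝ 0 (a x') ξ) =
      (continuousMultilinearCurryFin0 ℝ (Euc n) ℂ).symm ∘ fun x' => a x' ξ := by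
    ext x' m; simp
  rw [e, LinearIsometryEquiv.norm_iteratedFDeriv_comp_left]

theorem IsSymbol.exists_bound_fderiv (ha : IsSymbol t a) (N : ℕ) : ∃ C, 0 ≤ C ∧ ∀ i ≤ N, ∀ x ξ v,
    ‖iteratedFDeriv ℝ i (fun x' => fderiv ℝ (a x') ξ v) x‖ ≤ C * ‖v‖ * (1 + ‖ξ‖) ^ (t - 1) := by
  refine exists_forall_le_of_forall_exists (P := fun i C => ∀ x ξ v,
    ‖iteratedFDeriv ℝ i (fun x' => fderiv ℝ (a x') ξ v) x‖ ≤ C * ‖v‖ * (1 + ‖ξ‖) ^ (t - 1))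
    (fun i C C' h hC x ξ v => (hC x ξ v).trans (by gcongr)) (fun i => ?_) N
  obtain ⟨C, hC⟩ := ha.2 i 1
  refine ⟨C, fun x ξ v => ?_⟩
  have h1 := hC x ξ
  have hs : ContDiff ℝ ∞ fun x' => fderiv ℝ (a x') ξ := by
    refine contDiff_clm_apply_iff.2 fun v => ha.smooth_fderiv ξ v
  have e : (fun x' => iteratedFDeriv ℝ 1 (a x') ξ) =
      (continuousMultilinearCurryFin1 ℝ (Euc n) ℂ).symm ∘ fun x' => fderiv ℝ (a x') ξ := by
    ext x' m; simp [iteratedFDeriv_one_apply]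
  rw [e, LinearIsometryEquiv.norm_iteratedFDeriv_comp_left] at h1
  have e2 : (fun x' => fderiv ℝ (a x') ξ v) =
      (ContinuousLinearMap.apply ℝ ℂ v) ∘ fun x' => fderiv ℝ (a x') ξ := by
    ext x'; simp
  rw [e2]
  refine (ContinuousLinearMap.norm_iteratedFDeriv_comp_left _ (hs.contDiffAt)
    (by exact_mod_cast le_top)).trans ?_
  have h2 : ‖ContinuousLinearMap.apply ℝ ℂ v‖ ≤ ‖v‖ :=
    ContinuousLinearMap.opNorm_le_bound _ (norm_nonneg v) fun f => by
      simpa [mul_comm] using f.le_opNorm v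
  calc _ ≤ ‖v‖ * (C * (1 + ‖ξ‖) ^ (t - 1)) := by
        gcongr; simpa using h1
    _ = _ := by ring

theorem IsSymbol.exists_fourier_bound (ha : IsSymbol t a) (ρ : ℝ) (N : ℕ) : ∃ C, 0 ≤ C ∧
    ∀ (b : Euc n → ℂ) (B : ℝ), IsBump ρ N B b → ∀ ξ ζ,
    ‖𝓕 (fun x => b x * a x ξ) ζ‖ ≤ C * B * (1 + ‖ζ‖) ^ (-(N : ℝ)) * (1 + ‖ξ‖) ^ t := by
  obtain ⟨C1, h1, hC1⟩ := exists_norm_fourier_le (n := n) ρ N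
  obtain ⟨C2, h2, hC2⟩ := ha.exists_bound N
  refine ⟨C1 * 2 ^ N * C2, by positivity, fun b B hb ξ ζ => ?_⟩
  refine (hC1 _ _ (hb.mul (ha.smooth_left ξ) fun i hi x => hC2 i hi x ξ) ζ).trans_eq ?_
  ring

theorem IsSymbol.exists_fourier_bound_fderiv (ha : IsSymbol t a) (ρ : ℝ) (N : ℕ) : ∃ C, 0 ≤ C ∧
    ∀ (b : Euc n → ℂ) (B : ℝ), IsBump ρ N B b → ∀ ξ v ζ,
    ‖𝓕 (fun x => b x * fderiv ℝ (a x) ξ v) ζ‖ ≤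
      C * B * (1 + ‖ζ‖) ^ (-(N : ℝ)) * (‖v‖ * (1 + ‖ξ‖) ^ (t - 1)) := by
  obtain ⟨C1, h1, hC1⟩ := exists_norm_fourier_le (n := n) ρ N
  obtain ⟨C2, h2, hC2⟩ := ha.exists_bound_fderiv N
  refine ⟨C1 * 2 ^ N * C2, by positivity, fun b B hb ξ v ζ => ?_⟩
  refine (hC1 _ _ (hb.mul (ha.smooth_fderiv ξ v) fun i hi x => hC2 i hi x ξ v) ζ).trans_eq ?_
  ring

end Symbols

/-! ### Operators of symbols on `ℝⁿ` -/

section SymbolOp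

variable {n : ℕ} {t : ℝ} {a : Euc n → Euc n → ℂ}

theorem integrable_one_add_norm_rpow_mul (t : ℝ) (u : 𝓢(Euc n, ℂ)) :
    Integrable fun ξ => (1 + ‖ξ‖) ^ t * ‖u ξ‖ := by
  obtain ⟨k, hk⟩ := exists_nat_ge t
  have h0 := u.integrable_pow_mul volume 0
  have h1 := u.integrable_pow_mul volume k
  have hm : Continuous fun ξ : Euc n => (1 + ‖ξ‖) ^ t :=
    Continuous.rpow_const (by fun_prop) fun ξ => Or.inl (one_add_norm_pos ξ).ne'
  refine ((h0.add h1).const_mul (2 ^ k)).mono' (by fun_prop) (ae_of_all _ fun ξ => ?_)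
  simp only [Pi.add_apply, pow_zero, one_mul]
  rw [Real.norm_of_nonneg (by positivity)]
  have h2 : (1 + ‖ξ‖) ^ t ≤ 2 ^ k * (1 + ‖ξ‖ ^ k) := by
    calc (1 + ‖ξ‖) ^ t ≤ (1 + ‖ξ‖) ^ (k : ℝ) :=
          Real.rpow_le_rpow_of_exponent_le (by linarith [norm_nonneg ξ]) hk
      _ = (1 + ‖ξ‖) ^ k := Real.rpow_natCast _ _
      _ ≤ 2 ^ (k - 1) * (1 ^ k + ‖ξ‖ ^ k) := add_pow_le (by norm_num) (norm_nonneg _) k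
      _ ≤ _ := by
          rw [one_pow]; gcongr
          · norm_num
          · omega
  calc _ ≤ 2 ^ k * (1 + ‖ξ‖ ^ k) * ‖u ξ‖ := by gcongr
    _ = _ := by ring

theorem fourier_eq_integral (f : Euc n → ℂ) (η : Euc n) :
    𝓕 f η = ∫ x, Complex.exp (-(2 * Real.pi * Complex.I * (inner ℝ x η : ℝ))) * f x := by
  rw [Real.fourier_eq']
  congr 1 with x
  rw [smul_eq_mul]
  congr 2
  push_cast
  ring

theorem norm_exp_two_pi_mul (r : ℝ) : ‖Complex.exp (2 * Real.pi * Complex.I * (r : ℝ))‖ = 1 := by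
  have : (2 * Real.pi * Complex.I * (r : ℝ) : ℂ) = ((2 * Real.pi * r : ℝ) : ℂ) * Complex.I := by
    push_cast; ring
  rw [this, Complex.norm_exp_ofReal_mul_I]

theorem norm_exp_neg_two_pi_mul (r : ℝ) :
    ‖Complex.exp (-(2 * Real.pi * Complex.I * (r : ℝ)))‖ = 1 := by
  rw [Complex.exp_neg, norm_inv, norm_exp_two_pi_mul, inv_one]

theorem IsSymbol.exists_norm_le (ha : IsSymbol t a) : ∃ C, 0 ≤ C ∧ ∀ x ξ,
    ‖a x ξ‖ ≤ C * (1 + ‖ξ‖) ^ t := by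
  obtain ⟨C, h0, hC⟩ := ha.exists_bound 0
  exact ⟨C, h0, fun x ξ => by simpa using hC 0 le_rfl x ξ⟩

/-- Fubini. The kernel of `b Op(a)` on the Fourier side decays rapidly in `η - ξ` and grows like `(1
+ ‖ξ‖) ^ t`; all estimates for `Op(a)` use it only through these two properties and its smooth
dependence on `ξ`. -/
theorem IsSymbol.fourier_mul_symbolOp (ha : IsSymbol t a) {b : Euc n → ℂ} (hb : Continuous b)
    (hbi : HasCompactSupport b) (u : 𝓢(Euc n, ℂ)) (η : Euc n) :
    Integrable (fun ξ => 𝓕 (fun x => b x * a x ξ) (η - ξ) * 𝓕 (⇑u) ξ) ∧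
    𝓕 (fun x => b x * symbolOp a u x) η =
      ∫ ξ, 𝓕 (fun x => b x * a x ξ) (η - ξ) * 𝓕 (⇑u) ξ := by
  obtain ⟨C, hC0, hC⟩ := ha.exists_norm_le
  have hacont := ha.continuous
  have hcu : Continuous (𝓕 (u : Euc n → ℂ)) := by
    rw [← SchwartzMap.fourier_coe]; exact SchwartzMap.continuous _
  set F : Euc n → Euc n → ℂ := fun x ξ =>
    Complex.exp (-(2 * Real.pi * Complex.I * (inner ℝ x η : ℝ))) * (b x *
      (Complex.exp (2 * Real.pi * Complex.I * (inner ℝ ξ x : ℝ)) * a x ξ * 𝓕 (⇑u) ξ)) with hF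
  have hFi : Integrable (Function.uncurry F) (volume.prod volume) := by
    have h1 : Integrable fun x => ‖b x‖ := (hb.integrable_of_hasCompactSupport hbi).norm
    have h2 := (integrable_one_add_norm_rpow_mul t (𝓕 u)).const_mul C
    refine (h1.mul_prod h2).mono' ?_ (ae_of_all _ fun p => ?_)
    · apply Continuous.aestronglyMeasurable
      have h3 : Continuous fun p : Euc n × Euc n => a p.1 p.2 := hacont
      simp only [hF, Function.uncurry_def]
      fun_prop
    · simp only [hF, Function.uncurry_def, norm_mul, norm_exp_two_pi_mul, norm_exp_neg_two_pi_mul,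
        one_mul]
      rw [← mul_assoc C, SchwartzMap.fourier_coe]
      gcongr
      exact hC _ _
  have e1 : 𝓕 (fun x => b x * symbolOp a u x) η = ∫ x, ∫ ξ, F x ξ := by
    rw [fourier_eq_integral]
    simp only [hF, symbolOp]
    congr 1 with x
    rw [integral_const_mul, integral_const_mul]
  suffices e2 : ∀ ξ, ∫ x, F x ξ = 𝓕 (fun x => b x * a x ξ) (η - ξ) * 𝓕 (⇑u) ξ by
    refine ⟨?_, ?_⟩
    · simp only [← e2]
      exact hFi.integral_prod_right
    · rw [e1, integral_integral_swap hFi]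
      simp only [e2]
  intro ξ
  rw [fourier_eq_integral, ← integral_mul_const]
  congr 1 with x
  simp only [hF]
  have : Complex.exp (-(2 * Real.pi * Complex.I * (inner ℝ x (η - ξ) : ℝ))) =
      Complex.exp (-(2 * Real.pi * Complex.I * (inner ℝ x η : ℝ))) *
        Complex.exp (2 * Real.pi * Complex.I * (inner ℝ ξ x : ℝ)) := by
    rw [← Complex.exp_add, inner_sub_right, real_inner_comm x ξ]
    congr 1
    push_cast
    ring
  rw [this]
  ring

theorem symbolOp_const (f : Euc n → ℂ) (u : 𝓢(Euc n, ℂ)) (x : Euc n) :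
    symbolOp (fun x _ => f x) u x = f x * u x := by
  have h : 𝓕⁻ (𝓕 u) = u := FourierTransform.fourierInv_fourier_eq u
  have h1 : u x = 𝓕⁻ (𝓕 (u : Euc n → ℂ)) x := by
    conv_lhs => rw [← h]
    rw [SchwartzMap.fourierInv_coe, SchwartzMap.fourier_coe]
  rw [h1, Real.fourierInv_eq', ← integral_const_mul, symbolOp]
  congr 1 with ξ
  rw [smul_eq_mul]
  push_cast
  have : (2 * Real.pi * Complex.I * (inner ℝ ξ x : ℝ) : ℂ) =
      2 * Real.pi * (inner ℝ ξ x : ℝ) * Complex.I := by ring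
  rw [this]
  ring

/-- The identity is `Op(1)`, so estimates for multiplications are special cases of those for
`Op(a)`. -/
theorem isSymbol_one : IsSymbol 0 fun (_ _ : Euc n) => (1 : ℂ) := by
  refine ⟨contDiff_const, fun i j => ?_⟩
  rcases Nat.eq_zero_or_pos j with rfl | hj
  · refine ⟨1, fun x ξ => ?_⟩
    have e : (fun _ : Euc n => iteratedFDeriv ℝ 0 (fun _ : Euc n => (1 : ℂ)) ξ) =
        (continuousMultilinearCurryFin0 ℝ (Euc n) ℂ).symm ∘ fun _ => 1 := by
      ext x' m; simp
    rw [e, LinearIsometryEquiv.norm_iteratedFDeriv_comp_left]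
    rcases Nat.eq_zero_or_pos i with rfl | hi
    · simp
    · rw [iteratedFDeriv_const_of_ne (by omega)]
      simp
  · refine ⟨0, fun x ξ => ?_⟩
    have e : (fun _ : Euc n => iteratedFDeriv ℝ j (fun _ : Euc n => (1 : ℂ)) ξ) = 0 := by
      ext x' m
      rw [iteratedFDeriv_const_of_ne (by omega)]
      rfl
    rw [e]
    simp

theorem symbolOp_one (u : 𝓢(Euc n, ℂ)) : symbolOp (fun _ _ => 1) u = u := by
  ext x
  rw [symbolOp_const (fun _ => 1), one_mul]

theorem enorm_le_ofReal {x : ℂ} {r : ℝ} (h : ‖x‖ ≤ r) : ‖x‖ₑ ≤ ENNReal.ofReal r := by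
  rw [← ofReal_norm]; exact ENNReal.ofReal_le_ofReal h

theorem IsSymbol.exists_enorm_fourier_le (ha : IsSymbol t a) (ρ : ℝ) (N : ℕ) : ∃ C, 0 ≤ C ∧
    ∀ (b : Euc n → ℂ) (B : ℝ), IsBump ρ N B b → ∀ (u : 𝓢(Euc n, ℂ)) (η : Euc n),
    ‖𝓕 (fun x => b x * symbolOp a u x) η‖ₑ ≤ ∫⁻ ξ,
      ENNReal.ofReal (C * B * (1 + ‖η - ξ‖) ^ (-(N : ℝ)) * (1 + ‖ξ‖) ^ t) * ‖𝓕 (⇑u) ξ‖ₑ := by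
  obtain ⟨C, hC0, hC⟩ := ha.exists_fourier_bound ρ N
  refine ⟨C, hC0, fun b B hb u η => ?_⟩
  rw [(ha.fourier_mul_symbolOp hb.smooth.continuous hb.hasCompactSupport u η).2]
  refine (enorm_integral_le_lintegral_enorm _).trans (lintegral_mono fun ξ => ?_)
  rw [enorm_mul]
  gcongr
  exact enorm_le_ofReal (hC b B hb ξ (η - ξ))

/-- Freezing the frequency variable of a symbol gains one order. -/
theorem IsSymbol.exists_fourier_bound_sub (ha : IsSymbol t a) (ρ : ℝ) (N : ℕ) : ∃ C, 0 ≤ C ∧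
    ∀ (b : Euc n → ℂ) (B : ℝ), IsBump ρ N B b → ∀ ξ η ζ,
    ‖𝓕 (fun x => b x * a x ξ) ζ - 𝓕 (fun x => b x * a x η) ζ‖ ≤
      C * B * (1 + ‖ζ‖) ^ (-(N : ℝ)) * (‖η - ξ‖ * (1 + ‖η - ξ‖) ^ |t - 1| * (1 + ‖ξ‖) ^ (t - 1)) := by
  obtain ⟨C, hC0, hC⟩ := ha.exists_fourier_bound_fderiv ρ N
  obtain ⟨C', hC0', hC'⟩ := ha.exists_bound_fderiv 0
  refine ⟨C, hC0, fun b B hb ξ η ζ => ?_⟩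
  have hB := hb.nonneg
  -- Mean value inequality along the segment `ξ + s • v`, `0 ≤ s ≤ 1`, differentiating under the
  -- integral sign.
  set v := η - ξ with hv
  set F : ℝ → Euc n → ℂ := fun s x =>
    Complex.exp (-(2 * Real.pi * Complex.I * (inner ℝ x ζ : ℝ))) * (b x * a x (ξ + s • v))
  set F' : ℝ → Euc n → ℂ := fun s x =>
    Complex.exp (-(2 * Real.pi * Complex.I * (inner ℝ x ζ : ℝ))) *
      (b x * fderiv ℝ (a x) (ξ + s • v) v)
  have hbc := hb.smooth.continuous
  have hac : ∀ η, Continuous fun x => a x η := fun η => (ha.smooth_left η).continuous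
  have hac' : ∀ η, Continuous fun x => fderiv ℝ (a x) η v := fun η => (ha.smooth_fderiv η v).continuous
  have hFc : ∀ s, Continuous (F s) := fun s => by
    have := hac (ξ + s • v); fun_prop
  have hFc' : ∀ s, Continuous (F' s) := fun s => by
    have := hac' (ξ + s • v); fun_prop
  have hsupp : ∀ s, HasCompactSupport (F s) := fun s =>
    (hb.hasCompactSupport.mul_right).mul_left
  -- The dominating bound must hold on an open neighbourhood of `[0, 1]`; on `(-1, 2)` one has `‖s •
  -- v‖ ≤ 2 * ‖v‖`.
  set K : ℝ := C' * ‖v‖ * ((1 + ‖ξ‖) ^ (t - 1) * (1 + 2 * ‖v‖) ^ |t - 1|)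
  have hd : ∀ s ∈ Icc (0 : ℝ) 1, HasDerivAt (fun s => ∫ x, F s x) (∫ x, F' s x) s := by
    intro s hs
    have hnhds : Ioo (-1 : ℝ) 2 ∈ 𝓝 s := Ioo_mem_nhds (by linarith [hs.1]) (by linarith [hs.2])
    refine (hasDerivAt_integral_of_dominated_loc_of_deriv_le (bound := fun x => ‖b x‖ * K)
      hnhds ?_ ?_ ?_ ?_ ?_ ?_).2
    · exact Eventually.of_forall fun s => (hFc s).aestronglyMeasurable
    · exact (hFc s).integrable_of_hasCompactSupport (hsupp s)
    · exact (hFc' s).aestronglyMeasurable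
    · refine ae_of_all _ fun x s hs => ?_
      simp only [F', norm_mul, norm_exp_neg_two_pi_mul, one_mul]
      gcongr
      have h1 := hC' 0 le_rfl x (ξ + s • v) v
      rw [norm_iteratedFDeriv_zero] at h1
      refine h1.trans ?_
      simp only [K]
      gcongr
      refine (one_add_norm_rpow_le (t - 1) (ξ + s • v) ξ).trans ?_
      have : ‖ξ + s • v - ξ‖ ≤ 2 * ‖v‖ := by
        rw [add_sub_cancel_left, norm_smul]
        gcongr
        rw [Real.norm_eq_abs, abs_le]
        constructor <;> linarith [hs.1, hs.2]
      gcongr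
    · exact ((hbc.integrable_of_hasCompactSupport hb.hasCompactSupport).norm).mul_const K
    · refine ae_of_all _ fun x s _ => ?_
      have h1 : HasFDerivAt (a x) (fderiv ℝ (a x) (ξ + s • v)) (ξ + s • v) :=
        ((ha.smooth_right x).differentiable (by simp)).differentiableAt.hasFDerivAt
      have h2 : HasDerivAt (fun s : ℝ => ξ + s • v) v s := by
        simpa using ((hasDerivAt_id s).smul_const v).const_add ξ
      exact ((h1.comp_hasDerivAt s h2).const_mul (b x)).const_mul _
  have e : ∀ s, ∫ x, F s x = 𝓕 (fun x => b x * a x (ξ + s • v)) ζ := fun s => by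
    rw [fourier_eq_integral]
  have e' : ∀ s, ∫ x, F' s x = 𝓕 (fun x => b x * fderiv ℝ (a x) (ξ + s • v) v) ζ := fun s => by
    rw [fourier_eq_integral]
  have hmv := norm_image_sub_le_of_norm_deriv_le_segment_01'
    (f := fun s => ∫ x, F s x) (f' := fun s => ∫ x, F' s x)
    (C := C * B * (1 + ‖ζ‖) ^ (-(N : ℝ)) * (‖v‖ * (1 + ‖v‖) ^ |t - 1| * (1 + ‖ξ‖) ^ (t - 1)))
    (fun s hs => (hd s hs).hasDerivWithinAt) (fun s hs => by
      rw [e']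
      refine (hC b B hb (ξ + s • v) v ζ).trans ?_
      rw [mul_assoc ‖v‖]
      gcongr
      refine (one_add_norm_rpow_le (t - 1) (ξ + s • v) ξ).trans ?_
      rw [mul_comm]
      have : ‖ξ + s • v - ξ‖ ≤ ‖v‖ := by
        rw [add_sub_cancel_left, norm_smul]
        refine mul_le_of_le_one_left (norm_nonneg _) ?_
        rw [Real.norm_eq_abs, abs_le]
        constructor <;> linarith [hs.1, hs.2]
      gcongr)
  rw [norm_sub_rev]
  simpa [e, hv] using hmv

/-- Freezing the symbol at the output frequency `η` makes the main term the Fourier transform of an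
ordinary product, while the error has order `t - 1`. The error kernel grows polynomially in `η - ξ`;
asking for `N'` instead of `N` derivatives of the cutoff compensates for that. -/
theorem IsSymbol.exists_enorm_fourier_sub_le (ha : IsSymbol t a) (ρ : ℝ) (N : ℕ) :
    ∃ C, 0 ≤ C ∧ ∃ N' : ℕ,
    ∀ (b : Euc n → ℂ) (B : ℝ), IsBump ρ N' B b → ∀ (u : 𝓢(Euc n, ℂ)) (η : Euc n),
    ‖𝓕 (fun x => b x * symbolOp a u x) η - 𝓕 (fun x => b x * a x η * u x) η‖ₑ ≤ ∫⁻ ξ,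
      ENNReal.ofReal (C * B * (1 + ‖η - ξ‖) ^ (-(N : ℝ)) * (1 + ‖ξ‖) ^ (t - 1)) * ‖𝓕 (⇑u) ξ‖ₑ := by
  obtain ⟨k, hk⟩ := exists_nat_ge (1 + |t - 1|)
  obtain ⟨C, hC0, hC⟩ := ha.exists_fourier_bound_sub ρ (N + k)
  refine ⟨C, hC0, N + k, fun b B hb u η => ?_⟩
  have hB := hb.nonneg
  obtain ⟨i1, e1⟩ := ha.fourier_mul_symbolOp hb.smooth.continuous hb.hasCompactSupport u η
  have hsm : ContDiff ℝ ∞ fun x => b x * a x η := hb.smooth.mul (ha.smooth_left η)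
  have hsc : HasCompactSupport fun x => b x * a x η := hb.hasCompactSupport.mul_right
  -- For fixed `η` the frozen operator is multiplication by `x ↦ b x * a x η`, that is, the identity
  -- symbol with this function as cutoff.
  obtain ⟨i2, e2⟩ := isSymbol_one.fourier_mul_symbolOp hsm.continuous hsc u η
  rw [symbolOp_one] at e2
  simp only [mul_one] at e2 i2
  rw [e1, e2, ← integral_sub i1 i2]
  refine (enorm_integral_le_lintegral_enorm _).trans (lintegral_mono fun ξ => ?_)
  simp only
  rw [← sub_mul, enorm_mul]
  gcongr
  refine enorm_le_ofReal ((hC b B hb ξ η (η - ξ)).trans ?_)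
  have : ‖η - ξ‖ * (1 + ‖η - ξ‖) ^ |t - 1| ≤ (1 + ‖η - ξ‖) ^ (k : ℝ) := by
    calc _ ≤ (1 + ‖η - ξ‖) ^ (1 : ℝ) * (1 + ‖η - ξ‖) ^ |t - 1| := by
          gcongr; rw [Real.rpow_one]; linarith
      _ = (1 + ‖η - ξ‖) ^ (1 + |t - 1|) := by rw [← Real.rpow_add (by positivity)]
      _ ≤ _ := Real.rpow_le_rpow_of_exponent_le (by linarith [norm_nonneg (η - ξ)]) hk
  calc _ ≤ C * B * (1 + ‖η - ξ‖) ^ (-((N + k : ℕ) : ℝ)) *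
        ((1 + ‖η - ξ‖) ^ (k : ℝ) * (1 + ‖ξ‖) ^ (t - 1)) := by gcongr
    _ = C * B * ((1 + ‖η - ξ‖) ^ (-((N + k : ℕ) : ℝ)) * (1 + ‖η - ξ‖) ^ (k : ℝ)) *
        (1 + ‖ξ‖) ^ (t - 1) := by ring
    _ = _ := by
        rw [← Real.rpow_add (by positivity)]
        congr 3
        push_cast
        ring

end SymbolOp

/-! ### Sobolev estimates for localized symbol operators on Euclidean space. -/

section SobolevEuc

variable {n : ℕ} {t : ℝ} {a : Euc n → Euc n → ℂ}

theorem sobolevNormEuc_eq (s : ℝ) (u : Euc n → ℂ) :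
    sobolevNormEuc s u = wnorm s fun ξ => ‖𝓕 u ξ‖ₑ := by
  unfold sobolevNormEuc wnorm wsq
  congr 2 with ξ
  rw [ENNReal.ofReal_mul (by positivity), ENNReal.ofReal_pow (norm_nonneg _), ofReal_norm]

theorem sobolevNormEuc_mono {s r : ℝ} (h : s ≤ r) (u : Euc n → ℂ) :
    sobolevNormEuc s u ≤ sobolevNormEuc r u := by
  rw [sobolevNormEuc_eq, sobolevNormEuc_eq]
  exact wnorm_mono_left h _

theorem measurable_enorm_fourier (u : 𝓢(Euc n, ℂ)) : Measurable fun ξ => ‖𝓕 (⇑u) ξ‖ₑ := by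
  rw [← SchwartzMap.fourier_coe]
  exact (SchwartzMap.continuous _).enorm.measurable

/-- Smooth functions with compact support. -/
structure IsCc (b : Euc n → ℂ) : Prop where
  smooth : ContDiff ℝ ∞ b
  compact : HasCompactSupport b

/-- A smooth function with compact support as a Schwartz function. -/
def IsCc.toS {b : Euc n → ℂ} (hb : IsCc b) : 𝓢(Euc n, ℂ) := hb.compact.toSchwartzMap hb.smooth

@[simp]
theorem IsCc.coe_toS {b : Euc n → ℂ} (hb : IsCc b) : ⇑hb.toS = b := rfl

theorem IsCc.mul {b f : Euc n → ℂ} (hb : IsCc b) (hf : ContDiff ℝ ∞ f) :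
    IsCc fun x => b x * f x :=
  ⟨hb.smooth.mul hf, hb.compact.mul_right⟩

theorem IsSymbol.exists_sobolev_le (ha : IsSymbol t a) {b : Euc n → ℂ} (hb : IsCc b) (s : ℝ) :
    ∃ C : ℝ≥0, ∀ u : 𝓢(Euc n, ℂ),
      sobolevNormEuc (s - t) (fun x => b x * symbolOp a u x) ≤ C * sobolevNormEuc s u := by
  obtain ⟨ρ, hρ⟩ := exists_isBump hb.smooth hb.compact
  obtain ⟨N, hN⟩ := exists_nat_gt ((n : ℝ) + |s - t|)
  obtain ⟨B, hB⟩ := hρ N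
  obtain ⟨C, hC0, hC⟩ := ha.exists_enorm_fourier_le ρ N
  obtain ⟨C', hC'⟩ := exists_wnorm_le_of_kernel_le (n := n) (s - t) t N (C * B) hN
  refine ⟨C', fun u => ?_⟩
  have := hC' _ _ (measurable_enorm_fourier u) (hC b B hB u)
  rwa [sub_add_cancel, ← sobolevNormEuc_eq, ← sobolevNormEuc_eq] at this

theorem IsCc.exists_sobolev_mul_le {b : Euc n → ℂ} (hb : IsCc b) (s : ℝ) :
    ∃ C : ℝ≥0, ∀ u : 𝓢(Euc n, ℂ),
      sobolevNormEuc s (fun x => b x * u x) ≤ C * sobolevNormEuc s u := by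
  obtain ⟨C, hC⟩ := isSymbol_one.exists_sobolev_le hb s
  refine ⟨C, fun u => ?_⟩
  simpa [symbolOp_one] using hC u

theorem IsSymbol.continuous_symbolOp (ha : IsSymbol t a) (u : 𝓢(Euc n, ℂ)) :
    Continuous (symbolOp a u) := by
  obtain ⟨C, hC0, hC⟩ := ha.exists_norm_le
  have hac : Continuous fun p : Euc n × Euc n => a p.1 p.2 := ha.continuous
  have hcu : Continuous (𝓕 (u : Euc n → ℂ)) := by
    rw [← SchwartzMap.fourier_coe]; exact SchwartzMap.continuous _
  refine continuous_of_dominated (F := fun y ξ =>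
    Complex.exp (2 * Real.pi * Complex.I * (inner ℝ ξ y : ℝ)) * a y ξ * 𝓕 (⇑u) ξ)
    (bound := fun ξ => C * ((1 + ‖ξ‖) ^ t * ‖𝓕 u ξ‖)) (fun y => ?_) (fun y => ?_)
    ((integrable_one_add_norm_rpow_mul t (𝓕 u)).const_mul C) (ae_of_all _ fun ξ => ?_)
  · have : Continuous (a y) := (ha.smooth_right y).continuous
    exact Continuous.aestronglyMeasurable (by fun_prop)
  · refine ae_of_all _ fun ξ => ?_
    rw [norm_mul, norm_mul, norm_exp_two_pi_mul, one_mul, ← mul_assoc, SchwartzMap.fourier_coe]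
    gcongr
    exact hC y ξ
  · have : Continuous fun y => a y ξ := (ha.smooth_left ξ).continuous
    fun_prop

theorem fourier_sub_apply {f g : Euc n → ℂ} (hf : Integrable f) (hg : Integrable g) (η : Euc n) :
    𝓕 (fun x => f x - g x) η = 𝓕 f η - 𝓕 g η := by
  simp only [Real.fourier_eq]
  rw [← integral_sub]
  · simp only [smul_sub]
  · simpa using (Real.fourierIntegral_convergent_iff η).2 hf
  · simpa using (Real.fourierIntegral_convergent_iff η).2 hg

theorem measurable_kernel_lintegral (C N t : ℝ) {U : Euc n → ℝ≥0∞} (hU : Measurable U) :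
    Measurable fun η => ∫⁻ ξ, ENNReal.ofReal (C * (1 + ‖η - ξ‖) ^ (-N) * (1 + ‖ξ‖) ^ t) * U ξ := by
  refine Measurable.lintegral_prod_right'
    (f := fun p : Euc n × Euc n =>
      ENNReal.ofReal (C * (1 + ‖p.1 - p.2‖) ^ (-N) * (1 + ‖p.2‖) ^ t) * U p.2) ?_
  fun_prop

/-- The commutator of an operator of order `t` and a multiplication has order `t - 1`. -/
theorem IsSymbol.exists_sobolev_commutator_le (ha : IsSymbol t a) {b θ : Euc n → ℂ} (hb : IsCc b)
    (hθ : IsCc θ) (s : ℝ) :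
    ∃ C : ℝ≥0, ∀ u v : 𝓢(Euc n, ℂ), (∀ x, v x = θ x * u x) →
      sobolevNormEuc (s - t) (fun x => b x * symbolOp a v x - b x * θ x * symbolOp a u x) ≤
        C * sobolevNormEuc (s - 1) u := by
  have hbθ : IsCc fun x => b x * θ x := hb.mul hθ.smooth
  obtain ⟨N, hN⟩ := exists_nat_gt ((n : ℝ) + |s - t|)
  obtain ⟨ρ₁, h₁⟩ := exists_isBump hb.smooth hb.compact
  obtain ⟨ρ₂, h₂⟩ := exists_isBump hbθ.smooth hbθ.compact
  obtain ⟨C₁, hC₁, N₁, h₁'⟩ := ha.exists_enorm_fourier_sub_le ρ₁ N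
  obtain ⟨C₂, hC₂, N₂, h₂'⟩ := ha.exists_enorm_fourier_sub_le ρ₂ N
  obtain ⟨B₁, hB₁⟩ := h₁ N₁
  obtain ⟨B₂, hB₂⟩ := h₂ N₂
  obtain ⟨C₁', hC₁'⟩ := exists_wnorm_le_of_kernel_le (n := n) (s - t) (t - 1) N (C₁ * B₁) hN
  obtain ⟨C₂', hC₂'⟩ := exists_wnorm_le_of_kernel_le (n := n) (s - t) (t - 1) N (C₂ * B₂) hN
  obtain ⟨C₃, hC₃⟩ := hθ.exists_sobolev_mul_le (s - 1)
  refine ⟨C₁' * C₃ + C₂', fun u v huv => ?_⟩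
  have hv : sobolevNormEuc (s - 1) v ≤ C₃ * sobolevNormEuc (s - 1) u := by
    have := hC₃ u
    rwa [← funext huv] at this
  have es : s - t + (t - 1) = s - 1 := by ring
  have m₁ := measurable_kernel_lintegral (C₁ * B₁) N (t - 1) (measurable_enorm_fourier v)
  have m₂ := measurable_kernel_lintegral (C₂ * B₂) N (t - 1) (measurable_enorm_fourier u)
  have k₁ := hC₁' _ _ (measurable_enorm_fourier v) fun η => le_rfl
  have k₂ := hC₂' _ _ (measurable_enorm_fourier u) fun η => le_rfl
  rw [es, ← sobolevNormEuc_eq] at k₁ k₂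
  rw [sobolevNormEuc_eq]
  refine (wnorm_mono fun η => ?_).trans ((wnorm_add_le m₁ m₂).trans ((add_le_add k₁ k₂).trans ?_))
  · have i₁ : Integrable fun x => b x * symbolOp a v x :=
      (hb.smooth.continuous.mul (ha.continuous_symbolOp v)).integrable_of_hasCompactSupport
        hb.compact.mul_right
    have i₂ : Integrable fun x => b x * θ x * symbolOp a u x :=
      (hbθ.smooth.continuous.mul (ha.continuous_symbolOp u)).integrable_of_hasCompactSupport
        hbθ.compact.mul_right
    rw [fourier_sub_apply i₁ i₂]
    have e₁ := h₁' b B₁ hB₁ v η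
    have e₂ := h₂' _ B₂ hB₂ u η
    -- Both terms of the commutator have the same frozen-frequency approximation, which cancels and
    -- leaves two errors of order `t - 1`.
    have e : (fun x => b x * a x η * v x) = fun x => b x * θ x * a x η * u x := by
      ext x; rw [huv]; ring
    rw [e] at e₁
    set M := 𝓕 (fun x => b x * θ x * a x η * u x) η
    calc _ = ‖(𝓕 (fun x => b x * symbolOp a v x) η - M) -
          (𝓕 (fun x => b x * θ x * symbolOp a u x) η - M)‖ₑ := by congr 1; ring
      _ ≤ _ := enorm_sub_le
      _ ≤ _ := add_le_add e₁ e₂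
  · push_cast
    rw [add_mul, mul_assoc]
    gcongr

/-- Cutting off the singularity of `z⁻¹` gives a globally smooth function. The chain rule then
applies without assuming that the symbol is nonzero everywhere. -/
theorem exists_smooth_inv {c : ℝ} (hc : 0 < c) : ∃ g : ℂ → ℂ, ContDiff ℝ ∞ g ∧
    ∀ z, c ≤ ‖z‖ → g z = z⁻¹ := by
  let f : ContDiffBump (0 : ℂ) := ⟨c / 2, c, by positivity, by linarith⟩
  refine ⟨fun z => (1 - (f z : ℂ)) * z⁻¹, contDiff_iff_contDiffAt.2 fun z => ?_, fun z hz => ?_⟩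
  · rcases eq_or_ne z 0 with rfl | hz
    · refine contDiffAt_const (c := (0 : ℂ)) |>.congr_of_eventuallyEq ?_
      filter_upwards [f.eventuallyEq_one] with z hz
      simp [hz]
    · exact (contDiffAt_const.sub (Complex.ofRealCLM.contDiff.contDiffAt.comp z f.contDiffAt)).mul
        (contDiffAt_inv ℝ hz)
  · have : f z = 0 := f.zero_of_le_dist (by simpa using hz)
    simp [this]

/-- Localized reciprocals of an elliptic symbol. -/
theorem IsSymbol.exists_isBump_inv (ha : IsSymbol t a) {χ : Euc n → ℂ} (hχ : IsCc χ) {c R : ℝ}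
    (hc : 0 < c) (hell : ∀ y, χ y ≠ 0 → ∀ η, R ≤ ‖η‖ → c * (1 + ‖η‖) ^ t ≤ ‖a y η‖) :
    ∃ ρ, ∀ N, ∃ C, 0 ≤ C ∧ ∀ η, R ≤ ‖η‖ → ∃ b : Euc n → ℂ,
      IsBump ρ N (C * (1 + ‖η‖) ^ (-t)) b ∧ ∀ x, b x * a x η = χ x := by
  obtain ⟨ρ, hρ⟩ := exists_isBump hχ.smooth hχ.compact
  obtain ⟨g, hg, hgi⟩ := exists_smooth_inv hc
  refine ⟨ρ, fun N => ?_⟩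
  obtain ⟨B, hB⟩ := hρ N
  obtain ⟨A, hA0, hA⟩ := ha.exists_bound N
  obtain ⟨G, hG0, hG⟩ := exists_forall_le_of_forall_exists
    (P := fun i C => ∀ z : ℂ, ‖z‖ ≤ A → ‖iteratedFDeriv ℝ i g z‖ ≤ C)
    (fun i C C' h hC z hz => (hC z hz).trans h) (fun i => by
      obtain ⟨C, hC⟩ := (isCompact_closedBall (0 : ℂ) A).exists_bound_of_continuousOn
        (hg.continuous_iteratedFDeriv (m := i) (by exact_mod_cast le_top)).continuousOn
      exact ⟨C, fun z hz => hC z (by simpa using hz)⟩) N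
  set D := max 1 A
  have hD : 1 ≤ D := le_max_left _ _
  have hB0 := hB.nonneg
  refine ⟨2 ^ N * B * (N.factorial * G * D ^ N), by positivity, fun η hη => ?_⟩
  -- Normalization: `w * a(·, η)` has derivatives bounded uniformly in `η` and is at least `c` in
  -- absolute value where `χ ≠ 0`. Hence its reciprocal has uniform derivative bounds, and the size
  -- `(1 + ‖η‖) ^ (-t)` sits in the outer factor `w`.
  set w : ℝ := (1 + ‖η‖) ^ (-t) with hw
  have hw0 : 0 < w := by positivity
  have hwt : w * (1 + ‖η‖) ^ t = 1 := by rw [hw, ← Real.rpow_add (by positivity)]; simp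
  set f : Euc n → ℂ := fun x => (w : ℂ) * a x η
  have hf : ContDiff ℝ ∞ f := contDiff_const.mul (ha.smooth_left η)
  have hfb : ∀ i ≤ N, ∀ x, ‖iteratedFDeriv ℝ i f x‖ ≤ A := by
    intro i hi x
    have e : f = (w : ℂ) • fun x => a x η := by ext x; simp [f]
    rw [e, iteratedFDeriv_const_smul_apply ((ha.smooth_left η).of_le
      (by exact_mod_cast le_top)).contDiffAt, norm_smul, Complex.norm_real, Real.norm_of_nonneg hw0.le]
    calc w * _ ≤ w * (A * (1 + ‖η‖) ^ t) := by gcongr; exact hA i hi x η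
      _ = A * (w * (1 + ‖η‖) ^ t) := by ring
      _ = A := by rw [hwt, mul_one]
  have hgf : ∀ i ≤ N, ∀ x, ‖iteratedFDeriv ℝ i (g ∘ f) x‖ ≤ N.factorial * G * D ^ N := by
    intro i hi x
    refine (norm_iteratedFDeriv_comp_le (C := G) (D := D) hg hf (by exact_mod_cast le_top) x
      (fun j hj => hG j (by omega) _ ?_) fun j hj hj' => ?_).trans ?_
    · simpa using hfb 0 (Nat.zero_le _) x
    · calc _ ≤ A := hfb j (by omega) x
        _ ≤ D := le_max_right _ _
        _ ≤ _ := le_self_pow₀ hD (by omega)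
    · gcongr
  have h1 := hB.mul (hg.comp hf) hgf
  refine ⟨fun x => (w : ℂ) * (χ x * (g ∘ f) x), ⟨contDiff_const.mul h1.smooth, ?_, ?_⟩, ?_⟩
  · exact (Function.support_mul_subset_right _ _).trans h1.supp
  · intro i hi x
    have e : (fun x => (w : ℂ) * (χ x * (g ∘ f) x)) = (w : ℂ) • fun x => χ x * (g ∘ f) x := by
      ext x; simp
    rw [e, iteratedFDeriv_const_smul_apply (h1.smooth.of_le
      (by exact_mod_cast le_top)).contDiffAt, norm_smul, Complex.norm_real, Real.norm_of_nonneg hw0.le,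
      mul_comm]
    gcongr
    exact h1.bound i hi x
  · intro x
    by_cases hx : χ x = 0
    · simp [hx]
    have h2 := hell x hx η hη
    have h3 : c ≤ ‖f x‖ := by
      simp only [f, norm_mul, Complex.norm_real, Real.norm_of_nonneg hw0.le]
      calc c = w * (c * (1 + ‖η‖) ^ t) := by rw [mul_left_comm, hwt, mul_one]
        _ ≤ _ := by gcongr
    have h4 : f x ≠ 0 := norm_pos_iff.1 (hc.trans_le h3)
    have h5 : (w : ℂ) * a x η = f x := rfl
    simp only [Function.comp_apply, hgi _ h3]
    calc (w : ℂ) * (χ x * (f x)⁻¹) * a x η = χ x * (f x)⁻¹ * ((w : ℂ) * a x η) := by ring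
      _ = _ := by rw [h5, mul_assoc, inv_mul_cancel₀ h4, mul_one]

/-- The local elliptic estimate. -/
theorem IsSymbol.exists_elliptic_estimate (ha : IsSymbol t a) {χ : Euc n → ℂ} (hχ : IsCc χ)
    {c R : ℝ} (hc : 0 < c)
    (hell : ∀ y, χ y ≠ 0 → ∀ η, R ≤ ‖η‖ → c * (1 + ‖η‖) ^ t ≤ ‖a y η‖) (s : ℝ) :
    ∃ C : ℝ≥0, ∀ u w : 𝓢(Euc n, ℂ), (∀ x, w x = symbolOp a u x) →
      sobolevNormEuc (s + t) (fun x => χ x * u x) ≤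
        C * (sobolevNormEuc s w + sobolevNormEuc (s + t - 1) u) := by
  obtain ⟨N, hN⟩ := exists_nat_gt ((n : ℝ) + |s + t|)
  obtain ⟨k, hk⟩ := exists_nat_ge (max |t| 1)
  obtain ⟨ρ, hρ⟩ := ha.exists_isBump_inv hχ hc hell
  obtain ⟨C₁, hC₁, h₁⟩ := (isSymbol_one (n := n)).exists_enorm_fourier_le ρ (N + k)
  obtain ⟨C₂, hC₂, N₂, h₂⟩ := ha.exists_enorm_fourier_sub_le ρ (N + k)
  obtain ⟨B₁, hB₁, hb₁⟩ := hρ (max (N + k) N₂)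
  obtain ⟨ρ', hρ'⟩ := exists_isBump hχ.smooth hχ.compact
  obtain ⟨C₃, hC₃, h₃⟩ := (isSymbol_one (n := n)).exists_enorm_fourier_le ρ' (N + k)
  obtain ⟨B₃, hB₃⟩ := hρ' (N + k)
  have hB₃0 := hB₃.nonneg
  set K₁ := C₁ * B₁
  set K₂ := C₂ * B₁ + C₃ * B₃ * (1 + |R|)
  obtain ⟨C₁', hC₁'⟩ := exists_wnorm_le_of_kernel_le (n := n) (s + t) (-t) N K₁ hN
  obtain ⟨C₂', hC₂'⟩ := exists_wnorm_le_of_kernel_le (n := n) (s + t) (-1) N K₂ hN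
  refine ⟨C₁' + C₂', fun u w huw => ?_⟩
  have m₁ := measurable_kernel_lintegral K₁ N (-t) (measurable_enorm_fourier w)
  have m₂ := measurable_kernel_lintegral K₂ N (-1) (measurable_enorm_fourier u)
  have k₁ := hC₁' _ _ (measurable_enorm_fourier w) fun η => le_rfl
  have k₂ := hC₂' _ _ (measurable_enorm_fourier u) fun η => le_rfl
  rw [← sobolevNormEuc_eq] at k₁ k₂
  rw [show s + t + -t = s by ring] at k₁
  rw [show s + t + -1 = s + t - 1 by ring] at k₂
  have hNk : ∀ x : Euc n, (1 + ‖x‖) ^ (-((N + k : ℕ) : ℝ)) * (1 + ‖x‖) ^ (k : ℝ) =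
      (1 + ‖x‖) ^ (-(N : ℝ)) := fun x => by
    rw [← Real.rpow_add (by positivity)]; push_cast; congr 1; ring
  have hexp : ∀ (x : Euc n) (r : ℝ), r ≤ max |t| 1 → (1 + ‖x‖) ^ r ≤ (1 + ‖x‖) ^ (k : ℝ) :=
    fun x r hr => Real.rpow_le_rpow_of_exponent_le (by linarith [norm_nonneg x]) (hr.trans hk)
  -- For `‖η‖ ≥ R` take the cutoff `b = χ / a(·, η)`, which depends on `η`. The frozen term of `b
  -- Op(a) u` is then `𝓕 (χ u) η`, so `𝓕 (χ u) η` equals `𝓕 (b w) η` up to an error of order `-1` in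
  -- `u`.
  have main : ∀ η, ‖𝓕 (fun x => χ x * u x) η‖ₑ ≤
      (∫⁻ ξ, ENNReal.ofReal (K₁ * (1 + ‖η - ξ‖) ^ (-(N : ℝ)) * (1 + ‖ξ‖) ^ (-t)) * ‖𝓕 (⇑w) ξ‖ₑ) +
      ∫⁻ ξ, ENNReal.ofReal (K₂ * (1 + ‖η - ξ‖) ^ (-(N : ℝ)) * (1 + ‖ξ‖) ^ (-1 : ℝ)) *
        ‖𝓕 (⇑u) ξ‖ₑ := by
    intro η
    rcases le_or_gt R ‖η‖ with hη | hη
    · obtain ⟨b, hb, hba⟩ := hb₁ η hη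
      have e₁ := h₁ b _ ⟨hb.smooth, hb.supp, fun i hi => hb.bound i (hi.trans (le_max_left _ _))⟩ w η
      have e₂ := h₂ b _ ⟨hb.smooth, hb.supp, fun i hi => hb.bound i (hi.trans (le_max_right _ _))⟩ u η
      rw [symbolOp_one] at e₁
      simp only [hba, ← huw] at e₂
      -- The bounds of `b` are proportional to `(1 + ‖η‖) ^ (-t)`. Peetre's inequality moves this to
      -- `ξ` and uses up `k` of the `N + k` powers of decay.
      have hpee : ∀ ξ, (1 + ‖η‖) ^ (-t) ≤ (1 + ‖ξ‖) ^ (-t) * (1 + ‖η - ξ‖) ^ (k : ℝ) := fun ξ =>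
        (one_add_norm_rpow_le (-t) η ξ).trans (mul_le_mul_of_nonneg_left
          (hexp _ _ (by rw [abs_neg]; exact le_max_left _ _)) (by positivity))
      calc ‖𝓕 (fun x => χ x * u x) η‖ₑ = ‖𝓕 (fun x => b x * w x) η -
            (𝓕 (fun x => b x * w x) η - 𝓕 (fun x => χ x * u x) η)‖ₑ := by congr 1; ring
        _ ≤ _ := enorm_sub_le
        _ ≤ _ := add_le_add e₁ e₂
        _ ≤ _ := by
          refine add_le_add (lintegral_mono fun ξ => ?_) (lintegral_mono fun ξ => ?_)
          · refine mul_le_mul_left (ENNReal.ofReal_le_ofReal ?_) _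
            calc _ ≤ C₁ * (B₁ * ((1 + ‖ξ‖) ^ (-t) * (1 + ‖η - ξ‖) ^ (k : ℝ))) *
                  (1 + ‖η - ξ‖) ^ (-((N + k : ℕ) : ℝ)) * (1 + ‖ξ‖) ^ (0 : ℝ) := by
                  gcongr; exact hpee ξ
              _ = K₁ * ((1 + ‖η - ξ‖) ^ (-((N + k : ℕ) : ℝ)) * (1 + ‖η - ξ‖) ^ (k : ℝ)) *
                  (1 + ‖ξ‖) ^ (-t) := by rw [Real.rpow_zero]; ring
              _ = _ := by rw [hNk]
          · refine mul_le_mul_left (ENNReal.ofReal_le_ofReal ?_) _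
            calc _ ≤ C₂ * (B₁ * ((1 + ‖ξ‖) ^ (-t) * (1 + ‖η - ξ‖) ^ (k : ℝ))) *
                  (1 + ‖η - ξ‖) ^ (-((N + k : ℕ) : ℝ)) * (1 + ‖ξ‖) ^ (t - 1) := by
                  gcongr; exact hpee ξ
              _ = C₂ * B₁ * ((1 + ‖η - ξ‖) ^ (-((N + k : ℕ) : ℝ)) * (1 + ‖η - ξ‖) ^ (k : ℝ)) *
                  ((1 + ‖ξ‖) ^ (-t) * (1 + ‖ξ‖) ^ (t - 1)) := by ring
              _ = C₂ * B₁ * (1 + ‖η - ξ‖) ^ (-(N : ℝ)) * (1 + ‖ξ‖) ^ (-1 : ℝ) := by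
                  rw [hNk, ← Real.rpow_add (by positivity)]; congr 2; ring
              _ ≤ _ := by
                  gcongr
                  simp only [K₂]
                  have : 0 ≤ C₃ * B₃ * (1 + |R|) := by positivity
                  linarith
    -- Low frequencies: there `1 ≤ (1 + |R|) * (1 + ‖η‖)⁻¹`, so the multiplication by `χ` trivially
    -- counts as an operator of order `-1`.
    · have e₃ := h₃ χ B₃ hB₃ u η
      rw [symbolOp_one] at e₃
      refine (e₃.trans (lintegral_mono fun ξ => ?_)).trans le_add_self
      refine mul_le_mul_left (ENNReal.ofReal_le_ofReal ?_) _
      have h1 : 1 ≤ (1 + |R|) * ((1 + ‖ξ‖) ^ (-1 : ℝ) * (1 + ‖η - ξ‖) ^ (k : ℝ)) := by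
        calc (1 : ℝ) = (1 + ‖η‖) * (1 + ‖η‖) ^ (-1 : ℝ) := by
              rw [Real.rpow_neg_one, mul_inv_cancel₀ (one_add_norm_pos η).ne']
          _ ≤ (1 + |R|) * ((1 + ‖ξ‖) ^ (-1 : ℝ) * (1 + ‖η - ξ‖) ^ |(-1 : ℝ)|) := by
              gcongr
              · exact hη.le.trans (le_abs_self R)
              · exact one_add_norm_rpow_le (-1) η ξ
          _ ≤ _ := mul_le_mul_of_nonneg_left (mul_le_mul_of_nonneg_left
              (hexp _ _ (by simp)) (by positivity)) (by positivity)
      calc _ ≤ C₃ * B₃ * (1 + ‖η - ξ‖) ^ (-((N + k : ℕ) : ℝ)) * (1 + ‖ξ‖) ^ (0 : ℝ) *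
            ((1 + |R|) * ((1 + ‖ξ‖) ^ (-1 : ℝ) * (1 + ‖η - ξ‖) ^ (k : ℝ))) :=
            le_mul_of_one_le_right (by positivity) h1
        _ = C₃ * B₃ * (1 + |R|) *
            ((1 + ‖η - ξ‖) ^ (-((N + k : ℕ) : ℝ)) * (1 + ‖η - ξ‖) ^ (k : ℝ)) *
            (1 + ‖ξ‖) ^ (-1 : ℝ) := by rw [Real.rpow_zero]; ring
        _ ≤ _ := by
            rw [hNk]
            gcongr
            simp only [K₂]
            have : 0 ≤ C₂ * B₁ := by positivity
            linarith
  rw [sobolevNormEuc_eq]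
  refine (wnorm_mono main).trans ((wnorm_add_le m₁ m₂).trans ((add_le_add k₁ k₂).trans ?_))
  push_cast
  rw [mul_add]
  gcongr
  · exact le_self_add
  · exact le_add_self

end SobolevEuc

/-! ### Quadratic interpolation -/

section Interpolation

theorem lintegral_Ioi_scale {c : ℝ} (hc : 0 < c) (f : ℝ → ℝ≥0∞) :
    ∫⁻ x in Ioi (0 : ℝ), f x = ENNReal.ofReal c * ∫⁻ x in Ioi (0 : ℝ), f (c * x) := by
  have h := lintegral_image_eq_lintegral_abs_deriv_mul (s := Ioi (0 : ℝ)) (f := fun x => c * x)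
    (f' := fun _ => c) measurableSet_Ioi
    (fun x _ => by simpa using ((hasDerivAt_id x).const_mul c).hasDerivWithinAt)
    ((mul_right_injective₀ hc.ne').injOn) f
  have e : (fun x => c * x) '' Ioi (0 : ℝ) = Ioi 0 := by
    rw [image_mul_left_Ioi hc, mul_zero]
  rw [e] at h
  rw [h, abs_of_pos hc, lintegral_const_mul' _ _ ENNReal.ofReal_ne_top]

/-- The normalizing constant of quadratic interpolation. -/
def interpConst (θ : ℝ) : ℝ≥0∞ := ∫⁻ t in Ioi (0 : ℝ), ENNReal.ofReal (t ^ (-θ) / (1 + t))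

theorem interpConst_ne_zero {θ : ℝ} (h1 : θ < 1) : interpConst θ ≠ 0 := by
  have h : ∫⁻ _t in Ioc (1 : ℝ) 2, ENNReal.ofReal (1 / 6) ≤ interpConst θ := by
    unfold interpConst
    calc _ ≤ ∫⁻ t in Ioc (1 : ℝ) 2, ENNReal.ofReal (t ^ (-θ) / (1 + t)) := by
          refine setLIntegral_mono' measurableSet_Ioc fun t ht => ENNReal.ofReal_le_ofReal ?_
          have h2 : (2 : ℝ)⁻¹ ≤ t ^ (-θ) := by
            calc (2 : ℝ)⁻¹ ≤ t⁻¹ := inv_anti₀ (by linarith [ht.1]) ht.2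
              _ = t ^ (-1 : ℝ) := (Real.rpow_neg_one t).symm
              _ ≤ _ := Real.rpow_le_rpow_of_exponent_le ht.1.le (by linarith)
          rw [div_le_div_iff₀ (by norm_num) (by linarith [ht.1])]
          linarith [ht.2]
      _ ≤ _ := lintegral_mono_set fun t ht => by
          have := ht.1
          simp only [mem_Ioi]
          linarith
  refine (lt_of_lt_of_le ?_ h).ne'
  rw [setLIntegral_const, Real.volume_Ioc]
  norm_num

theorem interpConst_ne_top {θ : ℝ} (h0 : 0 < θ) (h1 : θ < 1) : interpConst θ ≠ ⊤ := by
  have hd : Ioi (0 : ℝ) = Ioc 0 1 ∪ Ioi 1 := (Ioc_union_Ioi_eq_Ioi zero_le_one).symm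
  unfold interpConst
  rw [hd]
  refine ((lintegral_union_le _ _ _).trans_lt (ENNReal.add_lt_top.2 ⟨?_, ?_⟩)).ne
  · have hi : IntegrableOn (fun t : ℝ => t ^ (-θ)) (Ioc 0 1) :=
      (intervalIntegrable_iff_integrableOn_Ioc_of_le zero_le_one).1
        (intervalIntegral.intervalIntegrable_rpow' (by linarith))
    refine lt_of_le_of_lt (setLIntegral_mono' measurableSet_Ioc fun t ht =>
      ENNReal.ofReal_le_ofReal ?_) hi.lintegral_lt_top
    exact div_le_self (Real.rpow_nonneg ht.1.le _) (by linarith [ht.1])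
  · have hi : IntegrableOn (fun t : ℝ => t ^ (-θ - 1)) (Ioi 1) :=
      integrableOn_Ioi_rpow_of_lt (by linarith) one_pos
    refine lt_of_le_of_lt (setLIntegral_mono' measurableSet_Ioi fun t ht =>
      ENNReal.ofReal_le_ofReal ?_) hi.lintegral_lt_top
    have ht0 : (0 : ℝ) < t := zero_lt_one.trans ht
    rw [Real.rpow_sub_one ht0.ne']
    have := Real.rpow_nonneg ht0.le (-θ)
    gcongr
    linarith

/-- After the substitution `l = (p / q) t`, homogeneity pulls `p ^ (1 - θ) * q ^ θ` out of the
integral. Averaging the parallel sums of `p` and `l * q` over all scales `l` thus produces the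
weight of the interpolation space. -/
theorem lintegral_interp {p q θ : ℝ} (hp : 0 < p) (hq : 0 < q) :
    ∫⁻ l in Ioi (0 : ℝ), ENNReal.ofReal (l ^ (-θ - 1)) * ENNReal.ofReal (l * p * q / (p + l * q)) =
      ENNReal.ofReal (p ^ (1 - θ) * q ^ θ) * interpConst θ := by
  have hc : 0 < p / q := div_pos hp hq
  rw [lintegral_Ioi_scale hc, interpConst, ← lintegral_const_mul' _ _ ENNReal.ofReal_ne_top,
    ← lintegral_const_mul' _ _ ENNReal.ofReal_ne_top]
  refine setLIntegral_congr_fun measurableSet_Ioi fun t ht => ?_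
  have ht0 : (0 : ℝ) < t := ht
  rw [← ENNReal.ofReal_mul (by positivity), ← ENNReal.ofReal_mul (by positivity),
    ← ENNReal.ofReal_mul (by positivity)]
  congr 1
  rw [Real.mul_rpow hc.le ht0.le, Real.rpow_sub_one hc.ne', Real.rpow_sub_one ht0.ne',
    Real.div_rpow hp.le hq.le, Real.rpow_sub hp, Real.rpow_one, Real.rpow_neg hp.le,
    Real.rpow_neg hq.le]
  have := Real.rpow_pos_of_pos hp θ
  have := Real.rpow_pos_of_pos hq θ
  have := Real.rpow_pos_of_pos ht0 (-θ)
  have h3 : p + p / q * t * q = p * (1 + t) := by field_simp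
  rw [h3]
  field_simp

/-- `A * B / (A + B)` is the minimum of `A x² + B y²` on `x + y = 1`: multiplied by `A + B`, the
deficit is the square `(A x - B y)²`. -/
theorem ofReal_mul_div_add_mul_sq_le {A B : ℝ} (hA : 0 < A) (hB : 0 < B) {x y z : ℝ≥0∞}
    (h : z ≤ x + y) :
    ENNReal.ofReal (A * B / (A + B)) * z ^ 2 ≤
      ENNReal.ofReal A * x ^ 2 + ENNReal.ofReal B * y ^ 2 := by
  rcases eq_or_ne x ⊤ with rfl | hx
  · simp [hA]
  rcases eq_or_ne y ⊤ with rfl | hy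
  · simp [hB]
  lift x to ℝ≥0 using hx
  lift y to ℝ≥0 using hy
  refine (mul_le_mul_right (pow_le_pow_left₀ zero_le h 2) _).trans ?_
  rw [← ENNReal.ofReal_coe_nnreal (p := x), ← ENNReal.ofReal_coe_nnreal (p := y),
    ← ENNReal.ofReal_add (by positivity) (by positivity), ← ENNReal.ofReal_pow (by positivity),
    ← ENNReal.ofReal_pow (by positivity), ← ENNReal.ofReal_pow (by positivity),
    ← ENNReal.ofReal_mul (by positivity), ← ENNReal.ofReal_mul (by positivity),
    ← ENNReal.ofReal_mul (by positivity), ← ENNReal.ofReal_add (by positivity) (by positivity)]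
  refine ENNReal.ofReal_le_ofReal ?_
  rw [div_mul_eq_mul_div, div_le_iff₀ (by positivity)]
  nlinarith [sq_nonneg (A * (x : ℝ) - B * y)]

variable {α β : Type*} [MeasurableSpace α] [MeasurableSpace β]

theorem lintegral_interp_weight {ν : Measure β} [SFinite ν] {p q : β → ℝ} (hp : ∀ x, 0 < p x)
    (hq : ∀ x, 0 < q x) (hpm : Measurable p) (hqm : Measurable q) {G : β → ℝ≥0∞}
    (hG : Measurable G) (θ : ℝ) :
    ∫⁻ l in Ioi (0 : ℝ), ENNReal.ofReal (l ^ (-θ - 1)) *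
        ∫⁻ x, ENNReal.ofReal (l * p x * q x / (p x + l * q x)) * G x ^ 2 ∂ν =
      interpConst θ * ∫⁻ x, ENNReal.ofReal (p x ^ (1 - θ) * q x ^ θ) * G x ^ 2 ∂ν := by
  simp_rw [← lintegral_const_mul' _ _ ENNReal.ofReal_ne_top]
  rw [lintegral_lintegral_swap (by fun_prop), ← lintegral_const_mul _ (by fun_prop)]
  refine lintegral_congr fun x => ?_
  simp_rw [← mul_assoc]
  rw [lintegral_mul_const _ (by fun_prop), lintegral_interp (hp x) (hq x)]
  ring

/-- Quadratic interpolation between weighted `L²` spaces, from decompositions at all scales. -/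
theorem lintegral_interp_le {μ : Measure α} {ν : Measure β} [SFinite μ] [SFinite ν]
    {p q : α → ℝ} (hp : ∀ x, 0 < p x) (hq : ∀ x, 0 < q x) (hpm : Measurable p) (hqm : Measurable q)
    {p' q' : β → ℝ} (hp' : ∀ x, 0 < p' x) (hq' : ∀ x, 0 < q' x) (hpm' : Measurable p')
    (hqm' : Measurable q') {F : α → ℝ≥0∞} {G : β → ℝ≥0∞} (hF : Measurable F) (hG : Measurable G)
    (C : ℝ≥0∞) {θ : ℝ} (h0 : 0 < θ) (h1 : θ < 1)
    (h : ∀ l : ℝ, 0 < l → ∃ G₀ G₁ : β → ℝ≥0∞, Measurable G₀ ∧ (∀ x, G x ≤ G₀ x + G₁ x) ∧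
      ∫⁻ x, ENNReal.ofReal (p' x) * G₀ x ^ 2 ∂ν ≤
        C * ∫⁻ x, ENNReal.ofReal (l * p x * q x / (p x + l * q x)) * F x ^ 2 ∂μ ∧
      ENNReal.ofReal l * ∫⁻ x, ENNReal.ofReal (q' x) * G₁ x ^ 2 ∂ν ≤
        C * ∫⁻ x, ENNReal.ofReal (l * p x * q x / (p x + l * q x)) * F x ^ 2 ∂μ) :
    ∫⁻ x, ENNReal.ofReal (p' x ^ (1 - θ) * q' x ^ θ) * G x ^ 2 ∂ν ≤
      2 * C * ∫⁻ x, ENNReal.ofReal (p x ^ (1 - θ) * q x ^ θ) * F x ^ 2 ∂μ := by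
  -- At the scale `l` the left side is at most the cost of any splitting of `G`. The hypothesis
  -- provides one whose two costs are each at most `C` times the right side, whence the factor `2`.
  have key : ∀ l : ℝ, 0 < l →
      ∫⁻ x, ENNReal.ofReal (l * p' x * q' x / (p' x + l * q' x)) * G x ^ 2 ∂ν ≤
      2 * C * ∫⁻ x, ENNReal.ofReal (l * p x * q x / (p x + l * q x)) * F x ^ 2 ∂μ := by
    intro l hl
    obtain ⟨G₀, G₁, hm, hle, b₀, b₁⟩ := h l hl
    calc _ ≤ ∫⁻ x, (ENNReal.ofReal (p' x) * G₀ x ^ 2 +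
          ENNReal.ofReal (l * q' x) * G₁ x ^ 2) ∂ν := by
          refine lintegral_mono fun x => ?_
          have := ofReal_mul_div_add_mul_sq_le (hp' x) (mul_pos hl (hq' x)) (hle x)
          refine le_trans (le_of_eq ?_) this
          congr 3
          ring
      _ = ∫⁻ x, ENNReal.ofReal (p' x) * G₀ x ^ 2 ∂ν +
          ENNReal.ofReal l * ∫⁻ x, ENNReal.ofReal (q' x) * G₁ x ^ 2 ∂ν := by
          rw [lintegral_add_left (by fun_prop), ← lintegral_const_mul' _ _ ENNReal.ofReal_ne_top]
          simp_rw [ENNReal.ofReal_mul hl.le, mul_assoc]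
      _ ≤ _ := (add_le_add b₀ b₁).trans_eq (by ring)
  have hc := interpConst_ne_top h0 h1
  have hc0 := interpConst_ne_zero h1
  -- Integrating against `l ^ (-θ - 1)` produces `interpConst θ` on both sides; it can be cancelled,
  -- being neither `0` nor `⊤`.
  rw [← ENNReal.mul_le_mul_iff_right hc0 hc, ← lintegral_interp_weight hp' hq' hpm' hqm' hG]
  calc _ ≤ ∫⁻ l in Ioi (0 : ℝ), 2 * C * (ENNReal.ofReal (l ^ (-θ - 1)) *
        ∫⁻ x, ENNReal.ofReal (l * p x * q x / (p x + l * q x)) * F x ^ 2 ∂μ) := by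
        refine setLIntegral_mono' measurableSet_Ioi fun l hl => ?_
        rw [mul_left_comm]
        exact mul_le_mul_right (key l hl) _
    _ = 2 * C * ∫⁻ l in Ioi (0 : ℝ), (ENNReal.ofReal (l ^ (-θ - 1)) *
        ∫⁻ x, ENNReal.ofReal (l * p x * q x / (p x + l * q x)) * F x ^ 2 ∂μ) := by
        rw [lintegral_const_mul]
        refine Measurable.mul (by fun_prop) ?_
        refine Measurable.lintegral_prod_right' (f := fun z : ℝ × α =>
          ENNReal.ofReal (z.1 * p z.2 * q z.2 / (p z.2 + z.1 * q z.2)) * F z.2 ^ 2) ?_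
        fun_prop
    _ = _ := by
        rw [lintegral_interp_weight hp hq hpm hqm hF]
        ring

end Interpolation

/-! ### Optimal decompositions of Schwartz functions. -/

section InterpolationEuc

variable {n : ℕ}

/-- A Fourier multiplier with a symbol of temperate growth. -/
theorem exists_fourier_eq_mul {h : Euc n → ℂ} (hh : h.HasTemperateGrowth) (u : 𝓢(Euc n, ℂ)) :
    ∃ v : 𝓢(Euc n, ℂ), ∀ ξ, 𝓕 (⇑v) ξ = h ξ * 𝓕 (⇑u) ξ := by
  refine ⟨𝓕⁻ (SchwartzMap.smulLeftCLM ℂ h (𝓕 u)), fun ξ => ?_⟩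
  rw [← SchwartzMap.fourier_coe, FourierTransform.fourier_fourierInv_eq,
    SchwartzMap.smulLeftCLM_apply_apply hh, smul_eq_mul, ← SchwartzMap.fourier_coe]

theorem mul_div_add_sq_le {A B : ℝ} (hA : 0 < A) (hB : 0 < B) :
    A * (B / (A + B)) ^ 2 ≤ A * B / (A + B) := by
  have h1 : B / (A + B) ≤ 1 := (div_le_one (by positivity)).2 (by linarith)
  have h2 : 0 ≤ A * B / (A + B) := by positivity
  calc A * (B / (A + B)) ^ 2 = A * B / (A + B) * (B / (A + B)) := by ring
    _ ≤ _ := mul_le_of_le_one_right h2 h1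

/-- The optimal decomposition of a Schwartz function for quadratic interpolation between Sobolev
spaces. -/
theorem exists_sobolev_decomposition (a b : ℝ) {l : ℝ} (hl : 0 < l) (u : 𝓢(Euc n, ℂ)) :
    ∃ u₀ u₁ : 𝓢(Euc n, ℂ), u = u₀ + u₁ ∧
      ∀ F : ℝ≥0∞, F = ∫⁻ ξ, ENNReal.ofReal (l * (1 + ‖ξ‖ ^ 2) ^ a * (1 + ‖ξ‖ ^ 2) ^ b /
        ((1 + ‖ξ‖ ^ 2) ^ a + l * (1 + ‖ξ‖ ^ 2) ^ b)) * ‖𝓕 (⇑u) ξ‖ₑ ^ 2 →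
      sobolevNormEuc a u₀ ^ 2 ≤ F ∧ ENNReal.ofReal l * sobolevNormEuc b u₁ ^ 2 ≤ F := by
  -- Chosen so that `(1 + Y²)⁻¹ = p / (p + l * q)` for `p = (1 + ‖ξ‖ ^ 2) ^ a` and `q = (1 + ‖ξ‖ ^
  -- 2) ^ b`. This exhibits the optimal multiplier as a composition of functions of temperate
  -- growth, so that it preserves Schwartz functions.
  set Y : Euc n → ℝ := fun ξ => Real.sqrt l * (1 + ‖ξ‖ ^ 2) ^ ((b - a) / 2) with hY
  have hYg : Y.HasTemperateGrowth := by
    simp only [hY]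
    exact (Function.HasTemperateGrowth.const _).mul
      (Function.hasTemperateGrowth_one_add_norm_sq_rpow (Euc n) _)
  have hg : (fun ξ => ((1 + ‖Y ξ‖ ^ 2) ^ (-1 : ℝ) : ℝ)).HasTemperateGrowth :=
    (Function.hasTemperateGrowth_one_add_norm_sq_rpow ℝ (-1)).comp hYg
  have hh : (fun ξ => (((1 + ‖Y ξ‖ ^ 2) ^ (-1 : ℝ) : ℝ) : ℂ)).HasTemperateGrowth :=
    Function.Complex.hasTemperateGrowth_ofReal.comp hg
  obtain ⟨u₁, hu₁⟩ := exists_fourier_eq_mul hh u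
  refine ⟨u - u₁, u₁, by simp, fun F hF => ?_⟩
  have hY2 : ∀ ξ, 1 + ‖Y ξ‖ ^ 2 = ((1 + ‖ξ‖ ^ 2) ^ a + l * (1 + ‖ξ‖ ^ 2) ^ b) /
      (1 + ‖ξ‖ ^ 2) ^ a := by
    intro ξ
    rw [add_div, div_self (by positivity), mul_div_assoc, ← Real.rpow_sub (by positivity)]
    simp only [hY]
    rw [norm_mul, mul_pow, Real.norm_of_nonneg (Real.sqrt_nonneg l), Real.sq_sqrt hl.le,
      Real.norm_of_nonneg (by positivity), rpow_sq_eq (by positivity),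
      mul_div_cancel₀ _ two_ne_zero]
  have hm : ∀ ξ, (1 + ‖Y ξ‖ ^ 2) ^ (-1 : ℝ) = (1 + ‖ξ‖ ^ 2) ^ a /
      ((1 + ‖ξ‖ ^ 2) ^ a + l * (1 + ‖ξ‖ ^ 2) ^ b) := fun ξ => by
    rw [Real.rpow_neg_one, hY2, inv_div]
  have hu₀ : ∀ ξ, 𝓕 (⇑(u - u₁)) ξ = ((l * (1 + ‖ξ‖ ^ 2) ^ b /
      ((1 + ‖ξ‖ ^ 2) ^ a + l * (1 + ‖ξ‖ ^ 2) ^ b) : ℝ) : ℂ) * 𝓕 (⇑u) ξ := by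
    intro ξ
    have e1 : 𝓕 (⇑(u - u₁)) ξ = 𝓕 (⇑u) ξ - 𝓕 (⇑u₁) ξ := by
      rw [← fourier_sub_apply u.integrable u₁.integrable]; rfl
    rw [e1, hu₁, hm, ← one_sub_mul]
    congr 1
    have : 0 < (1 + ‖ξ‖ ^ 2) ^ a + l * (1 + ‖ξ‖ ^ 2) ^ b := by positivity
    rw [← Complex.ofReal_one, ← Complex.ofReal_sub]
    congr 1
    field_simp
    ring
  have hen : ∀ (r : ℝ) (z : ℂ), 0 ≤ r → ‖(r : ℂ) * z‖ₑ ^ 2 = ENNReal.ofReal (r ^ 2) * ‖z‖ₑ ^ 2 := by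
    intro r z hr
    rw [enorm_mul, mul_pow, ENNReal.ofReal_pow hr, ← ofReal_norm, Complex.norm_real,
      Real.norm_of_nonneg hr]
  subst hF
  simp only [sobolevNormEuc_eq, wnorm_sq, wsq]
  constructor
  · refine lintegral_mono fun ξ => ?_
    have hA : 0 < (1 + ‖ξ‖ ^ 2) ^ a := by positivity
    have hB : 0 < l * (1 + ‖ξ‖ ^ 2) ^ b := by positivity
    rw [hu₀, hen _ _ (by positivity), ← mul_assoc, ← ENNReal.ofReal_mul (by positivity)]
    refine mul_le_mul_left (ENNReal.ofReal_le_ofReal ?_) _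
    rw [mul_right_comm, mul_comm (l * _)]
    exact mul_div_add_sq_le hA hB
  · rw [← lintegral_const_mul' _ _ ENNReal.ofReal_ne_top]
    refine lintegral_mono fun ξ => ?_
    have hA : 0 < (1 + ‖ξ‖ ^ 2) ^ a := by positivity
    have hB : 0 < l * (1 + ‖ξ‖ ^ 2) ^ b := by positivity
    rw [hu₁, hm, hen _ _ (by positivity), ← mul_assoc, ← mul_assoc, ← ENNReal.ofReal_mul hl.le,
      ← ENNReal.ofReal_mul (by positivity)]
    refine mul_le_mul_left (ENNReal.ofReal_le_ofReal ?_) _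
    exact le_of_eq_of_le (by ring) ((mul_div_add_sq_le hB hA).trans_eq (by ring))

end InterpolationEuc

/-! ### Sobolev norms under changes of coordinates -/

section Derivatives

variable {n : ℕ}

theorem contDiff_of_forall_tsupport {E F : Type*} [NormedAddCommGroup E] [NormedSpace ℝ E]
    [NormedAddCommGroup F] [NormedSpace ℝ F] {f : E → F}
    (h : ∀ x ∈ tsupport f, ContDiffAt ℝ ∞ f x) : ContDiff ℝ ∞ f := by
  refine contDiff_iff_contDiffAt.2 fun x => ?_
  by_cases hx : x ∈ tsupport f
  · exact h x hx
  · exact contDiffAt_const.congr_of_eventuallyEq (notMem_tsupport_iff_eventuallyEq.1 hx)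

/-- Quadratic interpolation for a sublinear map on Schwartz functions. -/
theorem sobolev_interp {β : Type*} [MeasurableSpace β] {ν : Measure β} [SFinite ν]
    {p q : β → ℝ} (hp : ∀ x, 0 < p x) (hq : ∀ x, 0 < q x) (hpm : Measurable p) (hqm : Measurable q)
    {T : 𝓢(Euc n, ℂ) → β → ℝ≥0∞} (hT : ∀ u, Measurable (T u))
    (hadd : ∀ u v x, T (u + v) x ≤ T u x + T v x) {a b : ℝ} (C : ℝ≥0)
    (ha : ∀ u, ∫⁻ x, ENNReal.ofReal (p x) * T u x ^ 2 ∂ν ≤ C * sobolevNormEuc a u ^ 2)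
    (hb : ∀ u, ∫⁻ x, ENNReal.ofReal (q x) * T u x ^ 2 ∂ν ≤ C * sobolevNormEuc b u ^ 2)
    {θ : ℝ} (h0 : 0 < θ) (h1 : θ < 1) (u : 𝓢(Euc n, ℂ)) :
    ∫⁻ x, ENNReal.ofReal (p x ^ (1 - θ) * q x ^ θ) * T u x ^ 2 ∂ν ≤
      2 * C * sobolevNormEuc ((1 - θ) * a + θ * b) u ^ 2 := by
  have h := lintegral_interp_le (μ := (volume : Measure (Euc n))) (ν := ν)
    (p := fun ξ => (1 + ‖ξ‖ ^ 2) ^ a) (q := fun ξ => (1 + ‖ξ‖ ^ 2) ^ b)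
    (fun ξ => by positivity) (fun ξ => by positivity) (by fun_prop) (by fun_prop) hp hq hpm hqm
    (measurable_enorm_fourier u) (hT u) C h0 h1 (fun l hl => ?_)
  · refine h.trans_eq ?_
    rw [sobolevNormEuc_eq, wnorm_sq, wsq]
    congr 2 with ξ
    rw [← Real.rpow_mul (by positivity), ← Real.rpow_mul (by positivity),
      ← Real.rpow_add (by positivity)]
    congr 3
    ring_nf
  · obtain ⟨u₀, u₁, rfl, hd⟩ := exists_sobolev_decomposition a b hl u
    obtain ⟨d₀, d₁⟩ := hd _ rfl
    refine ⟨T u₀, T u₁, hT _, hadd _ _, (ha u₀).trans (mul_le_mul_right d₀ _), ?_⟩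
    calc _ ≤ ENNReal.ofReal l * (C * sobolevNormEuc b u₁ ^ 2) := mul_le_mul_right (hb u₁) _
      _ = C * (ENNReal.ofReal l * sobolevNormEuc b u₁ ^ 2) := by ring
      _ ≤ _ := mul_le_mul_right d₁ _

theorem sobolevNormEuc_add_le (s : ℝ) (u v : 𝓢(Euc n, ℂ)) :
    sobolevNormEuc s (⇑(u + v)) ≤ sobolevNormEuc s u + sobolevNormEuc s v := by
  simp only [sobolevNormEuc_eq]
  refine (wnorm_mono fun ξ => ?_).trans
    (wnorm_add_le (measurable_enorm_fourier u) (measurable_enorm_fourier v))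
  have : 𝓕 (⇑(u + v)) ξ = 𝓕 (⇑u) ξ + 𝓕 (⇑v) ξ := by
    simp only [← SchwartzMap.fourier_coe, FourierTransform.fourier_add]
    rfl
  rw [this]
  exact enorm_add_le _ _

theorem sobolevNormEuc_smul (s : ℝ) (c : ℂ) (u : 𝓢(Euc n, ℂ)) :
    sobolevNormEuc s (⇑(c • u)) = ‖c‖₊ * sobolevNormEuc s u := by
  simp only [sobolevNormEuc_eq]
  rw [← wnorm_const_mul]
  congr 1 with ξ
  have : 𝓕 (⇑(c • u)) ξ = c * 𝓕 (⇑u) ξ := by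
    simp only [← SchwartzMap.fourier_coe, FourierTransform.fourier_smul]
    rfl
  rw [this, enorm_mul]
  rfl

theorem sobolevNormEuc_zero (s : ℝ) : sobolevNormEuc s (0 : Euc n → ℂ) = 0 := by
  have := sobolevNormEuc_smul s 0 (0 : 𝓢(Euc n, ℂ))
  simpa using this

theorem sobolevNormEuc_sum_le {ι : Type*} (s : ℝ) (I : Finset ι) (u : ι → 𝓢(Euc n, ℂ)) :
    sobolevNormEuc s (⇑(∑ i ∈ I, u i)) ≤ ∑ i ∈ I, sobolevNormEuc s (u i) := by
  classical
  induction I using Finset.induction_on with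
  | empty => simp [sobolevNormEuc_zero]
  | insert i I hi ih =>
    rw [Finset.sum_insert hi, Finset.sum_insert hi]
    exact (sobolevNormEuc_add_le _ _ _).trans (by gcongr)

/-- The partial derivative of a Schwartz function. -/
def pd (l : Fin n) (u : 𝓢(Euc n, ℂ)) : 𝓢(Euc n, ℂ) :=
  LineDeriv.lineDerivOp (EuclideanSpace.single l (1 : ℝ)) u

theorem pd_apply (l : Fin n) (u : 𝓢(Euc n, ℂ)) (x : Euc n) :
    pd l u x = fderiv ℝ u x (EuclideanSpace.single l 1) :=
  SchwartzMap.lineDerivOp_apply_eq_fderiv _ _ _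

theorem fourier_pd (l : Fin n) (u : 𝓢(Euc n, ℂ)) (ξ : Euc n) :
    𝓕 (⇑(pd l u)) ξ = 2 * Real.pi * Complex.I * ξ l * 𝓕 (⇑u) ξ := by
  have hg : (fun ξ : Euc n => inner ℝ ξ (EuclideanSpace.single l (1 : ℝ))).HasTemperateGrowth := by
    fun_prop
  rw [← SchwartzMap.fourier_coe, pd, SchwartzMap.fourier_lineDerivOp_eq, smul_apply,
    SchwartzMap.smulLeftCLM_apply_apply hg, ← SchwartzMap.fourier_coe,
    EuclideanSpace.inner_single_right]
  simp [mul_assoc]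

theorem sum_smul_single (y : Euc n) : ∑ l, y l • EuclideanSpace.single l (1 : ℝ) = y := by
  simpa using (EuclideanSpace.basisFun (Fin n) ℝ).sum_repr y

theorem wnorm_le_of_norm_le {s r : ℝ} {U V : Euc n → ℝ≥0∞}
    (h : ∀ ξ, ENNReal.ofReal ((1 + ‖ξ‖ ^ 2) ^ ((r - s) / 2)) * U ξ ≤ V ξ) :
    wnorm r U ≤ wnorm s V := by
  unfold wnorm wsq
  refine ENNReal.rpow_le_rpow (lintegral_mono fun ξ => ?_) (by norm_num)
  calc _ = ENNReal.ofReal ((1 + ‖ξ‖ ^ 2) ^ s) *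
        (ENNReal.ofReal ((1 + ‖ξ‖ ^ 2) ^ ((r - s) / 2)) * U ξ) ^ 2 := by
        rw [mul_pow, ← mul_assoc, ← ENNReal.ofReal_pow (by positivity),
          ← ENNReal.ofReal_mul (by positivity), rpow_sq_eq (by positivity),
          ← Real.rpow_add (by positivity)]
        congr 3
        ring
    _ ≤ _ := by gcongr; exact h ξ

theorem sobolevNormEuc_pd_le (s : ℝ) (l : Fin n) (u : 𝓢(Euc n, ℂ)) :
    sobolevNormEuc s (pd l u) ≤ (2 * NNReal.pi : ℝ≥0) * sobolevNormEuc (s + 1) u := by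
  simp only [sobolevNormEuc_eq]
  rw [← wnorm_const_mul]
  refine wnorm_le_of_norm_le fun ξ => ?_
  have h : ‖(2 * Real.pi * Complex.I * ξ l : ℂ)‖ = 2 * Real.pi * |ξ l| := by
    simp [abs_of_pos Real.pi_pos]
  have h1 : ENNReal.ofReal (2 * Real.pi) = ((2 * NNReal.pi : ℝ≥0) : ℝ≥0∞) := by
    rw [ENNReal.ofReal, Real.toNNReal_mul (by norm_num)]
    congr 2
    · norm_num
    · exact Real.toNNReal_coe (r := NNReal.pi)
  rw [fourier_pd, enorm_mul, ← mul_assoc, ← ofReal_norm (2 * Real.pi * Complex.I * ξ l : ℂ), h,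
    ← ENNReal.ofReal_mul (by positivity), ← h1]
  refine mul_le_mul_left (ENNReal.ofReal_le_ofReal ?_) _
  have h2 : |ξ l| ≤ (1 + ‖ξ‖ ^ 2) ^ (1 / 2 : ℝ) := by
    rw [← Real.sqrt_eq_rpow]
    refine Real.le_sqrt_of_sq_le ?_
    have := PiLp.norm_apply_le ξ l
    rw [Real.norm_eq_abs] at this
    nlinarith [abs_nonneg (ξ l)]
  rw [show (s - (s + 1)) / 2 = -(1 / 2 : ℝ) by ring, Real.rpow_neg (by positivity), inv_mul_eq_div,
    div_le_iff₀ (by positivity)]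
  gcongr

theorem wnorm_sum_le {ι : Type*} (s : ℝ) (I : Finset ι) {U : ι → Euc n → ℝ≥0∞}
    (hU : ∀ i, Measurable (U i)) :
    wnorm s (fun ξ => ∑ i ∈ I, U i ξ) ≤ ∑ i ∈ I, wnorm s (U i) := by
  classical
  induction I using Finset.induction_on with
  | empty => simp [wnorm, wsq]
  | insert i I hi ih =>
    simp only [Finset.sum_insert hi]
    exact (wnorm_add_le (hU i) (by fun_prop)).trans (by gcongr)

theorem norm_fourier_pd (l : Fin n) (u : 𝓢(Euc n, ℂ)) (ξ : Euc n) :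
    ‖𝓕 (⇑(pd l u)) ξ‖ = 2 * Real.pi * |ξ l| * ‖𝓕 (⇑u) ξ‖ := by
  rw [fourier_pd, norm_mul]
  simp [abs_of_pos Real.pi_pos]

theorem sobolevNormEuc_succ_le (s : ℝ) (u : 𝓢(Euc n, ℂ)) :
    sobolevNormEuc (s + 1) u ≤ sobolevNormEuc s u + ∑ l, sobolevNormEuc s (pd l u) := by
  simp only [sobolevNormEuc_eq]
  refine le_trans ?_ (add_le_add_right (wnorm_sum_le s Finset.univ
    (U := fun l ξ => ‖𝓕 (⇑(pd l u)) ξ‖ₑ) fun l => measurable_enorm_fourier _) _)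
  refine le_trans ?_ (wnorm_add_le (measurable_enorm_fourier u)
    (Finset.measurable_fun_sum _ fun l _ => measurable_enorm_fourier _))
  refine wnorm_le_of_norm_le fun ξ => ?_
  simp only [← ofReal_norm]
  rw [← ENNReal.ofReal_sum_of_nonneg (fun _ _ => norm_nonneg _),
    ← ENNReal.ofReal_add (norm_nonneg _) (Finset.sum_nonneg fun _ _ => norm_nonneg _),
    ← ENNReal.ofReal_mul (by positivity)]
  refine ENNReal.ofReal_le_ofReal ?_
  simp only [norm_fourier_pd]
  rw [← Finset.sum_mul, ← Finset.mul_sum, ← one_add_mul]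
  refine mul_le_mul_of_nonneg_right ?_ (norm_nonneg _)
  rw [show (s + 1 - s) / 2 = (1 / 2 : ℝ) by ring, ← Real.sqrt_eq_rpow]
  have h0 : 0 ≤ ∑ l, |ξ l| := Finset.sum_nonneg fun _ _ => abs_nonneg _
  have h1 : ‖ξ‖ ^ 2 ≤ (∑ l, |ξ l|) ^ 2 := by
    rw [EuclideanSpace.real_norm_sq_eq]
    simpa using Finset.sum_sq_le_sq_sum_of_nonneg (s := Finset.univ) (f := fun l => |ξ l|)
      fun _ _ => abs_nonneg _
  have h2 : 1 ≤ 2 * Real.pi := by linarith [Real.pi_gt_three]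
  refine (Real.sqrt_le_left (by positivity)).2 ?_
  nlinarith [mul_le_mul_of_nonneg_right h2 h0]

/-- `w = (1 - Δ / 4π²)⁻¹ u`, the Fourier multiplier of `1 - Δ / 4π²` being `1 + ‖ξ‖²` in this
normalization. It writes a function of low order through derivatives of a better one and so replaces
duality in the descent to negative orders. -/
theorem exists_sub_laplacian (u : 𝓢(Euc n, ℂ)) : ∃ w : 𝓢(Euc n, ℂ),
    u = w + ∑ l, (-(1 / (4 * Real.pi ^ 2) : ℂ)) • pd l (pd l w) ∧
    ∀ s, sobolevNormEuc (s + 2) w = sobolevNormEuc s u := by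
  have hh : (fun ξ : Euc n => (((1 + ‖ξ‖ ^ 2) ^ (-1 : ℝ) : ℝ) : ℂ)).HasTemperateGrowth :=
    Function.Complex.hasTemperateGrowth_ofReal.comp
      (Function.hasTemperateGrowth_one_add_norm_sq_rpow (Euc n) (-1))
  obtain ⟨w, hw⟩ := exists_fourier_eq_mul hh u
  have hw' : ∀ ξ, 𝓕 (⇑u) ξ = ((1 + ‖ξ‖ ^ 2 : ℝ) : ℂ) * 𝓕 (⇑w) ξ := by
    intro ξ
    have : (1 + ‖ξ‖ ^ 2) * (1 + ‖ξ‖ ^ 2) ^ (-1 : ℝ) = 1 := by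
      rw [Real.rpow_neg_one, mul_inv_cancel₀ (one_add_norm_sq_pos ξ).ne']
    rw [hw, ← mul_assoc, ← Complex.ofReal_mul, this, Complex.ofReal_one, one_mul]
  refine ⟨w, ?_, fun s => ?_⟩
  · have key : 𝓕 u = 𝓕 (w + ∑ l, (-(1 / (4 * Real.pi ^ 2) : ℂ)) • pd l (pd l w)) := by
      ext ξ
      rw [FourierTransform.fourier_add]
      have e1 : ∀ v : Fin n → 𝓢(Euc n, ℂ), 𝓕 (∑ l, v l) = ∑ l, 𝓕 (v l) := fun v =>
        map_sum (SchwartzMap.fourierTransformCLM ℂ) v Finset.univ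
      rw [e1]
      simp only [FourierTransform.fourier_smul, add_apply, sum_apply,
        smul_apply, SchwartzMap.fourier_coe, smul_eq_mul, fourier_pd, hw']
      have hπ : (Real.pi : ℂ) ≠ 0 := by exact_mod_cast Real.pi_ne_zero
      have e2 : ∀ l, -(1 / (4 * Real.pi ^ 2) : ℂ) *
          (2 * Real.pi * Complex.I * ξ l * (2 * Real.pi * Complex.I * ξ l * 𝓕 (⇑w) ξ)) =
          ((ξ l ^ 2 : ℝ) : ℂ) * 𝓕 (⇑w) ξ := by
        intro l
        push_cast
        field_simp
        linear_combination (-(ξ l : ℂ) ^ 2 * 𝓕 (⇑w) ξ * 4) * Complex.I_sq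
      simp only [e2]
      rw [← Finset.sum_mul, ← Complex.ofReal_sum, ← EuclideanSpace.real_norm_sq_eq]
      push_cast
      ring
    have := congrArg (fun v : 𝓢(Euc n, ℂ) => 𝓕⁻ v) key
    simpa only [FourierTransform.fourierInv_fourier_eq] using this
  · simp only [sobolevNormEuc_eq, wnorm, wsq]
    congr 2 with ξ
    rw [hw', enorm_mul, mul_pow, ← ofReal_norm ((1 + ‖ξ‖ ^ 2 : ℝ) : ℂ), Complex.norm_real,
      Real.norm_of_nonneg (by positivity), ← mul_assoc, ← ENNReal.ofReal_pow (by positivity),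
      ← ENNReal.ofReal_mul (by positivity), Real.rpow_add (by positivity), Real.rpow_two]

theorem sobolevNormEuc_zero_sq (u : 𝓢(Euc n, ℂ)) :
    sobolevNormEuc 0 u ^ 2 = ∫⁻ x, ‖u x‖ₑ ^ 2 := by
  have key : ∀ v : 𝓢(Euc n, ℂ), ∫⁻ x, ‖v x‖ₑ ^ 2 = ENNReal.ofReal (∫ x, ‖v x‖ ^ 2) := by
    intro v
    rw [ofReal_integral_eq_lintegral_ofReal]
    · simp_rw [ENNReal.ofReal_pow (norm_nonneg _), ofReal_norm]
    · exact (v.memLp 2 volume).integrable_norm_pow (by norm_num)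
    · exact ae_of_all _ fun x => by positivity
  rw [sobolevNormEuc_eq, wnorm_sq, wsq, key, ← SchwartzMap.integral_norm_sq_fourier, ← key]
  simp [SchwartzMap.fourier_coe]

end Derivatives

/-! ### Pull-backs by diffeomorphisms. -/

section ChangeOfCoordinates

variable {n : ℕ} {Φ : OpenPartialHomeomorph (Euc n) (Euc n)}

theorem isCc_mul_comp (hΦ : ContDiffOn ℝ ∞ Φ Φ.source) {χ : Euc n → ℂ} (hχ : IsCc χ)
    (hs : tsupport χ ⊆ Φ.source) {u : Euc n → ℂ} (hu : ContDiff ℝ ∞ u) :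
    IsCc fun x => χ x * u (Φ x) := by
  refine ⟨contDiff_of_forall_tsupport fun x hx => ?_, hχ.compact.mul_right⟩
  have hx' := hs (closure_mono (Function.support_mul_subset_left _ _) hx)
  exact hχ.smooth.contDiffAt.mul
    (hu.contDiffAt.comp x (hΦ.contDiffAt (Φ.open_source.mem_nhds hx')))

/-- The function `x ↦ χ x * u (Φ x)` as a Schwartz function. -/
def pullS (hΦ : ContDiffOn ℝ ∞ Φ Φ.source) {χ : Euc n → ℂ} (hχ : IsCc χ)
    (hs : tsupport χ ⊆ Φ.source) (u : 𝓢(Euc n, ℂ)) : 𝓢(Euc n, ℂ) :=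
  (isCc_mul_comp hΦ hχ hs (u.smooth ⊤)).toS

@[simp]
theorem pullS_apply (hΦ : ContDiffOn ℝ ∞ Φ Φ.source) {χ : Euc n → ℂ} (hχ : IsCc χ)
    (hs : tsupport χ ⊆ Φ.source) (u : 𝓢(Euc n, ℂ)) (x : Euc n) :
    pullS hΦ hχ hs u x = χ x * u (Φ x) := rfl

/-- All localized pull-backs by `Φ` are bounded on `H^s`. -/
def PullBounded (Φ : OpenPartialHomeomorph (Euc n) (Euc n)) (s : ℝ) : Prop :=
  ∀ χ : Euc n → ℂ, IsCc χ → tsupport χ ⊆ Φ.source → ∃ C : ℝ≥0, ∀ u : 𝓢(Euc n, ℂ),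
    sobolevNormEuc s (fun x => χ x * u (Φ x)) ≤ C * sobolevNormEuc s u

theorem isCc_mul_of_contDiffOn {χ : Euc n → ℂ} (hχ : IsCc χ) {V : Set (Euc n)} (hV : IsOpen V)
    (hs : tsupport χ ⊆ V) {c : Euc n → ℂ} (hc : ContDiffOn ℝ ∞ c V) :
    IsCc fun x => χ x * c x := by
  refine ⟨contDiff_of_forall_tsupport fun x hx => ?_, hχ.compact.mul_right⟩
  have hx' := hs (closure_mono (Function.support_mul_subset_left _ _) hx)
  exact hχ.smooth.contDiffAt.mul (hc.contDiffAt (hV.mem_nhds hx'))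

theorem tsupport_mul_subset_left' {X : Type*} [TopologicalSpace X] {χ c : X → ℂ} {V : Set X}
    (hs : tsupport χ ⊆ V) : tsupport (fun x => χ x * c x) ⊆ V :=
  (closure_mono (Function.support_mul_subset_left _ _)).trans hs

theorem IsCc.fderiv_apply {χ : Euc n → ℂ} (hχ : IsCc χ) (v : Euc n) :
    IsCc fun x => fderiv ℝ χ x v :=
  ⟨(hχ.smooth.fderiv_right (m := ∞) (by simp)).clm_apply contDiff_const,
    HasCompactSupport.of_support_subset_isCompact hχ.compact.isCompact
      ((Function.support_subset_iff'.2 fun x hx => by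
        have : fderiv ℝ χ x = 0 := by
          by_contra h
          exact hx (support_fderiv_subset ℝ h)
        simp [this]))⟩

theorem tsupport_fderiv_apply_subset' {χ : Euc n → ℂ} {V : Set (Euc n)} (hs : tsupport χ ⊆ V)
    (v : Euc n) : tsupport (fun x => fderiv ℝ χ x v) ⊆ V :=
  (closure_minimal (Function.support_subset_iff'.2 fun x hx => by
    have : fderiv ℝ χ x = 0 := by
      by_contra h
      exact hx (support_fderiv_subset ℝ h)
    simp [this]) (isClosed_tsupport χ)).trans hs

theorem contDiffOn_fderiv_apply {E F : Type*} [NormedAddCommGroup E] [NormedSpace ℝ E]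
    [NormedAddCommGroup F] [NormedSpace ℝ F] {f : E → F} {V : Set E} (hV : IsOpen V)
    (hf : ContDiffOn ℝ ∞ f V) : ContDiffOn ℝ ∞ (fderiv ℝ f) V :=
  hf.fderiv_of_isOpen hV (by simp)

/-- The product rule for a localized pull-back. -/
theorem fderiv_mul_comp_apply (hΦ : ContDiffOn ℝ ∞ Φ Φ.source) {χ : Euc n → ℂ} (hχ : IsCc χ)
    (hs : tsupport χ ⊆ Φ.source) (u : 𝓢(Euc n, ℂ)) (x v : Euc n) :
    fderiv ℝ (fun x => χ x * u (Φ x)) x v =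
      fderiv ℝ χ x v * u (Φ x) + χ x * fderiv ℝ u (Φ x) (fderiv ℝ Φ x v) := by
  by_cases hx : x ∈ tsupport χ
  · have h1 : DifferentiableAt ℝ χ x := (hχ.smooth.differentiable (by simp)).differentiableAt
    have h2 : DifferentiableAt ℝ Φ x :=
      (hΦ.contDiffAt (Φ.open_source.mem_nhds (hs hx))).differentiableAt (by simp)
    have h3 : DifferentiableAt ℝ u (Φ x) := u.differentiableAt
    have h4 := h1.hasFDerivAt.mul (h3.hasFDerivAt.comp x h2.hasFDerivAt)
    have h5 : fderiv ℝ (fun x => χ x * u (Φ x)) x = _ := h4.fderiv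
    rw [h5]
    simp
    ring
  · have h1 := notMem_tsupport_iff_eventuallyEq.1 hx
    have h2 : (fun x => χ x * u (Φ x)) =ᶠ[𝓝 x] fun _ => 0 := by
      filter_upwards [h1] with y hy
      simp [hy]
    have h3 : fderiv ℝ χ x = 0 := by rw [h1.fderiv_eq]; simp
    have h4 : χ x = 0 := h1.eq_of_nhds
    rw [h2.fderiv_eq, h3, h4]
    simp

theorem fderiv_eq_sum_pd (u : 𝓢(Euc n, ℂ)) (y v : Euc n) :
    fderiv ℝ u y v = ∑ l, (v l : ℂ) * pd l u y := by
  conv_lhs => rw [← sum_smul_single v, map_sum]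
  simp [pd_apply]

/-- By the chain rule, the derivatives of a localized pull-back of `u` are sums of localized
pull-backs of `u` and of its derivatives, with new cutoffs. This is why `PullBounded` quantifies
over all cutoffs. -/
theorem PullBounded.succ (hΦ : ContDiffOn ℝ ∞ Φ Φ.source) {s : ℝ} (h : PullBounded Φ s) :
    PullBounded Φ (s + 1) := by
  intro χ hχ hs
  have hcoef : ∀ l m : Fin n, ContDiffOn ℝ ∞
      (fun x => ((fderiv ℝ Φ x (EuclideanSpace.single l 1) m : ℝ) : ℂ)) Φ.source := fun l m => by
    have h1 := (contDiffOn_fderiv_apply Φ.open_source hΦ).clm_apply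
      (contDiffOn_const (c := EuclideanSpace.single l (1 : ℝ)))
    exact Complex.ofRealCLM.contDiff.comp_contDiffOn ((contDiff_piLp_apply 2).comp_contDiffOn h1)
  have hcc := fun l m => isCc_mul_of_contDiffOn hχ Φ.open_source hs (hcoef l m)
  have hcs := fun l m => tsupport_mul_subset_left' (c := fun x =>
    ((fderiv ℝ Φ x (EuclideanSpace.single l 1) m : ℝ) : ℂ)) hs
  obtain ⟨C₀, hC₀⟩ := h χ hχ hs
  choose C₁ hC₁ using fun l : Fin n => h _ (hχ.fderiv_apply (EuclideanSpace.single l 1))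
    (tsupport_fderiv_apply_subset' hs _)
  choose C₂ hC₂ using fun l m : Fin n => h _ (hcc l m) (hcs l m)
  refine ⟨C₀ + ∑ l, (C₁ l + ∑ m, C₂ l m * (2 * NNReal.pi)), fun u => ?_⟩
  have e : ∀ l, pd l (pullS hΦ hχ hs u) =
      pullS hΦ (hχ.fderiv_apply (EuclideanSpace.single l 1)) (tsupport_fderiv_apply_subset' hs _) u +
      ∑ m, pullS hΦ (hcc l m) (hcs l m) (pd m u) := by
    intro l
    ext x
    rw [pd_apply, add_apply, sum_apply]
    refine (fderiv_mul_comp_apply hΦ hχ hs u x _).trans ?_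
    simp only [pullS_apply]
    rw [fderiv_eq_sum_pd, Finset.mul_sum]
    simp only [mul_assoc]
  have hu := sobolevNormEuc_mono (show s ≤ s + 1 by linarith) u
  calc sobolevNormEuc (s + 1) (pullS hΦ hχ hs u)
      ≤ sobolevNormEuc s (pullS hΦ hχ hs u) + ∑ l, sobolevNormEuc s (pd l (pullS hΦ hχ hs u)) :=
        sobolevNormEuc_succ_le s _
    _ ≤ C₀ * sobolevNormEuc (s + 1) u + ∑ l, (C₁ l * sobolevNormEuc (s + 1) u +
          ∑ m, C₂ l m * ((2 * NNReal.pi : ℝ≥0) * sobolevNormEuc (s + 1) u)) := by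
        refine add_le_add ((hC₀ u).trans (by gcongr)) (Finset.sum_le_sum fun l _ => ?_)
        rw [e]
        refine (sobolevNormEuc_add_le _ _ _).trans (add_le_add ((hC₁ l u).trans (by gcongr)) ?_)
        refine (sobolevNormEuc_sum_le _ _ _).trans (Finset.sum_le_sum fun m _ => ?_)
        exact (hC₂ l m (pd m u)).trans (by gcongr; exact sobolevNormEuc_pd_le s m u)
    _ = _ := by
        push_cast
        rw [add_mul, Finset.sum_mul]
        congr 1
        refine Finset.sum_congr rfl fun l _ => ?_
        rw [add_mul, Finset.sum_mul]
        simp only [mul_assoc]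

theorem fderiv_apply_symm_fderiv (hΦ : ContDiffOn ℝ ∞ Φ Φ.source)
    (hΨ : ContDiffOn ℝ ∞ Φ.symm Φ.target) {x : Euc n} (hx : x ∈ Φ.source) :
    (fderiv ℝ Φ x).comp (fderiv ℝ Φ.symm (Φ x)) = ContinuousLinearMap.id ℝ (Euc n) := by
  have h1 : DifferentiableAt ℝ Φ x :=
    (hΦ.contDiffAt (Φ.open_source.mem_nhds hx)).differentiableAt (by simp)
  have h2 : DifferentiableAt ℝ Φ.symm (Φ x) :=
    (hΨ.contDiffAt (Φ.open_target.mem_nhds (Φ.map_source hx))).differentiableAt (by simp)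
  have h1' : HasFDerivAt Φ (fderiv ℝ Φ x) (Φ.symm (Φ x)) := by
    rw [Φ.left_inv hx]; exact h1.hasFDerivAt
  have h3 := h1'.comp (Φ x) h2.hasFDerivAt
  have h4 : (Φ ∘ Φ.symm) =ᶠ[𝓝 (Φ x)] id := by
    filter_upwards [Φ.open_target.mem_nhds (Φ.map_source hx)] with y hy
    exact Φ.right_inv hy
  exact (h3.congr_of_eventuallyEq h4.symm).unique (hasFDerivAt_id _)

/-- Write `u` as `w` plus second derivatives of `w`, where `w` is two orders better. One of the two
derivatives is spent on `w`; the other is pulled out of the pull-back by the inverse chain rule, so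
only boundedness of pull-backs on `H^s` is used. -/
theorem PullBounded.pred (hΦ : ContDiffOn ℝ ∞ Φ Φ.source) (hΨ : ContDiffOn ℝ ∞ Φ.symm Φ.target)
    {s : ℝ} (h : PullBounded Φ s) : PullBounded Φ (s - 1) := by
  intro χ hχ hs
  set c : Fin n → Fin n → Euc n → ℂ := fun l m x =>
    ((fderiv ℝ Φ.symm (Φ x) (EuclideanSpace.single m 1) l : ℝ) : ℂ)
  have hcoef : ∀ l m : Fin n, ContDiffOn ℝ ∞ (c l m) Φ.source := fun l m => by
    have h1 := (contDiffOn_fderiv_apply Φ.open_target hΨ).comp hΦ Φ.mapsTo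
    have h2 := h1.clm_apply (contDiffOn_const (c := EuclideanSpace.single m (1 : ℝ)))
    exact Complex.ofRealCLM.contDiff.comp_contDiffOn ((contDiff_piLp_apply 2).comp_contDiffOn h2)
  have hcc := fun l m => isCc_mul_of_contDiffOn hχ Φ.open_source hs (hcoef l m)
  have hcs := fun l m => tsupport_mul_subset_left' (c := c l m) hs
  have hdc := fun l m => (hcc l m).fderiv_apply (EuclideanSpace.single l 1)
  have hds := fun l m => tsupport_fderiv_apply_subset' (hcs l m) (EuclideanSpace.single l 1)
  obtain ⟨C₀, hC₀⟩ := h χ hχ hs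
  choose C₁ hC₁ using fun l m => h _ (hcc l m) (hcs l m)
  choose C₂ hC₂ using fun l m => h _ (hdc l m) (hds l m)
  set P : ℝ≥0 := 2 * NNReal.pi with hP
  set K : ℝ≥0 := ‖(-(1 / (4 * Real.pi ^ 2) : ℂ))‖₊ with hK
  refine ⟨C₀ + ∑ m, K * ∑ l, (P * (C₁ l m * P) + C₂ l m * P), fun u => ?_⟩
  obtain ⟨w, hw, hws⟩ := exists_sub_laplacian u
  -- Inverse chain rule `(∂_m v) ∘ Φ = ∑ c_{lm} ∂_l (v ∘ Φ)`, after which the product rule brings `χ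
  -- c_{lm}` under `∂_l`. The identity for `c` is that `dΦ ∘ dΦ⁻¹ = id`.
  have e : ∀ (m : Fin n) (v : 𝓢(Euc n, ℂ)), pullS hΦ hχ hs (pd m v) =
      ∑ l, (pd l (pullS hΦ (hcc l m) (hcs l m) v) +
        (-1 : ℂ) • pullS hΦ (hdc l m) (hds l m) v) := by
    intro m v
    ext x
    simp only [sum_apply, add_apply, smul_apply, smul_eq_mul, neg_one_mul]
    have e1 : ∀ l, pd l (pullS hΦ (hcc l m) (hcs l m) v) x +
        -(pullS hΦ (hdc l m) (hds l m) v x) =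
        χ x * (c l m x * fderiv ℝ v (Φ x) (fderiv ℝ Φ x (EuclideanSpace.single l 1))) := by
      intro l
      rw [pd_apply]
      refine (congrArg (· + _) (fderiv_mul_comp_apply hΦ (hcc l m) (hcs l m) v x _)).trans ?_
      simp only [pullS_apply]
      ring
    simp only [e1]
    rw [← Finset.mul_sum, pullS_apply]
    by_cases hx : x ∈ tsupport χ
    · congr 1
      have h1 := congrArg (fun L => L (EuclideanSpace.single m (1 : ℝ)))
        (fderiv_apply_symm_fderiv hΦ hΨ (hs hx))
      simp only [ContinuousLinearMap.comp_apply, ContinuousLinearMap.id_apply] at h1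
      rw [pd_apply]
      conv_lhs => rw [← h1, ← sum_smul_single (fderiv ℝ Φ.symm (Φ x) (EuclideanSpace.single m 1))]
      simp [c]
    · simp [image_eq_zero_of_notMem_tsupport hx]
  have hu : pullS hΦ hχ hs u = pullS hΦ hχ hs w +
      ∑ m, (-(1 / (4 * Real.pi ^ 2) : ℂ)) • pullS hΦ hχ hs (pd m (pd m w)) := by
    ext x
    conv_lhs => rw [hw]
    simp only [pullS_apply, add_apply, sum_apply, smul_apply, smul_eq_mul, mul_add, Finset.mul_sum]
    congr 1
    exact Finset.sum_congr rfl fun m _ => by ring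
  have hw1 : sobolevNormEuc (s + 1) w = sobolevNormEuc (s - 1) u := by
    rw [← hws]; congr 1; ring
  have hw0 : sobolevNormEuc s w ≤ sobolevNormEuc (s - 1) u := by
    rw [← hw1]; exact sobolevNormEuc_mono (by linarith) _
  have hwd : ∀ m, sobolevNormEuc s (pd m w) ≤ P * sobolevNormEuc (s - 1) u := fun m => by
    rw [← hw1]; exact sobolevNormEuc_pd_le s m w
  have hm : ∀ v : 𝓢(Euc n, ℂ), sobolevNormEuc (s - 1) v ≤ sobolevNormEuc s v := fun v =>
    sobolevNormEuc_mono (by linarith) _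
  change sobolevNormEuc (s - 1) (pullS hΦ hχ hs u) ≤ _
  rw [hu]
  calc _ ≤ C₀ * sobolevNormEuc (s - 1) u + ∑ m, K * ∑ l,
        (P * (C₁ l m * (P * sobolevNormEuc (s - 1) u)) +
          C₂ l m * (P * sobolevNormEuc (s - 1) u)) := by
        refine (sobolevNormEuc_add_le _ _ _).trans (add_le_add
          ((hm _).trans ((hC₀ w).trans (by gcongr))) ?_)
        refine (sobolevNormEuc_sum_le _ _ _).trans (Finset.sum_le_sum fun m _ => ?_)
        rw [sobolevNormEuc_smul, e]
        refine mul_le_mul_right ?_ _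
        refine (sobolevNormEuc_sum_le _ _ _).trans (Finset.sum_le_sum fun l _ => ?_)
        refine (sobolevNormEuc_add_le _ _ _).trans (add_le_add ?_ ?_)
        · refine (sobolevNormEuc_pd_le (s - 1) l _).trans (mul_le_mul_right ?_ _)
          rw [sub_add_cancel]
          exact (hC₁ l m _).trans (mul_le_mul_right (hwd m) _)
        · rw [sobolevNormEuc_smul]
          simp only [nnnorm_neg, nnnorm_one, ENNReal.coe_one, one_mul]
          exact (hm _).trans ((hC₂ l m _).trans (mul_le_mul_right (hwd m) _))
    _ = _ := by
        push_cast
        rw [add_mul, Finset.sum_mul]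
        congr 1
        refine Finset.sum_congr rfl fun m _ => ?_
        rw [mul_assoc, Finset.sum_mul]
        congr 1
        refine Finset.sum_congr rfl fun l _ => ?_
        ring

/-- Change of variables: on the compact support of `χ` the Jacobian determinant is bounded away from
zero. -/
theorem PullBounded.zero (hΦ : ContDiffOn ℝ ∞ Φ Φ.source) (hΨ : ContDiffOn ℝ ∞ Φ.symm Φ.target) :
    PullBounded Φ 0 := by
  intro χ hχ hs
  have hdet : ContinuousOn (fun x => (fderiv ℝ Φ x).det) Φ.source :=
    ContinuousLinearMap.continuous_det.comp_continuousOn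
      (contDiffOn_fderiv_apply Φ.open_source hΦ).continuousOn
  have hne : ∀ x ∈ Φ.source, (fderiv ℝ Φ x).det ≠ 0 := by
    intro x hx h0
    have h1 : LinearMap.det ((fderiv ℝ Φ x : Euc n →ₗ[ℝ] Euc n) ∘ₗ
        (fderiv ℝ Φ.symm (Φ x) : Euc n →ₗ[ℝ] Euc n)) = LinearMap.det LinearMap.id :=
      congrArg (fun L : Euc n →L[ℝ] Euc n => L.det) (fderiv_apply_symm_fderiv hΦ hΨ hx)
    rw [LinearMap.det_comp, LinearMap.det_id,
      show LinearMap.det (fderiv ℝ Φ x : Euc n →ₗ[ℝ] Euc n) = 0 from h0, zero_mul] at h1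
    exact zero_ne_one h1
  obtain ⟨A, hA⟩ := hχ.compact.isCompact.exists_bound_of_continuousOn
    (f := fun x => ‖χ x‖ ^ 2 * |(fderiv ℝ Φ x).det|⁻¹)
    ((hχ.smooth.continuous.norm.pow 2).continuousOn.mul
      ((hdet.mono hs).abs.inv₀ fun x hx => abs_ne_zero.2 (hne x (hs hx))))
  set B : ℝ≥0 := (max A 0).toNNReal
  have hB : ∀ x ∈ Φ.source, ‖χ x‖ₑ ^ 2 ≤ B * ENNReal.ofReal |(fderiv ℝ Φ x).det| := by
    intro x hx
    have hp : 0 < |(fderiv ℝ Φ x).det| := abs_pos.2 (hne x hx)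
    have h1 : (B : ℝ≥0∞) = ENNReal.ofReal (max A 0) := rfl
    rw [h1, ← ENNReal.ofReal_mul (by positivity), ← ofReal_norm, ← ENNReal.ofReal_pow (norm_nonneg _)]
    refine ENNReal.ofReal_le_ofReal ?_
    by_cases hx' : x ∈ tsupport χ
    · have := hA x hx'
      rw [Real.norm_of_nonneg (by positivity), ← div_eq_mul_inv, div_le_iff₀ hp] at this
      exact this.trans (by gcongr; exact le_max_left _ _)
    · rw [image_eq_zero_of_notMem_tsupport hx']
      rw [norm_zero, zero_pow two_ne_zero]
      positivity
  refine ⟨NNReal.sqrt B, fun u => ?_⟩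
  rw [← ENNReal.pow_le_pow_left_iff two_ne_zero, mul_pow]
  change sobolevNormEuc 0 (pullS hΦ hχ hs u) ^ 2 ≤ _
  rw [sobolevNormEuc_zero_sq, sobolevNormEuc_zero_sq]
  have hsq : ((NNReal.sqrt B : ℝ≥0) : ℝ≥0∞) ^ 2 = B := by
    rw [← ENNReal.coe_pow, NNReal.sq_sqrt]
  rw [hsq]
  have hms := Φ.open_source.measurableSet
  calc ∫⁻ x, ‖pullS hΦ hχ hs u x‖ₑ ^ 2
      = ∫⁻ x in Φ.source, ‖pullS hΦ hχ hs u x‖ₑ ^ 2 := by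
        rw [← lintegral_indicator hms]
        refine lintegral_congr fun x => ?_
        by_cases hx : x ∈ Φ.source
        · rw [indicator_of_mem hx]
        · have := image_eq_zero_of_notMem_tsupport fun h => hx (hs h)
          simp [indicator_of_notMem hx, this]
    _ ≤ ∫⁻ x in Φ.source, B * (ENNReal.ofReal |(fderiv ℝ Φ x).det| * ‖u (Φ x)‖ₑ ^ 2) := by
        refine setLIntegral_mono' hms fun x hx => ?_
        rw [pullS_apply, enorm_mul, mul_pow, ← mul_assoc]
        exact mul_le_mul_left (hB x hx) _
    _ = B * ∫⁻ y in Φ '' Φ.source, ‖u y‖ₑ ^ 2 := by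
        rw [lintegral_const_mul' _ _ ENNReal.coe_ne_top,
          lintegral_image_eq_lintegral_abs_det_fderiv_mul volume hms (fun x hx =>
            ((hΦ.contDiffAt (Φ.open_source.mem_nhds hx)).differentiableAt
              (by simp)).hasFDerivAt.hasFDerivWithinAt) Φ.injOn]
    _ ≤ _ := mul_le_mul_right (setLIntegral_le_lintegral _ _) _

theorem pullBounded_int (hΦ : ContDiffOn ℝ ∞ Φ Φ.source) (hΨ : ContDiffOn ℝ ∞ Φ.symm Φ.target)
    (k : ℤ) : PullBounded Φ k := by
  induction k using Int.induction_on with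
  | zero => simpa using PullBounded.zero hΦ hΨ
  | succ k ih => push_cast at ih ⊢; exact ih.succ hΦ
  | pred k ih => push_cast at ih ⊢; exact ih.pred hΦ hΨ

theorem rpow_half_le_iff {x y : ℝ≥0∞} : x ^ 2 ≤ y ^ 2 ↔ x ≤ y :=
  ENNReal.pow_le_pow_left_iff two_ne_zero

/-- Localized pull-backs by a diffeomorphism are bounded on all Sobolev spaces. -/
theorem pullBounded (hΦ : ContDiffOn ℝ ∞ Φ Φ.source) (hΨ : ContDiffOn ℝ ∞ Φ.symm Φ.target)
    (s : ℝ) : PullBounded Φ s := by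
  rcases eq_or_lt_of_le (Int.floor_le s) with hs | hs
  · rw [← hs]; exact pullBounded_int hΦ hΨ _
  intro χ hχ hχs
  set k := ⌊s⌋
  obtain ⟨C₀, hC₀⟩ := pullBounded_int hΦ hΨ k χ hχ hχs
  obtain ⟨C₁, hC₁⟩ := pullBounded_int hΦ hΨ (k + 1) χ hχ hχs
  have hs1 : s < k + 1 := Int.lt_floor_add_one s
  set C := max (C₀ ^ 2) (C₁ ^ 2)
  have hadd : ∀ u v, pullS hΦ hχ hχs (u + v) = pullS hΦ hχ hχs u + pullS hΦ hχ hχs v := by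
    intro u v; ext x; simp [mul_add]
  -- Orders which are not integers: interpolation between `⌊s⌋` and `⌊s⌋ + 1`.
  have hint := sobolev_interp (ν := (volume : Measure (Euc n)))
    (p := fun ξ => (1 + ‖ξ‖ ^ 2) ^ (k : ℝ)) (q := fun ξ => (1 + ‖ξ‖ ^ 2) ^ ((k + 1 : ℤ) : ℝ))
    (fun ξ => by positivity) (fun ξ => by positivity) (by fun_prop) (by fun_prop)
    (T := fun u ξ => ‖𝓕 (⇑(pullS hΦ hχ hχs u)) ξ‖ₑ) (fun u => measurable_enorm_fourier _)
    (fun u v ξ => by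
      rw [hadd]
      have : 𝓕 (⇑(pullS hΦ hχ hχs u + pullS hΦ hχ hχs v)) ξ =
          𝓕 (⇑(pullS hΦ hχ hχs u)) ξ + 𝓕 (⇑(pullS hΦ hχ hχs v)) ξ := by
        simp only [← SchwartzMap.fourier_coe, FourierTransform.fourier_add]
        rfl
      rw [this]
      exact enorm_add_le _ _) (a := k) (b := (k + 1 : ℤ)) C
    (fun u => by
      have := pow_le_pow_left₀ zero_le (hC₀ u) 2
      rw [mul_pow, sobolevNormEuc_eq, wnorm_sq, wsq] at this
      refine this.trans (mul_le_mul_left ?_ _)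
      exact_mod_cast le_max_left _ _)
    (fun u => by
      have := pow_le_pow_left₀ zero_le (hC₁ u) 2
      rw [mul_pow, sobolevNormEuc_eq, wnorm_sq, wsq] at this
      refine this.trans (mul_le_mul_left ?_ _)
      exact_mod_cast le_max_right _ _)
    (θ := s - k) (by linarith) (by linarith)
  refine ⟨NNReal.sqrt (2 * C), fun u => ?_⟩
  rw [← rpow_half_le_iff, mul_pow, ← ENNReal.coe_pow, NNReal.sq_sqrt]
  refine le_trans (le_of_eq ?_) ((hint u).trans_eq ?_)
  · rw [sobolevNormEuc_eq, wnorm_sq, wsq]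
    congr 1 with ξ
    rw [← Real.rpow_mul (by positivity), ← Real.rpow_mul (by positivity),
      ← Real.rpow_add (by positivity)]
    congr 3
    push_cast
    ring
  · push_cast
    congr 3
    ring

end ChangeOfCoordinates

/-! ### Smooth functions, charts and partitions of unity on closed subsets. -/

section Geometry

/-- A smooth immersion has, locally, a smooth left inverse on the ambient space. -/
theorem exists_local_leftInverse {n m : ℕ} {g : Euc n → Euc m} {V : Set (Euc n)} (hV : IsOpen V)
    (hg : ContDiffOn ℝ ∞ g V) {y₀ : Euc n} (hy₀ : y₀ ∈ V)
    (hinj : Function.Injective (fderiv ℝ g y₀)) :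
    ∃ U : Set (Euc m), IsOpen U ∧ g y₀ ∈ U ∧ ∃ G : Euc m → Euc n, ContDiffOn ℝ ∞ G U ∧
      ∀ᶠ y in 𝓝 y₀, G (g y) = y := by
  -- Let `L` be a linear left inverse of the derivative at `y₀`. Then `L ∘ g` is a local
  -- diffeomorphism there, and `G = (L ∘ g)⁻¹ ∘ L`.
  obtain ⟨L₀, hL₀⟩ := LinearMap.exists_leftInverse_of_injective
    (fderiv ℝ g y₀ : Euc n →ₗ[ℝ] Euc m) (LinearMap.ker_eq_bot.2 hinj)
  set L : Euc m →L[ℝ] Euc n := LinearMap.toContinuousLinearMap L₀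
  set h : Euc n → Euc n := fun y => L (g y)
  have hh : ContDiffOn ℝ ∞ h V := L.contDiff.comp_contDiffOn hg
  have hgd : ∀ y ∈ V, HasFDerivAt h (L.comp (fderiv ℝ g y)) y := fun y hy =>
    L.hasFDerivAt.comp y ((hg.contDiffAt (hV.mem_nhds hy)).differentiableAt (by simp)).hasFDerivAt
  have hid : L.comp (fderiv ℝ g y₀) = (ContinuousLinearEquiv.refl ℝ (Euc n) : Euc n →L[ℝ] Euc n) := by
    ext1 v
    exact congrArg (fun l => l v) hL₀
  have hat := hh.contDiffAt (hV.mem_nhds hy₀)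
  have hder : HasFDerivAt h ((ContinuousLinearEquiv.refl ℝ (Euc n) : Euc n →L[ℝ] Euc n)) y₀ :=
    hid ▸ hgd y₀ hy₀
  set e := hat.toOpenPartialHomeomorph h hder (by simp)
  have hee : (e : Euc n → Euc n) = h := rfl
  have hmem : y₀ ∈ e.source := hat.mem_toOpenPartialHomeomorph_source hder (by simp)
  have hcont : ContinuousAt (fun y => L.comp (fderiv ℝ g y)) y₀ :=
    (continuous_const.clm_comp continuous_id).continuousAt.comp
      ((contDiffOn_fderiv_apply hV hg).continuousOn.continuousAt (hV.mem_nhds hy₀))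
  -- Smoothness of the local inverse at a point requires an invertible derivative at that point, so
  -- the neighbourhood is shrunk until the derivative is invertible throughout.
  have hnear : ∀ᶠ y in 𝓝 y₀, L.comp (fderiv ℝ g y) ∈
      range ((↑) : (Euc n ≃L[ℝ] Euc n) → (Euc n →L[ℝ] Euc n)) :=
    hcont.eventually (by
      change range _ ∈ 𝓝 (L.comp (fderiv ℝ g y₀))
      rw [hid]
      exact ContinuousLinearEquiv.nhds _)
  obtain ⟨W, hWs, hWo, hW0⟩ := eventually_nhds_iff.1 (hnear.and
    ((hV.eventually_mem hy₀).and (e.open_source.eventually_mem hmem)))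
  have hopen : IsOpen (e '' W) := e.isOpen_image_of_subset_source hWo fun y hy => (hWs y hy).2.2
  refine ⟨L ⁻¹' (e '' W), hopen.preimage L.continuous, ⟨y₀, hW0, rfl⟩, fun x => e.symm (L x), ?_, ?_⟩
  · intro x hx
    obtain ⟨y, hy, hyx⟩ := hx
    obtain ⟨⟨E, hE⟩, hyV, hys⟩ := hWs y hy
    have hs : e.symm (L x) = y := by rw [← hyx, e.left_inv hys]
    refine ContDiffAt.contDiffWithinAt (ContDiffAt.comp x ?_ L.contDiff.contDiffAt)
    refine e.contDiffAt_symm (f₀' := E) (by rw [← hyx]; exact e.map_source hys) ?_ ?_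
    · rw [hs, hE]; exact hgd y hyV
    · rw [hs]; exact hh.contDiffAt (hV.mem_nhds hyV)
  · filter_upwards [e.open_source.mem_nhds hmem] with y hy
    exact e.left_inv hy

variable {m n : ℕ} {M : Set (Euc m)}

/-- Functions which extend smoothly near every point are smooth. -/
theorem mem_smoothFun_of_local (hM : IsClosed M) {f : M → ℂ}
    (h : ∀ p : M, ∃ U ∈ 𝓝 (p : Euc m), ∃ F : Euc m → ℂ, ContDiffOn ℝ ∞ F U ∧
      ∀ x : M, (x : Euc m) ∈ U → F x = f x) : f ∈ SmoothFun M := by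
  classical
  -- The value is prescribed on `M` and free off `M`. These constraints are convex, so a partition
  -- of unity glues the local extensions.
  obtain ⟨g, hg⟩ := exists_contMDiffMap_forall_mem_convex_of_local (n := (⊤ : ℕ∞))
    (I := modelWithCornersSelf ℝ (Euc m)) (M := Euc m) (F := ℂ)
    (t := fun x => {z | ∀ hx : x ∈ M, z = f ⟨x, hx⟩})
    (fun x => by
      by_cases hx : x ∈ M
      · have : {z | ∀ hx : x ∈ M, z = f ⟨x, hx⟩} = {f ⟨x, hx⟩} := by ext; simp [hx]
        rw [this]; exact convex_singleton _
      · have : {z | ∀ hx : x ∈ M, z = f ⟨x, hx⟩} = univ := by ext; simp [hx]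
        rw [this]; exact convex_univ)
    (fun x => by
      by_cases hx : x ∈ M
      · obtain ⟨U, hU, F, hF, hFf⟩ := h ⟨x, hx⟩
        exact ⟨U, hU, F, hF.contMDiffOn, fun y hy hyM => hFf ⟨y, hyM⟩ hy⟩
      · exact ⟨Mᶜ, hM.isOpen_compl.mem_nhds hx, 0, contMDiffOn_const,
          fun y hy hyM => absurd hyM hy⟩)
  exact ⟨g, g.contMDiff.contDiff, fun x => hg x x.2⟩

/-- A smooth left inverse of the parametrization extends the chart to the ambient space. The
neighbourhood is chosen so that its points on `M` lie in the chart domain, which is possible by the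
definition of the subspace topology. -/
theorem IsSmoothChart.exists_extension {κ : OpenPartialHomeomorph M (Euc n)} (hκ : IsSmoothChart κ)
    {p : M} (hp : p ∈ κ.source) :
    ∃ U : Set (Euc m), IsOpen U ∧ (p : Euc m) ∈ U ∧ ∃ G : Euc m → Euc n, ContDiffOn ℝ ∞ G U ∧
      ∀ x : M, (x : Euc m) ∈ U → x ∈ κ.source ∧ G x = κ x := by
  obtain ⟨U, hU, hpU, G, hG, hGg⟩ := exists_local_leftInverse κ.open_target hκ.1
    (κ.map_source hp) (hκ.2 _ (κ.map_source hp))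
  rw [κ.left_inv hp] at hpU
  have h1 : ∀ᶠ x in 𝓝 p, x ∈ κ.source ∧ G x = κ x := by
    filter_upwards [κ.open_source.mem_nhds hp, (κ.continuousAt hp).eventually hGg] with x hx hx'
    rw [κ.left_inv hx] at hx'
    exact ⟨hx, hx'⟩
  rw [nhds_subtype_eq_comap, eventually_comap] at h1
  obtain ⟨W, hW, hWo, hpW⟩ := eventually_nhds_iff.1 h1
  exact ⟨U ∩ W, hU.inter hWo, ⟨hpU, hpW⟩, G, hG.mono inter_subset_left,
    fun x hx => hW x hx.2 x rfl⟩

/-- The function `ψ * (u ∘ κ)` on `M`. -/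
def chartPush (hM : IsClosed M) {κ : OpenPartialHomeomorph M (Euc n)} (hκ : IsSmoothChart κ)
    {ψ : SmoothFun M} (hψ : tsupport (ψ : M → ℂ) ⊆ κ.source) {u : Euc n → ℂ}
    (hu : ContDiff ℝ ∞ u) : SmoothFun M :=
  ⟨fun x => (ψ : M → ℂ) x * u (κ x), mem_smoothFun_of_local hM fun p => by
    obtain ⟨F, hF, hFψ⟩ := ψ.2
    by_cases hp : p ∈ κ.source
    · obtain ⟨U, hU, hpU, G, hG, hGκ⟩ := hκ.exists_extension hp
      exact ⟨U, hU.mem_nhds hpU, fun x => F x * u (G x),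
        hF.contDiffOn.mul (hu.comp_contDiffOn hG), fun x hx => by
          simp only [hFψ, (hGκ x hx).2]⟩
    · have h1 : ∀ᶠ x in 𝓝 p, (ψ : M → ℂ) x = 0 :=
        notMem_tsupport_iff_eventuallyEq.1 fun h => hp (hψ h)
      rw [nhds_subtype_eq_comap, eventually_comap] at h1
      exact ⟨_, h1, 0, contDiff_const.contDiffOn, fun x hx => by simp [hx x rfl]⟩⟩

@[simp]
theorem chartPush_apply (hM : IsClosed M) {κ : OpenPartialHomeomorph M (Euc n)}
    (hκ : IsSmoothChart κ) {ψ : SmoothFun M} (hψ : tsupport (ψ : M → ℂ) ⊆ κ.source) {u : Euc n → ℂ}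
    (hu : ContDiff ℝ ∞ u) (x : M) :
    (chartPush hM hκ hψ hu : M → ℂ) x = (ψ : M → ℂ) x * u (κ x) := rfl

theorem SmoothFun.continuous (f : SmoothFun M) : Continuous (f : M → ℂ) := by
  obtain ⟨F, hF, hFf⟩ := f.2
  have : (f : M → ℂ) = fun x : M => F x := funext fun x => (hFf x).symm
  rw [this]
  exact hF.continuous.comp continuous_subtype_val

theorem chartPull_mul (κ : OpenPartialHomeomorph M (Euc n)) (f g : SmoothFun M) (y : Euc n) :
    chartPull κ (f * g) y = chartPull κ f y * chartPull κ g y := by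
  by_cases hy : y ∈ κ.target <;> simp [chartPull, hy]

theorem chartPull_add (κ : OpenPartialHomeomorph M (Euc n)) (f g : SmoothFun M) :
    chartPull κ (f + g) = fun y => chartPull κ f y + chartPull κ g y := by
  ext y
  by_cases hy : y ∈ κ.target <;> simp [chartPull, hy]

theorem chartPull_smul (κ : OpenPartialHomeomorph M (Euc n)) (c : ℂ) (f : SmoothFun M) :
    chartPull κ (c • f) = fun y => c * chartPull κ f y := by
  ext y
  by_cases hy : y ∈ κ.target <;> simp [chartPull, hy]

theorem tsupport_chartPull_subset [CompactSpace M] {κ : OpenPartialHomeomorph M (Euc n)}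
    {f : SmoothFun M} (hf : tsupport (f : M → ℂ) ⊆ κ.source) :
    tsupport (chartPull κ f) ⊆ κ '' tsupport (f : M → ℂ) ∧
      IsCompact (κ '' tsupport (f : M → ℂ)) := by
  have hc : IsCompact (κ '' tsupport (f : M → ℂ)) :=
    (isClosed_tsupport _).isCompact.image_of_continuousOn (κ.continuousOn.mono hf)
  refine ⟨closure_minimal (fun y hy => ?_) hc.isClosed, hc⟩
  have hyt : y ∈ κ.target := by
    by_contra h
    exact hy (indicator_of_notMem h _)
  rw [Function.mem_support, chartPull, indicator_of_mem hyt] at hy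
  exact ⟨κ.symm y, subset_tsupport _ hy, κ.right_inv hyt⟩

theorem tsupport_chartPull_subset_target [CompactSpace M] {κ : OpenPartialHomeomorph M (Euc n)}
    {f : SmoothFun M} (hf : tsupport (f : M → ℂ) ⊆ κ.source) :
    tsupport (chartPull κ f) ⊆ κ.target :=
  (tsupport_chartPull_subset hf).1.trans
    ((image_mono hf).trans (κ.mapsTo.image_subset))

theorem isCc_chartPull [CompactSpace M] {κ : OpenPartialHomeomorph M (Euc n)}
    (hκ : IsSmoothChart κ) {f : SmoothFun M} (hf : tsupport (f : M → ℂ) ⊆ κ.source) :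
    IsCc (chartPull κ f) := by
  refine ⟨contDiff_of_forall_tsupport fun y hy => ?_,
    (tsupport_chartPull_subset hf).2.of_isClosed_subset (isClosed_tsupport _)
      (tsupport_chartPull_subset hf).1⟩
  obtain ⟨F, hF, hFf⟩ := f.2
  have hyt := tsupport_chartPull_subset_target hf hy
  refine ((hF.contDiffAt (x := ((κ.symm y : M) : Euc m))).comp y
    (hκ.1.contDiffAt (κ.open_target.mem_nhds hyt))).congr_of_eventuallyEq ?_
  filter_upwards [κ.open_target.mem_nhds hyt] with z hz
  simp [chartPull, hz, hFf]

/-- Smooth charts are smoothly compatible. -/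
theorem IsSmoothChart.contDiffOn_transition {κ κ' : OpenPartialHomeomorph M (Euc n)}
    (hκ : IsSmoothChart κ) (hκ' : IsSmoothChart κ') :
    ContDiffOn ℝ ∞ (κ.symm.trans κ') (κ.symm.trans κ').source := by
  intro y hy
  rw [OpenPartialHomeomorph.trans_source] at hy
  have hy' : κ.symm y ∈ κ'.source := hy.2
  have hyt : y ∈ κ.target := hy.1
  obtain ⟨U, hU, hpU, G, hG, hGκ⟩ := hκ'.exists_extension hy'
  have hg : ContDiffAt ℝ ∞ (fun y => (κ.symm y : Euc m)) y :=
    hκ.1.contDiffAt (κ.open_target.mem_nhds hyt)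
  refine (((hG.contDiffAt (hU.mem_nhds hpU)).comp y hg).congr_of_eventuallyEq
    ?_).contDiffWithinAt
  filter_upwards [hg.continuousAt.eventually (hU.mem_nhds hpU)] with z hz
  exact (hGκ _ hz).2.symm

/-- Smooth partitions of unity on a compact `M`. -/
theorem exists_partition [CompactSpace M] (U : M → Set M) (hU : ∀ p, IsOpen (U p))
    (hp : ∀ p, p ∈ U p) : ∃ (t : Finset M) (ρ : t → SmoothFun M),
      (∀ i, tsupport (ρ i : M → ℂ) ⊆ U i) ∧ ∑ i, ρ i = 1 := by
  have hMc : IsCompact M := isCompact_iff_compactSpace.2 inferInstance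
  obtain ⟨t, ht⟩ := isCompact_univ.elim_finite_subcover U hU
    (fun p _ => mem_iUnion.2 ⟨p, hp p⟩)
  choose V hV hVU using fun p => isOpen_induced_iff.1 (hU p)
  obtain ⟨ρ, hρ⟩ := SmoothPartitionOfUnity.exists_isSubordinate
    (modelWithCornersSelf ℝ (Euc m)) hMc.isClosed (fun i : t => V i) (fun i => hV i) (fun x hx => by
      obtain ⟨i, hi⟩ := mem_iUnion.1 (ht (mem_univ ⟨x, hx⟩))
      obtain ⟨hit, hxi⟩ := mem_iUnion.1 hi
      rw [← hVU] at hxi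
      exact mem_iUnion.2 ⟨⟨i, hit⟩, hxi⟩)
  refine ⟨t, fun i => ⟨fun x => (ρ i x : ℂ), fun x => (ρ i x : ℂ),
    Complex.ofRealCLM.contDiff.comp (ρ i).contMDiff.contDiff, fun x => rfl⟩, fun i => ?_, ?_⟩
  · rw [← hVU]
    intro x hx
    refine hρ i ?_
    have h1 : closure (Function.support fun x : M => (ρ i x : ℂ)) ⊆
        (Subtype.val : M → Euc m) ⁻¹' closure (Function.support (ρ i)) :=
      closure_minimal (fun y hy => subset_closure (by
        simpa using hy)) (isClosed_closure.preimage continuous_subtype_val)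
    exact h1 hx
  · ext x
    have h1 := ρ.sum_eq_one x.2
    rw [finsum_eq_sum_of_fintype] at h1
    simp only [AddSubmonoidClass.coe_finsetSum, Finset.sum_apply, OneMemClass.coe_one, Pi.one_apply]
    exact_mod_cast h1

/-- Smooth functions equal to one near a closed set, supported in a given neighbourhood. -/
theorem exists_cutoff [CompactSpace M] {A O : Set M} (hA : IsClosed A) (hO : IsOpen O)
    (hAO : A ⊆ O) : ∃ η : SmoothFun M, tsupport (η : M → ℂ) ⊆ O ∧
      ∀ x ∈ A, ∀ᶠ y in 𝓝 x, (η : M → ℂ) y = 1 := by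
  classical
  obtain ⟨t, ρ, hρ, hsum⟩ := exists_partition (fun p => if p ∈ A then O else Aᶜ)
    (fun p => by split_ifs; exacts [hO, hA.isOpen_compl])
    (fun p => by
      by_cases h : p ∈ A
      · simpa [h] using hAO h
      · simp [h])
  -- Members centred in `A` are supported in `O`. The others are supported in `Aᶜ`, hence vanish
  -- near each point of `A`, where the selected members therefore add up to one.
  set S : Finset t := Finset.univ.filter fun i => (i : M) ∈ A
  refine ⟨∑ i ∈ S, ρ i, ?_, fun x hx => ?_⟩
  · refine (closure_minimal ?_ (isClosed_biUnion_finset (s := S)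
      fun i _ => isClosed_tsupport (ρ i : M → ℂ))).trans (iUnion₂_subset fun i hi => ?_)
    · intro x hx
      simp only [Function.mem_support, AddSubmonoidClass.coe_finsetSum, Finset.sum_apply] at hx
      obtain ⟨i, hi, hix⟩ := Finset.exists_ne_zero_of_sum_ne_zero hx
      exact mem_iUnion₂.2 ⟨i, hi, subset_tsupport _ hix⟩
    · have := hρ i
      rwa [if_pos (Finset.mem_filter.1 hi).2] at this
  · have h1 : ∀ᶠ y in 𝓝 x, ∀ i : t, (i : M) ∉ A → (ρ i : M → ℂ) y = 0 := by
      rw [eventually_all]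
      intro i
      by_cases hi : (i : M) ∈ A
      · simp [hi]
      · have := hρ i
        rw [if_neg hi] at this
        filter_upwards [notMem_tsupport_iff_eventuallyEq.1 fun h => this h hx] with y hy _
        exact hy
    filter_upwards [h1] with y hy
    have h2 := congrArg (fun f : SmoothFun M => (f : M → ℂ) y) hsum
    simp only [AddSubmonoidClass.coe_finsetSum, Finset.sum_apply, OneMemClass.coe_one,
      Pi.one_apply] at h2 ⊢
    rw [← h2, Finset.sum_filter]
    refine Finset.sum_congr rfl fun i _ => ?_
    split_ifs with h
    · rfl
    · exact (hy i h).symm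

end Geometry

/-! ### Charts containing two given points. -/

section CommonCharts

variable {m n : ℕ} {M : Set (Euc m)}

/-- A chart which is locally a translate of smooth charts is smooth. -/
theorem isSmoothChart_of_local {κ : OpenPartialHomeomorph M (Euc n)}
    (h : ∀ y ∈ κ.target, ∃ (κ' : OpenPartialHomeomorph M (Euc n)) (v : Euc n), IsSmoothChart κ' ∧
      y - v ∈ κ'.target ∧ ∀ᶠ z in 𝓝 y, κ.symm z = κ'.symm (z - v)) : IsSmoothChart κ := by
  have key : ∀ y ∈ κ.target, ContDiffAt ℝ ∞ (fun y => (κ.symm y : Euc m)) y ∧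
      Function.Injective (fderiv ℝ (fun z => (κ.symm z : Euc m)) y) := by
    intro y hy
    obtain ⟨κ', v, hκ', hyv, he⟩ := h y hy
    have he' : (fun z => (κ.symm z : Euc m)) =ᶠ[𝓝 y] fun z => (κ'.symm (z - v) : Euc m) := by
      filter_upwards [he] with z hz
      rw [hz]
    refine ⟨ContDiffAt.congr_of_eventuallyEq ?_ he', ?_⟩
    · exact ContDiffAt.comp (g := fun z => (κ'.symm z : Euc m)) (f := fun z => z - v) y
        (hκ'.1.contDiffAt (κ'.open_target.mem_nhds hyv))
        (contDiff_id.sub contDiff_const).contDiffAt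
    · rw [he'.fderiv_eq]
      have := fderiv_comp_sub (𝕜 := ℝ) (f := fun z => (κ'.symm z : Euc m)) (x := y) v
      rw [this]
      exact hκ'.2 _ hyv
  exact ⟨fun y hy => (key y hy).1.contDiffWithinAt, fun y hy => (key y hy).2⟩

theorem IsSmoothChart.restrOpen {κ : OpenPartialHomeomorph M (Euc n)} (hκ : IsSmoothChart κ)
    {s : Set M} (hs : IsOpen s) : IsSmoothChart (κ.restrOpen s hs) :=
  isSmoothChart_of_local fun y hy => ⟨κ, 0, hκ, by
    rw [sub_zero]; exact hy.1, Eventually.of_forall fun z => by rw [sub_zero]; rfl⟩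

theorem IsSmoothChart.translate {κ : OpenPartialHomeomorph M (Euc n)} (hκ : IsSmoothChart κ)
    (v : Euc n) : IsSmoothChart (κ.transHomeomorph (Homeomorph.addRight v)) :=
  isSmoothChart_of_local fun y hy => ⟨κ, v, hκ, by
    rw [sub_eq_add_neg]; exact hy, Eventually.of_forall fun z => by rw [sub_eq_add_neg]; rfl⟩

open Classical in
theorem IsSmoothChart.disjointUnion {κ κ' : OpenPartialHomeomorph M (Euc n)} (hκ : IsSmoothChart κ)
    (hκ' : IsSmoothChart κ') (hs : Disjoint κ.source κ'.source)
    (ht : Disjoint κ.target κ'.target) : IsSmoothChart (κ.disjointUnion κ' hs ht) := by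
  refine isSmoothChart_of_local fun y hy => ?_
  have hco : ∀ z, (κ.disjointUnion κ' hs ht).symm z = κ.target.piecewise κ.symm κ'.symm z :=
    fun z => rfl
  rcases hy with hy | hy
  · refine ⟨κ, 0, hκ, by rwa [sub_zero], ?_⟩
    filter_upwards [κ.open_target.mem_nhds hy] with z hz
    rw [hco, sub_zero, piecewise_eq_of_mem _ _ _ hz]
  · refine ⟨κ', 0, hκ', by rwa [sub_zero], ?_⟩
    filter_upwards [κ'.open_target.mem_nhds hy] with z hz
    rw [hco, sub_zero, piecewise_eq_of_notMem _ _ _ fun h => ht.le_bot ⟨h, hz⟩]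

theorem SobolevAtlas.exists_chart (𝒜 : SobolevAtlas n M) (p : M) :
    ∃ κ : OpenPartialHomeomorph M (Euc n), IsSmoothChart κ ∧ p ∈ κ.source := by
  have h : ∑ i, (𝒜.cutoff i : M → ℂ) p ≠ 0 := by rw [𝒜.partition p]; exact one_ne_zero
  obtain ⟨i, -, hi⟩ := Finset.exists_ne_zero_of_sum_ne_zero h
  exact ⟨𝒜.chart i, 𝒜.smooth i, 𝒜.subordinate i (subset_tsupport _ hi)⟩

/-- Any two points lie in the domain of a common smooth chart. -/
theorem SobolevAtlas.exists_common_chart (𝒜 : SobolevAtlas n M) (hn : 0 < n) (p q : M) :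
    ∃ κ : OpenPartialHomeomorph M (Euc n), IsSmoothChart κ ∧ p ∈ κ.source ∧ q ∈ κ.source := by
  classical
  obtain ⟨κ, hκ, hp⟩ := 𝒜.exists_chart p
  rcases eq_or_ne p q with rfl | hpq
  · exact ⟨κ, hκ, hp, hp⟩
  obtain ⟨κ', hκ', hq⟩ := 𝒜.exists_chart q
  obtain ⟨U, V, hU, hV, hpU, hqV, hUV⟩ := t2_separation hpq
  -- This translation puts the image of `q` at distance `2` from `κ p`, so the unit balls about the
  -- two images are disjoint; it needs `0 < n`.
  set v : Euc n := κ p - κ' q + EuclideanSpace.single ⟨0, hn⟩ (2 : ℝ) with hv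
  have ho := κ.isOpen_inter_preimage (Metric.isOpen_ball (x := κ p) (ε := 1))
  have ho' := κ'.isOpen_inter_preimage (Metric.isOpen_ball (x := κ' q) (ε := 1))
  set k := κ.restrOpen _ (ho.inter hU)
  set k' := (κ'.restrOpen _ (ho'.inter hV)).transHomeomorph (Homeomorph.addRight v)
  have hs : Disjoint k.source k'.source :=
    hUV.mono (fun x hx => hx.2.2) (fun x hx => hx.2.2)
  have ht : Disjoint k.target k'.target := by
    rw [Set.disjoint_left]
    rintro y ⟨hy, hy2⟩ hy'
    have h1 : dist y (κ p) < 1 := by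
      have : κ (κ.symm y) ∈ Metric.ball (κ p) 1 := hy2.1.2
      rwa [κ.right_inv hy] at this
    have h2 : dist (y + -v) (κ' q) < 1 := by
      have h3 : y + -v ∈ (κ'.restrOpen _ (ho'.inter hV)).target := hy'
      have h4 : κ' (κ'.symm (y + -v)) ∈ Metric.ball (κ' q) 1 := h3.2.1.2
      rwa [κ'.right_inv h3.1] at h4
    have h5 : ‖EuclideanSpace.single (⟨0, hn⟩ : Fin n) (2 : ℝ)‖ = 2 := by simp
    have h6 : EuclideanSpace.single (⟨0, hn⟩ : Fin n) (2 : ℝ) = (y - κ p) - (y + -v - κ' q) := by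
      rw [hv]; abel
    rw [h6] at h5
    have h7 := norm_sub_le (y - κ p) (y + -v - κ' q)
    rw [dist_eq_norm] at h1 h2
    linarith
  refine ⟨k.disjointUnion k' hs ht, ((hκ.restrOpen _).disjointUnion
    ((hκ'.restrOpen _).translate v) hs ht), Or.inl ⟨hp, ⟨hp, ?_⟩, hpU⟩, Or.inr ⟨hq, ⟨hq, ?_⟩, hqV⟩⟩
  · exact Metric.mem_ball_self one_pos
  · exact Metric.mem_ball_self one_pos

/-- A partition of unity such that the supports of any two members lie in a common chart. -/
theorem SobolevAtlas.exists_fine_partition [CompactSpace M] (𝒜 : SobolevAtlas n M) (hn : 0 < n) :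
    ∃ (t : Finset M) (θ : t → SmoothFun M), ∑ i, θ i = 1 ∧
      ∀ i j, ∃ κ : OpenPartialHomeomorph M (Euc n), IsSmoothChart κ ∧
        tsupport (θ i : M → ℂ) ⊆ κ.source ∧ tsupport (θ j : M → ℂ) ⊆ κ.source := by
  choose κ hκ hp hq using 𝒜.exists_common_chart hn
  -- A Lebesgue number for a cover of `M × M` by squares of chart domains: in the maximum metric,
  -- the `δ`-balls about any two points lie in one common chart.
  obtain ⟨δ, hδ, H⟩ := lebesgue_number_lemma_of_metric (s := (univ : Set (M × M)))
    (c := fun x : M × M => (κ x.1 x.2).source ×ˢ (κ x.1 x.2).source) isCompact_univ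
    (fun x => (κ x.1 x.2).open_source.prod (κ x.1 x.2).open_source)
    (fun x _ => mem_iUnion.2 ⟨x, hp _ _, hq _ _⟩)
  obtain ⟨t, θ, hθ, hsum⟩ := exists_partition (fun p : M => Metric.ball p δ)
    (fun p => Metric.isOpen_ball) (fun p => Metric.mem_ball_self hδ)
  refine ⟨t, θ, hsum, fun i j => ?_⟩
  obtain ⟨x, hx⟩ := H ((i : M), (j : M)) (mem_univ _)
  refine ⟨κ x.1 x.2, hκ _ _, fun y hy => ?_, fun y hy => ?_⟩
  · refine (hx (show (y, (j : M)) ∈ _ from ?_)).1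
    rw [← ball_prod_same]
    exact ⟨hθ i hy, Metric.mem_ball_self hδ⟩
  · refine (hx (show ((i : M), y) ∈ _ from ?_)).2
    rw [← ball_prod_same]
    exact ⟨Metric.mem_ball_self hδ, hθ j hy⟩

end CommonCharts

/-! ### Sobolev norms on the manifold. -/

section ManifoldNorms

theorem sobolevNormEuc_lt_top {n : ℕ} (s : ℝ) (u : 𝓢(Euc n, ℂ)) : sobolevNormEuc s u < ⊤ := by
  rw [sobolevNormEuc_eq, wnorm]
  refine ENNReal.rpow_lt_top_of_nonneg (by norm_num) (ne_of_lt ?_)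
  have h1 := (integrable_one_add_norm_rpow_mul (2 * s) (𝓕 u)).2
  obtain ⟨B, hB⟩ := (𝓕 u).decay 0 0
  have hB0 : 0 ≤ B := hB.1.le
  have hB1 : ∀ ξ, ‖(𝓕 u) ξ‖ ≤ B := fun ξ => by simpa using hB.2 ξ
  have h2 : ∀ ξ : Euc n, ENNReal.ofReal ((1 + ‖ξ‖ ^ 2) ^ s) * ‖𝓕 (⇑u) ξ‖ₑ ^ 2 ≤
      ENNReal.ofReal (2 ^ |s| * B) * ‖(1 + ‖ξ‖) ^ (2 * s) * ‖(𝓕 u) ξ‖‖ₑ := fun ξ => by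
    rw [← SchwartzMap.fourier_coe, ← ofReal_norm, ← ofReal_norm, ← ENNReal.ofReal_pow (norm_nonneg _),
      ← ENNReal.ofReal_mul (by positivity), ← ENNReal.ofReal_mul (by positivity)]
    refine ENNReal.ofReal_le_ofReal ?_
    rw [Real.norm_of_nonneg (by have := one_add_norm_pos ξ; positivity)]
    have h3 := one_add_norm_sq_rpow_le s ξ
    have h4 := hB1 ξ
    have := one_add_norm_pos ξ
    calc (1 + ‖ξ‖ ^ 2) ^ s * ‖(𝓕 u) ξ‖ ^ 2 ≤
        (2 ^ |s| * (1 + ‖ξ‖) ^ (2 * s)) * (B * ‖(𝓕 u) ξ‖) := by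
          refine mul_le_mul h3 ?_ (by positivity) (by positivity)
          rw [sq]
          exact mul_le_mul_of_nonneg_right h4 (norm_nonneg _)
      _ = _ := by ring
  refine (lintegral_mono h2).trans_lt ?_
  rw [lintegral_const_mul' _ _ ENNReal.ofReal_ne_top]
  exact ENNReal.mul_lt_top ENNReal.ofReal_lt_top h1

/-- Above the threshold `B` the term `ε * X ^ s` dominates; below it `X ^ s'` is bounded. -/
theorem rpow_le_add_of_lt {s' s ε : ℝ} (hs : s' < s) (hε : 0 < ε) :
    ∃ K : ℝ, 0 ≤ K ∧ ∀ X : ℝ, 1 ≤ X → X ^ s' ≤ ε * X ^ s + K := by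
  set B := max 1 ((1 / ε) ^ (1 / (s - s')))
  have hB : 1 ≤ B := le_max_left _ _
  refine ⟨B ^ |s'|, by positivity, fun X hX => ?_⟩
  have hX0 : 0 < X := by linarith
  by_cases h : X ≤ B
  · have h1 : X ^ s' ≤ B ^ |s'| := (Real.rpow_le_rpow_of_exponent_le hX (le_abs_self _)).trans
      (Real.rpow_le_rpow hX0.le h (abs_nonneg _))
    have : 0 ≤ ε * X ^ s := by positivity
    linarith
  · push Not at h
    have h1 : (1 / ε) ^ (1 / (s - s')) ≤ X := (le_max_right _ _).trans h.le
    have h2 := Real.rpow_le_rpow (by positivity) h1 (sub_pos.2 hs).le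
    rw [← Real.rpow_mul (by positivity), one_div_mul_cancel (sub_pos.2 hs).ne', Real.rpow_one,
      div_le_iff₀ hε] at h2
    have h3 : X ^ s = X ^ (s - s') * X ^ s' := by rw [← Real.rpow_add hX0]; ring_nf
    have h4 : 0 < X ^ s' := by positivity
    have h5 : 0 ≤ B ^ |s'| := by positivity
    rw [h3]
    nlinarith

theorem wsq_le_add {n : ℕ} {s' s ε : ℝ} (hs : s' < s) (hε : 0 < ε) :
    ∃ K : ℝ≥0, ∀ U : Euc n → ℝ≥0∞, Measurable U →
      wsq s' U ≤ ENNReal.ofReal ε * wsq s U + K * wsq 0 U := by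
  obtain ⟨K, hK, h⟩ := rpow_le_add_of_lt hs hε
  refine ⟨K.toNNReal, fun U hU => ?_⟩
  have hm : ∀ r : ℝ, Measurable fun ξ : Euc n => ENNReal.ofReal ((1 + ‖ξ‖ ^ 2) ^ r) * U ξ ^ 2 :=
    fun r => (measurable_weight r).mul (hU.pow_const 2)
  unfold wsq
  rw [← lintegral_const_mul _ (hm s), ← lintegral_const_mul _ (hm 0),
    ← lintegral_add_left ((hm s).const_mul _)]
  refine lintegral_mono fun ξ => ?_
  rw [Real.rpow_zero, ENNReal.ofReal_one, one_mul, ← mul_assoc, ← add_mul,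
    ← ENNReal.ofReal_mul hε.le, ENNReal.ofNNReal_toNNReal, ← ENNReal.ofReal_add (by positivity) hK]
  exact mul_le_mul_left (ENNReal.ofReal_le_ofReal (h _ (by nlinarith [sq_nonneg ‖ξ‖]))) _

variable {m n : ℕ} {M : Set (Euc m)}

theorem tsupport_mul_left {V : Set M} {χ : SmoothFun M} (h : tsupport (χ : M → ℂ) ⊆ V)
    (f : SmoothFun M) : tsupport ((χ * f : SmoothFun M) : M → ℂ) ⊆ V :=
  (tsupport_mul_subset_left (f := (χ : M → ℂ)) (g := (f : M → ℂ))).trans h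

theorem tsupport_mul_right {V : Set M} {χ : SmoothFun M} (h : tsupport (χ : M → ℂ) ⊆ V)
    (f : SmoothFun M) : tsupport ((f * χ : SmoothFun M) : M → ℂ) ⊆ V :=
  (tsupport_mul_subset_right (f := (f : M → ℂ)) (g := (χ : M → ℂ))).trans h

theorem exists_cutoff_mul [CompactSpace M] {A O : Set M} (hA : IsClosed A) (hO : IsOpen O)
    (hAO : A ⊆ O) : ∃ η : SmoothFun M, tsupport (η : M → ℂ) ⊆ O ∧
      ∀ f : SmoothFun M, tsupport (f : M → ℂ) ⊆ A → η * f = f := by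
  obtain ⟨η, hη, h1⟩ := exists_cutoff hA hO hAO
  refine ⟨η, hη, fun f hf => ?_⟩
  ext x
  change (η : M → ℂ) x * (f : M → ℂ) x = (f : M → ℂ) x
  by_cases hx : x ∈ tsupport (f : M → ℂ)
  · rw [(h1 x (hf hx)).self_of_nhds, one_mul]
  · rw [image_eq_zero_of_notMem_tsupport hx, mul_zero]

variable {κ κ' : OpenPartialHomeomorph M (Euc n)}

section

variable [CompactSpace M]

/-- A function supported in a chart as a Schwartz function. -/
def chartS (hκ : IsSmoothChart κ) {f : SmoothFun M} (hf : tsupport (f : M → ℂ) ⊆ κ.source) :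
    𝓢(Euc n, ℂ) := (isCc_chartPull hκ hf).toS

@[simp]
theorem coe_chartS (hκ : IsSmoothChart κ) {f : SmoothFun M} (hf : tsupport (f : M → ℂ) ⊆ κ.source) :
    ⇑(chartS hκ hf) = chartPull κ f := rfl

/-- Change of charts. -/
theorem exists_chartPull_le (hκ : IsSmoothChart κ) (hκ' : IsSmoothChart κ') {ψ χ : SmoothFun M}
    (hψ : tsupport (ψ : M → ℂ) ⊆ κ.source) (hχ : tsupport (χ : M → ℂ) ⊆ κ'.source) (s : ℝ) :
    ∃ C : ℝ≥0, ∀ f : SmoothFun M, sobolevNormEuc s (chartPull κ (ψ * χ * f)) ≤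
      C * sobolevNormEuc s (chartPull κ' (χ * f)) := by
  -- The pull-back by the transition map needs a cutoff supported in the overlap of the charts. `ψ *
  -- η` is one, and `η * χ = χ` makes its insertion harmless.
  obtain ⟨η, hη, hη1⟩ := exists_cutoff_mul (isClosed_tsupport (χ : M → ℂ)) κ'.open_source hχ
  have hb := isCc_chartPull hκ (tsupport_mul_left hψ η)
  have hbs : tsupport (chartPull κ (ψ * η)) ⊆ (κ.symm.trans κ').source := by
    refine (tsupport_chartPull_subset (tsupport_mul_left hψ η)).1.trans ?_
    rintro _ ⟨x, hx, rfl⟩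
    have hx1 := tsupport_mul_left hψ η hx
    refine ⟨κ.map_source hx1, ?_⟩
    change κ.symm (κ x) ∈ κ'.source
    rw [κ.left_inv hx1]
    exact tsupport_mul_right hη ψ hx
  have hΦ := hκ.contDiffOn_transition hκ'
  have hΨ := hκ'.contDiffOn_transition hκ
  have he : (κ.symm.trans κ').symm = κ'.symm.trans κ := by
    rw [OpenPartialHomeomorph.trans_symm_eq_symm_trans_symm, OpenPartialHomeomorph.symm_symm]
  obtain ⟨C, hC⟩ := pullBounded hΦ (by rw [← OpenPartialHomeomorph.symm_source, he]; exact hΨ) s _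
    hb hbs
  refine ⟨C, fun f => ?_⟩
  refine le_trans (le_of_eq ?_) (hC (chartS hκ' (tsupport_mul_left hχ f)))
  congr 1
  ext y
  rw [coe_chartS]
  by_cases hy : y ∈ κ.target
  · have h1 : (η : M → ℂ) (κ.symm y) * (χ : M → ℂ) (κ.symm y) = (χ : M → ℂ) (κ.symm y) :=
      congrArg (fun g : SmoothFun M => (g : M → ℂ) (κ.symm y)) (hη1 χ le_rfl)
    simp only [chartPull, indicator_of_mem hy, MulMemClass.coe_mul, Pi.mul_apply]
    by_cases hy' : κ.symm y ∈ κ'.source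
    · rw [OpenPartialHomeomorph.coe_trans, Function.comp_apply,
        indicator_of_mem (κ'.map_source hy'), κ'.left_inv hy']
      linear_combination (-(ψ : M → ℂ) (κ.symm y) * (f : M → ℂ) (κ.symm y)) * h1
    · rw [image_eq_zero_of_notMem_tsupport fun h => hy' (hχ h),
        image_eq_zero_of_notMem_tsupport fun h => hy' (hη h)]
      simp
  · simp [chartPull, hy]

end

variable (𝒜 : SobolevAtlas n M)

theorem sobolevNorm_sq (s : ℝ) (f : SmoothFun M) : sobolevNorm 𝒜 s f ^ 2 =
    ∑ i, sobolevNormEuc s (chartPull (𝒜.chart i) (𝒜.cutoff i * f)) ^ 2 := rpow_half_sq _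

theorem le_sobolevNorm (s : ℝ) (i : Fin 𝒜.size) (f : SmoothFun M) :
    sobolevNormEuc s (chartPull (𝒜.chart i) (𝒜.cutoff i * f)) ≤ sobolevNorm 𝒜 s f := by
  rw [← rpow_half_le_iff, sobolevNorm_sq]
  exact Finset.single_le_sum (f := fun i =>
    sobolevNormEuc s (chartPull (𝒜.chart i) (𝒜.cutoff i * f)) ^ 2) (fun _ _ => zero_le)
    (Finset.mem_univ i)

theorem sobolevNorm_le_sum (s : ℝ) (f : SmoothFun M) : sobolevNorm 𝒜 s f ≤
    ∑ i, sobolevNormEuc s (chartPull (𝒜.chart i) (𝒜.cutoff i * f)) := by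
  rw [← rpow_half_le_iff, sobolevNorm_sq]
  exact Finset.sum_sq_le_sq_sum_of_nonneg fun _ _ => zero_le

theorem sobolevNorm_mono {s r : ℝ} (h : s ≤ r) (f : SmoothFun M) :
    sobolevNorm 𝒜 s f ≤ sobolevNorm 𝒜 r f := by
  rw [← rpow_half_le_iff, sobolevNorm_sq, sobolevNorm_sq]
  exact Finset.sum_le_sum fun i _ => pow_le_pow_left₀ zero_le (sobolevNormEuc_mono h _) 2

theorem SobolevAtlas.sum_cutoff_mul (f : SmoothFun M) : ∑ i, 𝒜.cutoff i * f = f := by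
  rw [← Finset.sum_mul]
  have : ∑ i, 𝒜.cutoff i = 1 := by
    ext x
    simpa using 𝒜.partition x
  rw [this, one_mul]

variable [CompactSpace M]

theorem sobolevNorm_lt_top (s : ℝ) (f : SmoothFun M) : sobolevNorm 𝒜 s f < ⊤ :=
  (sobolevNorm_le_sum 𝒜 s f).trans_lt (ENNReal.sum_lt_top.2 fun i _ =>
    sobolevNormEuc_lt_top s (chartS (𝒜.smooth i) (tsupport_mul_left (𝒜.subordinate i) f)))

theorem sobolevNorm_smul (s : ℝ) (c : ℂ) (f : SmoothFun M) :
    sobolevNorm 𝒜 s (c • f) = ‖c‖₊ * sobolevNorm 𝒜 s f := by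
  have h : ∀ i, sobolevNormEuc s (chartPull (𝒜.chart i) (𝒜.cutoff i * c • f)) =
      ‖c‖₊ * sobolevNormEuc s (chartPull (𝒜.chart i) (𝒜.cutoff i * f)) := fun i => by
    rw [mul_smul_comm, chartPull_smul]
    exact sobolevNormEuc_smul s c (chartS (𝒜.smooth i) (tsupport_mul_left (𝒜.subordinate i) f))
  refine (ENNReal.pow_right_strictMono two_ne_zero).injective ?_
  simp only [mul_pow, sobolevNorm_sq, h, Finset.mul_sum]

theorem sobolevNorm_add_le (s : ℝ) (f g : SmoothFun M) :
    sobolevNorm 𝒜 s (f + g) ≤ sobolevNorm 𝒜 s f + sobolevNorm 𝒜 s g := by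
  have h : ∀ i, sobolevNormEuc s (chartPull (𝒜.chart i) (𝒜.cutoff i * (f + g))) ≤
      sobolevNormEuc s (chartPull (𝒜.chart i) (𝒜.cutoff i * f)) +
      sobolevNormEuc s (chartPull (𝒜.chart i) (𝒜.cutoff i * g)) := fun i => by
    rw [mul_add, chartPull_add]
    exact sobolevNormEuc_add_le s (chartS (𝒜.smooth i) (tsupport_mul_left (𝒜.subordinate i) f))
      (chartS (𝒜.smooth i) (tsupport_mul_left (𝒜.subordinate i) g))
  have h1 := ENNReal.Lp_add_le Finset.univ
    (fun i => sobolevNormEuc s (chartPull (𝒜.chart i) (𝒜.cutoff i * f)))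
    (fun i => sobolevNormEuc s (chartPull (𝒜.chart i) (𝒜.cutoff i * g))) (p := 2) (by norm_num)
  simp only [ENNReal.rpow_two] at h1
  refine le_trans ?_ h1
  unfold sobolevNorm
  gcongr with i
  exact h i

theorem sobolevNorm_zero (s : ℝ) : sobolevNorm 𝒜 s (0 : SmoothFun M) = 0 := by
  simpa using sobolevNorm_smul 𝒜 s 0 (0 : SmoothFun M)

theorem sobolevNorm_sum_le {ι : Type*} (s : ℝ) (I : Finset ι) (f : ι → SmoothFun M) :
    sobolevNorm 𝒜 s (∑ i ∈ I, f i) ≤ ∑ i ∈ I, sobolevNorm 𝒜 s (f i) :=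
  Finset.le_sum_of_subadditive _ (sobolevNorm_zero 𝒜 s).le (sobolevNorm_add_le 𝒜 s) _ _

/-- Localization to an arbitrary chart is bounded. -/
theorem exists_chartPull_le_sobolevNorm (hκ : IsSmoothChart κ) {ψ : SmoothFun M}
    (hψ : tsupport (ψ : M → ℂ) ⊆ κ.source) (s : ℝ) : ∃ C : ℝ≥0, ∀ f : SmoothFun M,
      sobolevNormEuc s (chartPull κ (ψ * f)) ≤ C * sobolevNorm 𝒜 s f := by
  choose C hC using fun i => exists_chartPull_le hκ (𝒜.smooth i) hψ (𝒜.subordinate i) s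
  refine ⟨∑ i, C i, fun f => ?_⟩
  have h1 : chartS hκ (tsupport_mul_left hψ f) =
      ∑ i, chartS hκ (tsupport_mul_left (tsupport_mul_left hψ (𝒜.cutoff i)) f) := by
    ext y
    rw [sum_apply]
    simp only [coe_chartS]
    conv_lhs => rw [← 𝒜.sum_cutoff_mul f]
    by_cases hy : y ∈ κ.target
    · simp [chartPull, hy, Finset.mul_sum, mul_assoc]
    · simp [chartPull, hy]
  rw [← coe_chartS hκ (tsupport_mul_left hψ f), h1]
  refine (sobolevNormEuc_sum_le _ _ _).trans ?_
  push_cast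
  rw [Finset.sum_mul]
  exact Finset.sum_le_sum fun i _ => (hC i f).trans (mul_le_mul_right (le_sobolevNorm 𝒜 s i f) _)

/-- The Sobolev norm of a function supported in a chart is bounded by that of its localization. -/
theorem exists_sobolevNorm_le_chartPull (hκ : IsSmoothChart κ) {χ : SmoothFun M}
    (hχ : tsupport (χ : M → ℂ) ⊆ κ.source) (s : ℝ) : ∃ C : ℝ≥0, ∀ f : SmoothFun M,
      sobolevNorm 𝒜 s (χ * f) ≤ C * sobolevNormEuc s (chartPull κ (χ * f)) := by
  choose C hC using fun i => exists_chartPull_le (𝒜.smooth i) hκ (𝒜.subordinate i) hχ s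
  refine ⟨∑ i, C i, fun f => (sobolevNorm_le_sum 𝒜 s _).trans ?_⟩
  push_cast
  rw [Finset.sum_mul]
  refine Finset.sum_le_sum fun i _ => ?_
  rw [← mul_assoc]
  exact hC i f

theorem exists_sobolevNorm_mul_le (s : ℝ) (g : SmoothFun M) : ∃ C : ℝ≥0, ∀ f : SmoothFun M,
    sobolevNorm 𝒜 s (g * f) ≤ C * sobolevNorm 𝒜 s f := by
  choose C hC using fun i => exists_chartPull_le_sobolevNorm 𝒜 (𝒜.smooth i)
    (tsupport_mul_left (𝒜.subordinate i) g) s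
  refine ⟨∑ i, C i, fun f => (sobolevNorm_le_sum 𝒜 s _).trans ?_⟩
  push_cast
  rw [Finset.sum_mul]
  refine Finset.sum_le_sum fun i _ => ?_
  rw [← mul_assoc]
  exact hC i f

/-- Ehrling's inequality. It reduces the lower order term of the elliptic estimate to the `L²` norm.
-/
theorem exists_sobolevNorm_sq_le_add {s' s ε : ℝ} (hs : s' < s) (hε : 0 < ε) :
    ∃ K : ℝ≥0, ∀ f : SmoothFun M, sobolevNorm 𝒜 s' f ^ 2 ≤
      ENNReal.ofReal ε * sobolevNorm 𝒜 s f ^ 2 + K * sobolevNorm 𝒜 0 f ^ 2 := by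
  obtain ⟨K, hK⟩ := wsq_le_add (n := n) hs hε
  refine ⟨K, fun f => ?_⟩
  simp only [sobolevNorm_sq, Finset.mul_sum]
  rw [← Finset.sum_add_distrib]
  refine Finset.sum_le_sum fun i _ => ?_
  simp only [sobolevNormEuc_eq, wnorm_sq]
  exact hK _ (measurable_enorm_fourier
    (chartS (𝒜.smooth i) (tsupport_mul_left (𝒜.subordinate i) f)))

end ManifoldNorms

/-! ### Pseudodifferential operators on the manifold. -/

section PseudoDiffOnManifolds

variable {m n : ℕ} {M : Set (Euc m)} (𝒜 : SobolevAtlas n M)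

theorem chartPull_sub (κ : OpenPartialHomeomorph M (Euc n)) (f g : SmoothFun M) (y : Euc n) :
    chartPull κ (f - g) y = chartPull κ f y - chartPull κ g y := by
  by_cases hy : y ∈ κ.target <;> simp [chartPull, hy]

theorem sum_sum_mul_apply_mul {ι : Type*} [Fintype ι] {θ : ι → SmoothFun M} (hθ : ∑ i, θ i = 1)
    (A : SmoothFun M →ₗ[ℂ] SmoothFun M) (f : SmoothFun M) :
    ∑ i, ∑ j, θ i * A (θ j * f) = A f := by
  simp only [← Finset.mul_sum, ← map_sum, ← Finset.sum_mul, hθ, one_mul]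

variable [CompactSpace M]

/-- Operators of order `t` are bounded from `H^s` to `H^{s-t}`. -/
theorem IsPseudoDiff.exists_sobolevNorm_le (hn : 0 < n) {t : ℝ}
    {A : SmoothFun M →ₗ[ℂ] SmoothFun M} (hA : IsPseudoDiff n t A) (s : ℝ) :
    ∃ C : ℝ≥0, ∀ f : SmoothFun M, sobolevNorm 𝒜 (s - t) (A f) ≤ C * sobolevNorm 𝒜 s f := by
  obtain ⟨I, θ, hθ, hκ⟩ := 𝒜.exists_fine_partition hn
  have key : ∀ i j, ∃ C : ℝ≥0, ∀ f : SmoothFun M,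
      sobolevNorm 𝒜 (s - t) (θ i * A (θ j * f)) ≤ C * sobolevNorm 𝒜 s f := by
    intro i j
    obtain ⟨κ, hκ, hi, hj⟩ := hκ i j
    obtain ⟨a, ha, hloc⟩ := hA κ hκ _ _ hi hj
    obtain ⟨η, hη, hη1⟩ := exists_cutoff_mul (isClosed_tsupport (θ i : M → ℂ)) κ.open_source hi
    obtain ⟨C₁, hC₁⟩ := exists_sobolevNorm_le_chartPull 𝒜 hκ hi (s - t)
    obtain ⟨C₂, hC₂⟩ := ha.exists_sobolev_le (isCc_chartPull hκ hη) s
    obtain ⟨C₃, hC₃⟩ := exists_chartPull_le_sobolevNorm 𝒜 hκ hj s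
    refine ⟨C₁ * (C₂ * C₃), fun f => (hC₁ _).trans ?_⟩
    -- The left side already carries the factor `θ i`, on whose support `η = 1`; multiplying by `η`
    -- supplies the compactly supported cutoff of the Euclidean estimate.
    have h1 : chartPull κ (θ i * A (θ j * f)) =
        fun x => chartPull κ η x * symbolOp a (chartPull κ (θ j * f)) x := by
      ext x
      rw [← hloc, ← chartPull_mul, ← mul_assoc, hη1 _ le_rfl]
    have h2 := hC₂ (chartS hκ (tsupport_mul_left hj f))
    simp only [coe_chartS] at h2
    rw [h1]
    push_cast
    rw [mul_assoc, mul_assoc]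
    exact mul_le_mul_right (h2.trans (mul_le_mul_right (hC₃ f) _)) _
  choose C hC using key
  refine ⟨∑ i, ∑ j, C i j, fun f => ?_⟩
  rw [← sum_sum_mul_apply_mul hθ A f]
  push_cast
  simp only [Finset.sum_mul]
  exact (sobolevNorm_sum_le 𝒜 _ _ _).trans (Finset.sum_le_sum fun i _ =>
    (sobolevNorm_sum_le 𝒜 _ _ _).trans (Finset.sum_le_sum fun j _ => hC i j f))

/-- The commutator of an operator of order `t` with a multiplication has order `t - 1`. -/
theorem IsPseudoDiff.exists_sobolevNorm_commutator_le (hn : 0 < n) {t : ℝ}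
    {A : SmoothFun M →ₗ[ℂ] SmoothFun M} (hA : IsPseudoDiff n t A) (θ : SmoothFun M) (s : ℝ) :
    ∃ C : ℝ≥0, ∀ f : SmoothFun M,
      sobolevNorm 𝒜 (s - t) (A (θ * f) - θ * A f) ≤ C * sobolevNorm 𝒜 (s - 1) f := by
  obtain ⟨I, ρ, hρ, hκ⟩ := 𝒜.exists_fine_partition hn
  have key : ∀ i j, ∃ C : ℝ≥0, ∀ f : SmoothFun M,
      sobolevNorm 𝒜 (s - t) (ρ i * (A (ρ j * (θ * f)) - θ * A (ρ j * f))) ≤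
        C * sobolevNorm 𝒜 (s - 1) f := by
    intro i j
    obtain ⟨κ, hκ, hi, hj⟩ := hκ i j
    obtain ⟨a, ha, hloc⟩ := hA κ hκ _ _ hi hj
    -- With `η = 1` on the supports of both `ρ i` and `ρ j`, the multiplier `θ` can be replaced by
    -- `η * θ`, which is supported in the chart.
    obtain ⟨η, hη, hη1⟩ := exists_cutoff_mul
      ((isClosed_tsupport (ρ i : M → ℂ)).union (isClosed_tsupport (ρ j : M → ℂ))) κ.open_source
      (union_subset hi hj)
    obtain ⟨C₁, hC₁⟩ := exists_sobolevNorm_le_chartPull 𝒜 hκ hi (s - t)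
    obtain ⟨C₂, hC₂⟩ := ha.exists_sobolev_commutator_le (isCc_chartPull hκ hη)
      (isCc_chartPull hκ (tsupport_mul_left hη θ)) s
    obtain ⟨C₃, hC₃⟩ := exists_chartPull_le_sobolevNorm 𝒜 hκ hj (s - 1)
    refine ⟨C₁ * (C₂ * C₃), fun f => (hC₁ _).trans ?_⟩
    have h1 : chartPull κ (ρ i * (A (ρ j * (θ * f)) - θ * A (ρ j * f))) = fun x =>
        chartPull κ η x * symbolOp a (chartPull κ (ρ j * (θ * f))) x -
        chartPull κ η x * chartPull κ (η * θ) x * symbolOp a (chartPull κ (ρ j * f)) x := by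
      ext x
      have e1 : ρ i * (A (ρ j * (θ * f)) - θ * A (ρ j * f)) =
          η * (ρ i * A (ρ j * (θ * f))) - η * (η * θ) * (ρ i * A (ρ j * f)) := by
        have := hη1 (ρ i) subset_union_left
        linear_combination (-A (ρ j * (θ * f)) + (1 + η) * θ * A (ρ j * f)) * this
      rw [← hloc, ← hloc, ← chartPull_mul, ← chartPull_mul,
        ← chartPull_mul, ← chartPull_sub, e1]
    have h2 := hC₂ (chartS hκ (tsupport_mul_left hj f)) (chartS hκ (tsupport_mul_left hj (θ * f)))
      (fun x => by
        rw [coe_chartS, coe_chartS, ← chartPull_mul]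
        have := hη1 (ρ j) subset_union_right
        have e2 : ρ j * (θ * f) = η * θ * (ρ j * f) := by linear_combination (-θ * f) * this
        rw [e2])
    simp only [coe_chartS] at h2
    rw [h1]
    push_cast
    rw [mul_assoc, mul_assoc]
    exact mul_le_mul_right (h2.trans (mul_le_mul_right (hC₃ f) _)) _
  choose C hC using key
  refine ⟨∑ i, ∑ j, C i j, fun f => ?_⟩
  have e2 : A (θ * f) - θ * A f = ∑ i, ∑ j, ρ i * (A (ρ j * (θ * f)) - θ * A (ρ j * f)) := by
    conv_lhs => rw [← sum_sum_mul_apply_mul hρ A f, ← sum_sum_mul_apply_mul hρ A (θ * f)]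
    simp only [Finset.mul_sum, ← Finset.sum_sub_distrib]
    refine Finset.sum_congr rfl fun i _ => Finset.sum_congr rfl fun j _ => ?_
    ring
  rw [e2]
  push_cast
  simp only [Finset.sum_mul]
  exact (sobolevNorm_sum_le 𝒜 _ _ _).trans (Finset.sum_le_sum fun i _ =>
    (sobolevNorm_sum_le 𝒜 _ _ _).trans (Finset.sum_le_sum fun j _ => hC i j f))

/-- The elliptic estimate. -/
theorem IsEllipticOp.exists_sobolevNorm_le (hn : 0 < n) {t : ℝ}
    {A : SmoothFun M →ₗ[ℂ] SmoothFun M} (hA : IsPseudoDiff n t A) (hell : IsEllipticOp n t A)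
    (s : ℝ) : ∃ C : ℝ≥0, ∀ f : SmoothFun M, sobolevNorm 𝒜 (s + t) f ≤
      C * (sobolevNorm 𝒜 s (A f) + sobolevNorm 𝒜 (s + t - 1) f) := by
  have key : ∀ p : M, ∃ V : Set M, IsOpen V ∧ p ∈ V ∧ ∀ χ : SmoothFun M,
      tsupport (χ : M → ℂ) ⊆ V → ∃ C : ℝ≥0, ∀ f : SmoothFun M, sobolevNorm 𝒜 (s + t) (χ * f) ≤
      C * (sobolevNorm 𝒜 s (A f) + sobolevNorm 𝒜 (s + t - 1) f) := by
    intro p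
    obtain ⟨κ, hκ, hp⟩ := 𝒜.exists_chart p
    obtain ⟨η, hη, hη1⟩ := exists_cutoff (isClosed_singleton (x := p)) κ.open_source
      (singleton_subset_iff.2 hp)
    obtain ⟨a, ha, hloc⟩ := hA κ hκ _ _ hη hη
    have hηp := hη1 p rfl
    obtain ⟨c, hc, R, hR⟩ := hell κ hκ _ _ hη hη a ha hloc p hp
      (by rw [hηp.self_of_nhds]; exact one_ne_zero) (by rw [hηp.self_of_nhds]; exact one_ne_zero)
    obtain ⟨V, hV, hVo, hpV⟩ := eventually_nhds_iff.1
      (hηp.and ((κ.open_source.eventually_mem hp).and ((κ.continuousAt hp).eventually hR)))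
    refine ⟨V, hVo, hpV, fun χ hχ => ?_⟩
    have hχκ : tsupport (χ : M → ℂ) ⊆ κ.source := fun x hx => (hV x (hχ hx)).2.1
    have hηχ : η * χ = χ := by
      ext x
      change (η : M → ℂ) x * (χ : M → ℂ) x = (χ : M → ℂ) x
      by_cases hx : x ∈ tsupport (χ : M → ℂ)
      · rw [(hV x (hχ hx)).1, one_mul]
      · rw [image_eq_zero_of_notMem_tsupport hx, mul_zero]
    obtain ⟨C₁, hC₁⟩ := exists_sobolevNorm_le_chartPull 𝒜 hκ hχκ (s + t)
    obtain ⟨C₂, hC₂⟩ := ha.exists_elliptic_estimate (isCc_chartPull hκ hχκ) hc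
      (fun y hy ξ hξ => by
        have hyt : y ∈ κ.target := by
          by_contra h
          exact hy (indicator_of_notMem h _)
        rw [chartPull, indicator_of_mem hyt] at hy
        have h2 := (hV _ (hχ (subset_tsupport _ hy))).2.2 ξ hξ
        rwa [κ.right_inv hyt] at h2) s
    obtain ⟨C₃, hC₃⟩ := exists_chartPull_le_sobolevNorm 𝒜 hκ hη s
    obtain ⟨C₄, hC₄⟩ := exists_chartPull_le_sobolevNorm 𝒜 hκ hη (s + t - 1)
    -- The local estimate involves `A (η * f)`, which is `η * A f` plus a commutator of order `t -
    -- 1`; the latter only contributes the norm of order `s + t - 1`.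
    obtain ⟨C₅, hC₅⟩ := hA.exists_sobolevNorm_commutator_le 𝒜 hn η (s + t)
    obtain ⟨C₆, hC₆⟩ := exists_sobolevNorm_mul_le 𝒜 s η
    refine ⟨C₁ * (C₂ * (C₃ * (C₅ + C₆) + C₄)), fun f => (hC₁ _).trans ?_⟩
    have h1 : chartPull κ (χ * f) =
        fun x => chartPull κ χ x * chartPull κ (η * f) x := by
      ext x
      rw [← chartPull_mul, ← mul_assoc, mul_comm χ η, hηχ]
    have h2 := hC₂ (chartS hκ (tsupport_mul_left hη f))
      (chartS hκ (tsupport_mul_left hη (A (η * f))))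
      (fun x => congrFun (hloc f) x)
    simp only [coe_chartS] at h2
    have h3 : sobolevNorm 𝒜 s (A (η * f)) ≤
        (C₅ + C₆) * (sobolevNorm 𝒜 s (A f) + sobolevNorm 𝒜 (s + t - 1) f) := by
      have h4 := hC₅ f
      rw [add_sub_cancel_right] at h4
      calc sobolevNorm 𝒜 s (A (η * f))
          = sobolevNorm 𝒜 s ((A (η * f) - η * A f) + η * A f) := by rw [sub_add_cancel]
        _ ≤ C₅ * sobolevNorm 𝒜 (s + t - 1) f + C₆ * sobolevNorm 𝒜 s (A f) :=
            (sobolevNorm_add_le 𝒜 s _ _).trans (add_le_add h4 (hC₆ _))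
        _ ≤ C₅ * (sobolevNorm 𝒜 s (A f) + sobolevNorm 𝒜 (s + t - 1) f) +
            C₆ * (sobolevNorm 𝒜 s (A f) + sobolevNorm 𝒜 (s + t - 1) f) := by
            gcongr
            · exact le_add_self
            · exact le_self_add
        _ = _ := by rw [add_mul]
    rw [h1]
    push_cast
    rw [mul_assoc, mul_assoc]
    refine mul_le_mul_right (h2.trans (mul_le_mul_right ?_ _)) _
    rw [add_mul, mul_assoc]
    exact add_le_add ((hC₃ _).trans (mul_le_mul_right h3 _))
      ((hC₄ f).trans (mul_le_mul_right le_add_self _))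
  choose V hVo hpV hV using key
  obtain ⟨I, χ, hχ, hsum⟩ := exists_partition V hVo hpV
  choose C hC using fun i => hV _ _ (hχ i)
  refine ⟨∑ i, C i, fun f => ?_⟩
  have h1 : f = ∑ i, χ i * f := by rw [← Finset.sum_mul, hsum, one_mul]
  conv_lhs => rw [h1]
  push_cast
  rw [Finset.sum_mul]
  exact (sobolevNorm_sum_le 𝒜 _ _ _).trans (Finset.sum_le_sum fun i _ => hC i f)

end PseudoDiffOnManifolds

/-! ### The surface measure, and the comparison of `L²` with `H⁰`. -/

section SurfaceMeasure

theorem ENNReal.sq_sum_le_card_mul {ι : Type*} (I : Finset ι) (x : ι → ℝ≥0∞) :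
    (∑ i ∈ I, x i) ^ 2 ≤ I.card * ∑ i ∈ I, x i ^ 2 := by
  have h := ENNReal.inner_le_Lp_mul_Lq I (fun _ => 1) x (p := 2) (q := 2)
    (Real.HolderConjugate.two_two)
  simp only [one_mul, Finset.sum_const, nsmul_eq_mul, ENNReal.rpow_two, one_pow, mul_one] at h
  refine (pow_le_pow_left₀ zero_le h 2).trans_eq ?_
  rw [mul_pow, rpow_half_sq, rpow_half_sq]

variable {m n : ℕ} {M : Set (Euc m)} {κ : OpenPartialHomeomorph M (Euc n)}

theorem euclideanHausdorffMeasure_image_le {X Y : Type*} [MetricSpace X] [MeasurableSpace X]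
    [BorelSpace X] [MetricSpace Y] [MeasurableSpace Y] [BorelSpace Y] {f : X → Y} {s : Set X}
    {K : ℝ≥0} (hf : LipschitzOnWith K f s) (n : ℕ) :
    Measure.euclideanHausdorffMeasure n (f '' s) ≤
      (K : ℝ≥0∞) ^ n * Measure.euclideanHausdorffMeasure n s := by
  rw [Measure.euclideanHausdorffMeasure_def, Measure.euclideanHausdorffMeasure_def,
    Measure.smul_apply, Measure.smul_apply]
  simp only [ENNReal.smul_def, smul_eq_mul]
  have := hf.hausdorffMeasure_image_le (d := n) (by positivity)
  rw [ENNReal.rpow_natCast] at this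
  calc _ ≤ _ := mul_le_mul_right this _
    _ = _ := by ring

/-- Charts are locally bi-Lipschitz. -/
theorem IsSmoothChart.exists_lipschitzOnWith (hκ : IsSmoothChart κ) {p : M} (hp : p ∈ κ.source) :
    ∃ (W : Set M) (K : ℝ≥0), IsOpen W ∧ p ∈ W ∧ W ⊆ κ.source ∧ LipschitzOnWith K κ W ∧
      LipschitzOnWith K κ.symm (κ '' W) := by
  obtain ⟨U, hU, hpU, G, hG, hGκ⟩ := hκ.exists_extension hp
  obtain ⟨K₁, s, hs, h₁⟩ :=
    ((hG.contDiffAt (hU.mem_nhds hpU)).of_le (by simp)).exists_lipschitzOnWith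
  obtain ⟨K₂, t, ht, h₂⟩ :=
    ((hκ.1.contDiffAt (κ.open_target.mem_nhds (κ.map_source hp))).of_le (by simp)).exists_lipschitzOnWith
  have hev : ∀ᶠ x : M in 𝓝 p, ((x : Euc m) ∈ U ∧ (x : Euc m) ∈ s) ∧ κ x ∈ t :=
    ((continuous_subtype_val.continuousAt.eventually (hU.mem_nhds hpU)).and
      (continuous_subtype_val.continuousAt.eventually hs)).and ((κ.continuousAt hp).eventually ht)
  obtain ⟨W, hW, hWo, hpW⟩ := eventually_nhds_iff.1 hev
  have hWs : W ⊆ κ.source := fun x hx => (hGκ x (hW x hx).1.1).1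
  refine ⟨W, max K₁ K₂, hWo, hpW, hWs, fun x hx y hy => ?_, ?_⟩
  · rw [← (hGκ x (hW x hx).1.1).2, ← (hGκ y (hW y hy).1.1).2]
    exact (h₁ (hW x hx).1.2 (hW y hy).1.2).trans (by gcongr; exacts [le_max_left _ _, le_rfl])
  · rintro _ ⟨x, hx, rfl⟩ _ ⟨y, hy, rfl⟩
    exact (h₂ (hW x hx).2 (hW y hy).2).trans (by gcongr; exact le_max_right _ _)

/-- A map with Lipschitz constant `K` enlarges `n`-dimensional Hausdorff measure at most by `K ^ n`,
and on `ℝⁿ` the normalized Hausdorff measure is Lebesgue measure. Two-sided bounds of this kind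
replace the area formula. -/
theorem surfaceMeasure_restrict_le {W : Set M} {K : ℝ≥0} (hWo : IsOpen W) (hW : W ⊆ κ.source)
    (h : LipschitzOnWith K κ.symm (κ '' W)) : (surfaceMeasure n M).restrict W ≤
      ((K : ℝ≥0∞) ^ n) • ((volume : Measure (Euc n)).restrict (κ '' W)).map κ.symm := by
  have hoW : IsOpen (κ '' W) := κ.isOpen_image_of_subset_source hWo hW
  have hm : AEMeasurable κ.symm ((volume : Measure (Euc n)).restrict (κ '' W)) :=
    (κ.symm.continuousOn.mono ((image_mono hW).trans κ.mapsTo.image_subset)).aemeasurable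
      hoW.measurableSet
  refine Measure.le_iff.2 fun B hB => ?_
  rw [Measure.restrict_apply hB, Measure.smul_apply, Measure.map_apply_of_aemeasurable hm hB,
    Measure.restrict_apply' hoW.measurableSet, smul_eq_mul]
  have h1 : κ.symm ⁻¹' B ∩ κ '' W = κ '' (B ∩ W) := by
    ext y
    constructor
    · rintro ⟨hy, x, hx, rfl⟩
      rw [mem_preimage, κ.left_inv (hW hx)] at hy
      exact ⟨x, ⟨hy, hx⟩, rfl⟩
    · rintro ⟨x, hx, rfl⟩
      refine ⟨?_, x, hx.2, rfl⟩
      rw [mem_preimage, κ.left_inv (hW hx.2)]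
      exact hx.1
  have h2 : B ∩ W = κ.symm '' (κ '' (B ∩ W)) := by
    rw [image_image]
    exact ((image_congr fun x hx => κ.left_inv (hW hx.2)).trans (image_id _)).symm
  rw [h1]
  conv_lhs => rw [h2]
  rw [← EuclideanSpace.euclideanHausdorffMeasure_eq_volume]
  exact euclideanHausdorffMeasure_image_le (h.mono (image_mono inter_subset_right)) n

theorem volume_restrict_le {W : Set M} {K : ℝ≥0} (hWo : IsOpen W) (hW : W ⊆ κ.source)
    (h : LipschitzOnWith K κ W) : (volume : Measure (Euc n)).restrict (κ '' W) ≤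
      ((K : ℝ≥0∞) ^ n) • ((surfaceMeasure n M).restrict W).map κ := by
  have hm : AEMeasurable κ ((surfaceMeasure n M).restrict W) :=
    (κ.continuousOn.mono hW).aemeasurable hWo.measurableSet
  refine Measure.le_iff.2 fun B hB => ?_
  rw [Measure.restrict_apply hB, Measure.smul_apply, Measure.map_apply_of_aemeasurable hm hB,
    Measure.restrict_apply' hWo.measurableSet, smul_eq_mul]
  have h1 : B ∩ κ '' W = κ '' (κ ⁻¹' B ∩ W) := by
    rw [image_preimage_inter]
  rw [h1, ← EuclideanSpace.euclideanHausdorffMeasure_eq_volume]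
  exact euclideanHausdorffMeasure_image_le (h.mono inter_subset_right) n

/-- The square of the norm of `L²(M)`. -/
def l2sq (n : ℕ) (f : SmoothFun M) : ℝ≥0∞ := ∫⁻ x, ‖(f : M → ℂ) x‖ₑ ^ 2 ∂(surfaceMeasure n M)

theorem lintegral_eq_setLIntegral_of_support {X : Type*} [MeasurableSpace X] {ν : Measure X}
    {W : Set X} (hW : MeasurableSet W) {g : X → ℂ} (h : ∀ x, x ∉ W → g x = 0) :
    ∫⁻ x, ‖g x‖ₑ ^ 2 ∂ν = ∫⁻ x in W, ‖g x‖ₑ ^ 2 ∂ν := by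
  rw [← lintegral_indicator hW]
  refine lintegral_congr fun x => ?_
  by_cases hx : x ∈ W
  · rw [indicator_of_mem hx]
  · simp [indicator_of_notMem hx, h x hx]

theorem measurable_enorm_sq (f : SmoothFun M) : Measurable fun x => ‖(f : M → ℂ) x‖ₑ ^ 2 :=
  (SmoothFun.continuous f).measurable.enorm.pow_const 2

theorem chartPull_eq_zero_of_notMem_image {W : Set M} {f : SmoothFun M}
    (hf : tsupport (f : M → ℂ) ⊆ W) {y : Euc n} (hy : y ∉ κ '' W) : chartPull κ f y = 0 := by
  by_cases hyt : y ∈ κ.target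
  · rw [chartPull, indicator_of_mem hyt]
    by_contra h
    exact hy ⟨_, hf (subset_tsupport _ h), κ.right_inv hyt⟩
  · rw [chartPull, indicator_of_notMem hyt]

theorem chartPull_apply_of_mem {W : Set M} (hW : W ⊆ κ.source) {x : M} (hx : x ∈ W)
    (f : SmoothFun M) : chartPull κ f (κ x) = (f : M → ℂ) x := by
  rw [chartPull, indicator_of_mem (κ.map_source (hW hx)), κ.left_inv (hW hx)]

theorem l2sq_le_lintegral_chartPull {W : Set M} {K : ℝ≥0} (hWo : IsOpen W) (hW : W ⊆ κ.source)
    (h : LipschitzOnWith K κ.symm (κ '' W)) {f : SmoothFun M} (hf : tsupport (f : M → ℂ) ⊆ W) :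
    l2sq n f ≤ (K : ℝ≥0∞) ^ n * ∫⁻ y, ‖chartPull κ f y‖ₑ ^ 2 := by
  have hoW : IsOpen (κ '' W) := κ.isOpen_image_of_subset_source hWo hW
  have hm : AEMeasurable κ.symm ((volume : Measure (Euc n)).restrict (κ '' W)) :=
    (κ.symm.continuousOn.mono ((image_mono hW).trans κ.mapsTo.image_subset)).aemeasurable
      hoW.measurableSet
  rw [l2sq, lintegral_eq_setLIntegral_of_support hWo.measurableSet
    (fun x hx => image_eq_zero_of_notMem_tsupport fun h => hx (hf h)),
    lintegral_eq_setLIntegral_of_support hoW.measurableSet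
    (fun y hy => chartPull_eq_zero_of_notMem_image hf hy)]
  refine (lintegral_mono' (surfaceMeasure_restrict_le hWo hW h) le_rfl).trans_eq ?_
  rw [lintegral_smul_measure, smul_eq_mul,
    lintegral_map' (measurable_enorm_sq f).aemeasurable hm]
  congr 1
  refine setLIntegral_congr_fun hoW.measurableSet ?_
  rintro _ ⟨x, hx, rfl⟩
  simp only [chartPull_apply_of_mem hW hx, κ.left_inv (hW hx)]

theorem lintegral_chartPull_le_l2sq [CompactSpace M] (hκ : IsSmoothChart κ) {W : Set M} {K : ℝ≥0}
    (hWo : IsOpen W) (hW : W ⊆ κ.source) (h : LipschitzOnWith K κ W) {f : SmoothFun M}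
    (hf : tsupport (f : M → ℂ) ⊆ W) :
    ∫⁻ y, ‖chartPull κ f y‖ₑ ^ 2 ≤ (K : ℝ≥0∞) ^ n * l2sq n f := by
  have hoW : IsOpen (κ '' W) := κ.isOpen_image_of_subset_source hWo hW
  have hm : AEMeasurable κ ((surfaceMeasure n M).restrict W) :=
    (κ.continuousOn.mono hW).aemeasurable hWo.measurableSet
  rw [l2sq, lintegral_eq_setLIntegral_of_support hWo.measurableSet
    (fun x hx => image_eq_zero_of_notMem_tsupport fun h => hx (hf h)),
    lintegral_eq_setLIntegral_of_support hoW.measurableSet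
    (fun y hy => chartPull_eq_zero_of_notMem_image hf hy)]
  refine (lintegral_mono' (volume_restrict_le hWo hW h) le_rfl).trans_eq ?_
  have hms : Measurable fun y => ‖chartPull κ f y‖ₑ ^ 2 :=
    (isCc_chartPull hκ (hf.trans hW)).smooth.continuous.measurable.enorm.pow_const 2
  rw [lintegral_smul_measure, smul_eq_mul, lintegral_map' hms.aemeasurable hm]
  congr 1
  refine setLIntegral_congr_fun hWo.measurableSet fun x hx => ?_
  simp only [chartPull_apply_of_mem hW hx]

theorem l2sq_sum_le {ι : Type*} (n : ℕ) (I : Finset ι) (f : ι → SmoothFun M) :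
    l2sq n (∑ i ∈ I, f i) ≤ I.card * ∑ i ∈ I, l2sq n (f i) := by
  unfold l2sq
  rw [← lintegral_finsetSum _ fun i _ => measurable_enorm_sq (f i),
    ← lintegral_const_mul _ (Finset.measurable_fun_sum _ fun i _ => measurable_enorm_sq (f i))]
  refine lintegral_mono fun x => ?_
  have h1 : ((∑ i ∈ I, f i : SmoothFun M) : M → ℂ) x = ∑ i ∈ I, (f i : M → ℂ) x := by simp
  rw [h1]
  refine (pow_le_pow_left₀ zero_le (enorm_sum_le _ _) 2).trans ?_
  simpa using ENNReal.sq_sum_le_card_mul I fun i => ‖(f i : M → ℂ) x‖ₑ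

variable [CompactSpace M] (𝒜 : SobolevAtlas n M)

theorem exists_lipschitz_partition (𝒜 : SobolevAtlas n M) : ∃ (I : Finset M) (ρ : I → SmoothFun M), ∑ i, ρ i = 1 ∧
    ∀ i, ∃ (κ : OpenPartialHomeomorph M (Euc n)) (W : Set M) (K : ℝ≥0), IsSmoothChart κ ∧
      IsOpen W ∧ W ⊆ κ.source ∧ LipschitzOnWith K κ W ∧ LipschitzOnWith K κ.symm (κ '' W) ∧
      tsupport (ρ i : M → ℂ) ⊆ W := by
  choose κ hκ hp using 𝒜.exists_chart
  choose W K hWo hpW hW h₁ h₂ using fun p => (hκ p).exists_lipschitzOnWith (hp p)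
  obtain ⟨I, ρ, hρ, hsum⟩ := exists_partition W hWo hpW
  exact ⟨I, ρ, hsum, fun i => ⟨κ i, W i, K i, hκ i, hWo i, hW i, h₁ i, h₂ i, hρ i⟩⟩

theorem exists_l2sq_le : ∃ C : ℝ≥0, ∀ f : SmoothFun M, l2sq n f ≤ C * sobolevNorm 𝒜 0 f ^ 2 := by
  obtain ⟨I, ρ, hsum, hρ⟩ := exists_lipschitz_partition 𝒜
  have key : ∀ i, ∃ C : ℝ≥0, ∀ f : SmoothFun M, l2sq n (ρ i * f) ≤
      C * sobolevNorm 𝒜 0 f ^ 2 := by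
    intro i
    obtain ⟨κ, W, K, hκ, hWo, hW, h₁, h₂, hi⟩ := hρ i
    obtain ⟨C, hC⟩ := exists_chartPull_le_sobolevNorm 𝒜 hκ (hi.trans hW) 0
    refine ⟨K ^ n * C ^ 2, fun f => ?_⟩
    refine (l2sq_le_lintegral_chartPull hWo hW h₂ (tsupport_mul_left hi f)).trans ?_
    have h3 := sobolevNormEuc_zero_sq (chartS hκ (tsupport_mul_left (hi.trans hW) f))
    rw [coe_chartS] at h3
    rw [← h3]
    push_cast
    rw [mul_assoc, ← mul_pow]
    exact mul_le_mul_right (pow_le_pow_left₀ zero_le (hC f) 2) _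
  choose C hC using key
  refine ⟨I.card * ∑ i, C i, fun f => ?_⟩
  have h1 : f = ∑ i, ρ i * f := by rw [← Finset.sum_mul, hsum, one_mul]
  conv_lhs => rw [h1]
  refine (l2sq_sum_le n _ _).trans ?_
  push_cast
  rw [mul_assoc, Finset.sum_mul, Finset.card_univ, Fintype.card_coe]
  exact mul_le_mul_right (Finset.sum_le_sum fun i _ => hC i f) _

/-- The total mass is the squared `L²` norm of the constant `1`, which has a finite norm in `H⁰`. -/
theorem isFiniteMeasure_surfaceMeasure (𝒜 : SobolevAtlas n M) :
    IsFiniteMeasure (surfaceMeasure n M) := by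
  obtain ⟨C, hC⟩ := exists_l2sq_le 𝒜
  have h := (hC 1).trans_lt (ENNReal.mul_lt_top ENNReal.coe_lt_top
    (ENNReal.pow_lt_top (sobolevNorm_lt_top 𝒜 0 1)))
  refine ⟨?_⟩
  simpa [l2sq] using h

theorem exists_sobolevNorm_zero_le : ∃ C : ℝ≥0, ∀ f : SmoothFun M,
    sobolevNorm 𝒜 0 f ^ 2 ≤ C * l2sq n f := by
  obtain ⟨I, ρ, hsum, hρ⟩ := exists_lipschitz_partition 𝒜
  have key : ∀ i, ∃ C : ℝ≥0, ∀ f : SmoothFun M, sobolevNorm 𝒜 0 (ρ i * f) ^ 2 ≤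
      C * l2sq n f := by
    intro i
    obtain ⟨κ, W, K, hκ, hWo, hW, h₁, h₂, hi⟩ := hρ i
    obtain ⟨C, hC⟩ := exists_sobolevNorm_le_chartPull 𝒜 hκ (hi.trans hW) 0
    obtain ⟨B, hB⟩ := isCompact_univ.exists_bound_of_continuousOn
      (SmoothFun.continuous (ρ i)).continuousOn
    refine ⟨C ^ 2 * (K ^ n * B.toNNReal ^ 2), fun f => ?_⟩
    refine (pow_le_pow_left₀ zero_le (hC f) 2).trans ?_
    have h3 := sobolevNormEuc_zero_sq (chartS hκ (tsupport_mul_left (hi.trans hW) f))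
    rw [coe_chartS] at h3
    rw [mul_pow, h3]
    push_cast
    rw [mul_assoc, mul_assoc]
    refine mul_le_mul_right ((lintegral_chartPull_le_l2sq hκ hWo hW h₁
      (tsupport_mul_left hi f)).trans (mul_le_mul_right ?_ _)) _
    unfold l2sq
    rw [← lintegral_const_mul _ (measurable_enorm_sq f)]
    refine lintegral_mono fun x => ?_
    have h4 : ‖(ρ i : M → ℂ) x‖ₑ ≤ B.toNNReal := enorm_le_ofReal (hB x (mem_univ x))
    calc ‖((ρ i * f : SmoothFun M) : M → ℂ) x‖ₑ ^ 2
        = ‖(ρ i : M → ℂ) x‖ₑ ^ 2 * ‖(f : M → ℂ) x‖ₑ ^ 2 := by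
          rw [← mul_pow, ← enorm_mul]; rfl
      _ ≤ _ := mul_le_mul_left (pow_le_pow_left₀ zero_le h4 2) _
  choose C hC using key
  refine ⟨Fintype.card I * ∑ i, C i, fun f => ?_⟩
  have h1 : f = ∑ i, ρ i * f := by rw [← Finset.sum_mul, hsum, one_mul]
  conv_lhs => rw [h1]
  refine (pow_le_pow_left₀ zero_le (sobolevNorm_sum_le 𝒜 0 _ _) 2).trans ?_
  refine (ENNReal.sq_sum_le_card_mul _ _).trans ?_
  push_cast
  rw [mul_assoc, Finset.sum_mul, Finset.card_univ]
  exact mul_le_mul_right (Finset.sum_le_sum fun i _ => hC i f) _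

end SurfaceMeasure

/-! ### Spectral norms and spectral projections. -/

section Spectral

variable {m n : ℕ} {M : Set (Euc m)} {D : SmoothFun M →ₗ[ℂ] SmoothFun M} {e : ℕ → SmoothFun M}
  {ev : ℕ → ℝ}

/-- The square of the norm of order `r` defined by means of the eigenvalues. -/
def specSq (n : ℕ) (e : ℕ → SmoothFun M) (ev : ℕ → ℝ) (r : ℝ) (f : SmoothFun M) : ℝ≥0∞ :=
  ∑' k, ENNReal.ofReal ((1 + |ev k|) ^ r) * ‖innerL2 n f (e k)‖ₑ ^ 2

theorem specSq_mono_of_le {r : ℝ} {f g : SmoothFun M}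
    (h : ∀ k, ‖innerL2 n f (e k)‖ₑ ≤ ‖innerL2 n g (e k)‖ₑ) :
    specSq n e ev r f ≤ specSq n e ev r g :=
  ENNReal.tsum_le_tsum fun k => mul_le_mul_right (pow_le_pow_left₀ zero_le (h k) 2) _

theorem innerL2_self (f : SmoothFun M) : innerL2 n f f = ((l2sq n f).toReal : ℂ) := by
  have h1 : ∀ x, (f : M → ℂ) x * conj ((f : M → ℂ) x) = ((‖(f : M → ℂ) x‖ ^ 2 : ℝ) : ℂ) := fun x => by
    rw [Complex.mul_conj, Complex.normSq_eq_norm_sq]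
  rw [innerL2]
  simp only [h1]
  rw [integral_complex_ofReal, integral_eq_lintegral_of_nonneg_ae
    (Eventually.of_forall fun x => by positivity)
    (show Continuous fun x => ‖(f : M → ℂ) x‖ ^ 2 from
      (SmoothFun.continuous f).norm.pow 2).aestronglyMeasurable]
  simp only [ENNReal.ofReal_pow (norm_nonneg _), ofReal_norm]
  rfl

variable [CompactSpace M] [IsFiniteMeasure (surfaceMeasure n M)]

theorem memLp_smoothFun (f : SmoothFun M) : MemLp (f : M → ℂ) 2 (surfaceMeasure n M) := by
  obtain ⟨B, hB⟩ := isCompact_univ.exists_bound_of_continuousOn (SmoothFun.continuous f).continuousOn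
  exact MemLp.of_bound (SmoothFun.continuous f).aestronglyMeasurable B
    (Eventually.of_forall fun x => hB x (mem_univ x))

/-- A smooth function as an element of `L²(M)`. -/
def toL2 (n : ℕ) [IsFiniteMeasure (surfaceMeasure n M)] (f : SmoothFun M) :
    Lp ℂ 2 (surfaceMeasure n M) := (memLp_smoothFun f).toLp

theorem coeFn_toL2 (f : SmoothFun M) : (toL2 n f : M → ℂ) =ᵐ[surfaceMeasure n M] (f : M → ℂ) :=
  MemLp.coeFn_toLp _

theorem innerL2_eq_inner (f g : SmoothFun M) : innerL2 n f g = inner ℂ (toL2 n g) (toL2 n f) := by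
  rw [L2.inner_def, innerL2]
  refine integral_congr_ae ?_
  filter_upwards [coeFn_toL2 f, coeFn_toL2 g] with x hf hg
  rw [hf, hg, RCLike.inner_apply]

theorem toL2_add (f g : SmoothFun M) : toL2 n (f + g) = toL2 n f + toL2 n g := rfl

theorem toL2_smul (c : ℂ) (f : SmoothFun M) : toL2 n (c • f) = c • toL2 n f := rfl

theorem innerL2_add_left (f g h : SmoothFun M) :
    innerL2 n (f + g) h = innerL2 n f h + innerL2 n g h := by
  simp only [innerL2_eq_inner, toL2_add, inner_add_right]

theorem innerL2_smul_left (c : ℂ) (f h : SmoothFun M) :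
    innerL2 n (c • f) h = c * innerL2 n f h := by
  simp only [innerL2_eq_inner, toL2_smul, inner_smul_right]

theorem innerL2_sub_left (f g h : SmoothFun M) :
    innerL2 n (f - g) h = innerL2 n f h - innerL2 n g h := by
  rw [sub_eq_add_neg, innerL2_add_left, ← neg_one_smul ℂ g, innerL2_smul_left]
  ring

theorem innerL2_sum_left {ι : Type*} (I : Finset ι) (f : ι → SmoothFun M) (h : SmoothFun M) :
    innerL2 n (∑ i ∈ I, f i) h = ∑ i ∈ I, innerL2 n (f i) h := by
  classical
  induction I using Finset.induction_on with
  | empty => simpa using innerL2_smul_left (n := n) 0 (0 : SmoothFun M) h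
  | insert i I hi ih => rw [Finset.sum_insert hi, Finset.sum_insert hi, innerL2_add_left, ih]

theorem innerL2_smul_right (c : ℂ) (f h : SmoothFun M) :
    innerL2 n f (c • h) = conj c * innerL2 n f h := by
  simp only [innerL2_eq_inner, toL2_smul, inner_smul_left]

theorem l2sq_ne_top (f : SmoothFun M) : l2sq n f ≠ ⊤ := by
  have h := (memLp_two_iff_integrable_sq_norm
    (SmoothFun.continuous f).aestronglyMeasurable).1 (memLp_smoothFun (n := n) f)
  have h2 := h.2
  rw [HasFiniteIntegral] at h2
  refine ne_of_lt (lt_of_eq_of_lt ?_ h2)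
  refine lintegral_congr fun x => ?_
  rw [enorm_pow, enorm_norm]

theorem IsEigenbasis.innerL2_eq (he : IsEigenbasis n D e ev) (j k : ℕ) :
    innerL2 n (e j) (e k) = if j = k then 1 else 0 := by
  obtain ⟨b, hb⟩ := he.basis
  have h : ∀ k, toL2 n (e k) = b k := fun k =>
    Lp.ext ((coeFn_toL2 (e k)).trans (hb k).symm)
  rw [innerL2_eq_inner, h, h, orthonormal_iff_ite.1 b.orthonormal]
  simp only [eq_comm]

/-- Parseval's identity. -/
theorem IsEigenbasis.tsum_eq (he : IsEigenbasis n D e ev) (f : SmoothFun M) :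
    ∑' k, ‖innerL2 n f (e k)‖ₑ ^ 2 = l2sq n f := by
  obtain ⟨b, hb⟩ := he.basis
  have h : ∀ k, toL2 n (e k) = b k := fun k =>
    Lp.ext ((coeFn_toL2 (e k)).trans (hb k).symm)
  have h1 := b.hasSum_inner_mul_inner (toL2 n f) (toL2 n f)
  rw [← innerL2_eq_inner, innerL2_self] at h1
  have h2 : ∀ k, inner ℂ (toL2 n f) (b k) * inner ℂ (b k) (toL2 n f) =
      ((‖innerL2 n f (e k)‖ ^ 2 : ℝ) : ℂ) := fun k => by
    have h3 : inner ℂ (b k) (toL2 n f) = innerL2 n f (e k) := by rw [← h, innerL2_eq_inner]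
    rw [← inner_conj_symm (toL2 n f), h3, mul_comm, Complex.mul_conj, Complex.normSq_eq_norm_sq]
  simp only [h2] at h1
  have h3 := Complex.hasSum_ofReal.1 h1
  rw [← ENNReal.ofReal_toReal (l2sq_ne_top (n := n) f), ← h3.tsum_eq,
    ENNReal.ofReal_tsum_of_nonneg (fun k => by positivity) h3.summable]
  simp only [ENNReal.ofReal_pow (norm_nonneg _), ofReal_norm]

theorem IsEigenbasis.innerL2_apply (he : IsEigenbasis n D e ev) (hD : IsSelfAdjointOp n D)
    (f : SmoothFun M) (k : ℕ) : innerL2 n (D f) (e k) = ev k * innerL2 n f (e k) := by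
  rw [hD, he.eigen, innerL2_smul_right, Complex.conj_ofReal]

theorem IsEigenbasis.innerL2_pow_apply (he : IsEigenbasis n D e ev) (hD : IsSelfAdjointOp n D)
    (j : ℕ) (f : SmoothFun M) (k : ℕ) :
    innerL2 n ((D ^ j) f) (e k) = (ev k : ℂ) ^ j * innerL2 n f (e k) := by
  induction j with
  | zero => simp
  | succ j ih => rw [pow_succ', Module.End.mul_apply, he.innerL2_apply hD, ih]; ring

/-- The orthogonal projection to the span of `e 0, …, e N`. -/
def specProj (n : ℕ) (e : ℕ → SmoothFun M) (N : ℕ) (f : SmoothFun M) : SmoothFun M :=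
  ∑ k ∈ Finset.range (N + 1), innerL2 n f (e k) • e k

/-- Reduces the truncation error to the projection `P`, through `τ - PτP = (1 - P)τ + Pτ(1 - P)`. -/
theorem truncation_eq (N : ℕ) (τ : SmoothFun M →ₗ[ℂ] SmoothFun M) (f : SmoothFun M) :
    truncation n e N τ f = specProj n e N (τ (specProj n e N f)) := by
  unfold truncation specProj
  refine Finset.sum_congr rfl fun j _ => ?_
  rw [map_sum, innerL2_sum_left, Finset.sum_smul]
  refine Finset.sum_congr rfl fun k _ => ?_
  rw [map_smul, innerL2_smul_left, mul_comm]

theorem IsEigenbasis.innerL2_sum (he : IsEigenbasis n D e ev) (I : Finset ℕ) (c : ℕ → ℂ) (k : ℕ) :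
    innerL2 n (∑ j ∈ I, c j • e j) (e k) = if k ∈ I then c k else 0 := by
  rw [innerL2_sum_left]
  simp only [innerL2_smul_left, he.innerL2_eq, mul_ite, mul_one, mul_zero, Finset.sum_ite_eq']

theorem IsEigenbasis.innerL2_specProj (he : IsEigenbasis n D e ev) (N : ℕ) (f : SmoothFun M)
    (k : ℕ) : innerL2 n (specProj n e N f) (e k) = if k ≤ N then innerL2 n f (e k) else 0 := by
  rw [specProj, he.innerL2_sum]
  simp only [Finset.mem_range, Nat.lt_succ_iff]

theorem IsEigenbasis.innerL2_sub_specProj (he : IsEigenbasis n D e ev) (N : ℕ) (f : SmoothFun M)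
    (k : ℕ) :
    innerL2 n (f - specProj n e N f) (e k) = if k ≤ N then 0 else innerL2 n f (e k) := by
  rw [innerL2_sub_left, he.innerL2_specProj]
  split_ifs <;> simp

theorem one_add_abs_pos (x : ℝ) : 0 < 1 + |x| := by positivity

theorem IsEigenbasis.specSq_zero (he : IsEigenbasis n D e ev) (f : SmoothFun M) :
    specSq n e ev 0 f = l2sq n f := by
  simp [specSq, he.tsum_eq]

theorem IsEigenbasis.l2sq_pow_apply_le (he : IsEigenbasis n D e ev) (hD : IsSelfAdjointOp n D)
    {j k : ℕ} (hjk : j ≤ k) (f : SmoothFun M) :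
    l2sq n ((D ^ j) f) ≤ specSq n e ev (2 * k) f := by
  rw [← he.tsum_eq, specSq]
  refine ENNReal.tsum_le_tsum fun l => ?_
  rw [he.innerL2_pow_apply hD, enorm_mul, mul_pow]
  refine mul_le_mul_left ?_ _
  rw [← ofReal_norm, ← ENNReal.ofReal_pow (norm_nonneg _)]
  refine ENNReal.ofReal_le_ofReal ?_
  rw [norm_pow, Complex.norm_real, Real.norm_eq_abs, ← pow_mul]
  have h1 : (1 + |ev l|) ^ (2 * (k : ℝ)) = (1 + |ev l|) ^ (2 * k) := by
    rw [← Real.rpow_natCast]; push_cast; rfl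
  rw [h1]
  calc |ev l| ^ (j * 2) ≤ (1 + |ev l|) ^ (j * 2) := by gcongr; linarith
    _ ≤ (1 + |ev l|) ^ (2 * k) := pow_le_pow_right₀ (by linarith [abs_nonneg (ev l)]) (by lia)

theorem IsEigenbasis.specSq_le (he : IsEigenbasis n D e ev) (hD : IsSelfAdjointOp n D) (k : ℕ)
    (f : SmoothFun M) :
    specSq n e ev (2 * k) f ≤ (4 ^ k : ℝ≥0) * (l2sq n f + l2sq n ((D ^ k) f)) := by
  rw [← he.tsum_eq, ← he.tsum_eq, ← ENNReal.tsum_add, ← ENNReal.tsum_mul_left, specSq]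
  refine ENNReal.tsum_le_tsum fun l => ?_
  rw [he.innerL2_pow_apply hD, enorm_mul, mul_pow]
  have h1 : (1 + |ev l|) ^ (2 * (k : ℝ)) = (1 + |ev l|) ^ (2 * k) := by
    rw [← Real.rpow_natCast]; push_cast; rfl
  have h2 : ‖(ev l : ℂ) ^ k‖ₑ ^ 2 = ENNReal.ofReal (|ev l| ^ (2 * k)) := by
    rw [← ofReal_norm, ← ENNReal.ofReal_pow (norm_nonneg _), norm_pow, Complex.norm_real,
      Real.norm_eq_abs, ← pow_mul, mul_comm]
  have h4 : ((4 ^ k : ℝ≥0) : ℝ≥0∞) = ENNReal.ofReal (4 ^ k) := by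
    rw [ENNReal.ofReal_pow (by norm_num)]; norm_num
  rw [h1, h2, ← one_add_mul, ← mul_assoc, h4, ← ENNReal.ofReal_one,
    ← ENNReal.ofReal_add zero_le_one (by positivity), ← ENNReal.ofReal_mul (by positivity)]
  refine mul_le_mul_left (ENNReal.ofReal_le_ofReal ?_) _
  have h3 : (1 + |ev l|) ≤ 2 * max 1 |ev l| := by
    linarith [le_max_left 1 |ev l|, le_max_right 1 |ev l|]
  calc (1 + |ev l|) ^ (2 * k) ≤ (2 * max 1 |ev l|) ^ (2 * k) := by gcongr
    _ = 4 ^ k * max 1 |ev l| ^ (2 * k) := by rw [mul_pow, pow_mul]; norm_num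
    _ ≤ 4 ^ k * (1 + |ev l| ^ (2 * k)) := by
        gcongr
        rcases max_cases 1 |ev l| with h | h
        · rw [h.1, one_pow]; have : 0 ≤ |ev l| ^ (2 * k) := by positivity
          linarith
        · rw [h.1]; linarith

theorem IsEigenbasis.specSq_specProj_le (he : IsEigenbasis n D e ev) (r : ℝ) (N : ℕ)
    (f : SmoothFun M) : specSq n e ev r (specProj n e N f) ≤ specSq n e ev r f := by
  refine specSq_mono_of_le fun k => ?_
  rw [he.innerL2_specProj]
  split_ifs <;> simp

/-- Only the indices `k > N` survive, and for them `|ev N| ≤ |ev k|`: this is where the ordering by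
absolute value enters. -/
theorem IsEigenbasis.specSq_sub_specProj_le (he : IsEigenbasis n D e ev) (r : ℝ) {ρ : ℝ}
    (hρ : 0 ≤ ρ) (N : ℕ) (f : SmoothFun M) : specSq n e ev r (f - specProj n e N f) ≤
      ENNReal.ofReal ((1 + |ev N|) ^ (-ρ)) * specSq n e ev (r + ρ) f := by
  rw [specSq, specSq, ← ENNReal.tsum_mul_left]
  refine ENNReal.tsum_le_tsum fun k => ?_
  rw [he.innerL2_sub_specProj]
  split_ifs with h
  · simp
  · rw [← mul_assoc, ← ENNReal.ofReal_mul (by positivity)]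
    refine mul_le_mul_left (ENNReal.ofReal_le_ofReal ?_) _
    have h1 : |ev N| ≤ |ev k| := he.mono (not_le.1 h).le
    have h2 : (1 + |ev k|) ^ (-ρ) ≤ (1 + |ev N|) ^ (-ρ) :=
      Real.rpow_le_rpow_of_nonpos (one_add_abs_pos _) (by linarith) (by linarith)
    calc (1 + |ev k|) ^ r = (1 + |ev k|) ^ (-ρ) * (1 + |ev k|) ^ (r + ρ) := by
          rw [← Real.rpow_add (one_add_abs_pos _)]; ring_nf
      _ ≤ _ := by
          have := one_add_abs_pos (ev k)
          gcongr

/-- Tails of a convergent series. Combined with the comparison of norms at the order `kμ`, this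
approximates smooth functions by finite sums of eigenfunctions in `H^{kμ}`. -/
theorem IsEigenbasis.tendsto_specSq_sub_specProj (he : IsEigenbasis n D e ev) {r : ℝ}
    {f : SmoothFun M} (hf : specSq n e ev r f ≠ ⊤) :
    Tendsto (fun N => specSq n e ev r (f - specProj n e N f)) atTop (𝓝 0) := by
  have h := ENNReal.tendsto_sum_nat_add (fun k =>
    ENNReal.ofReal ((1 + |ev k|) ^ r) * ‖innerL2 n f (e k)‖ₑ ^ 2) hf
  have h2 := h.comp (tendsto_add_atTop_nat 1)
  refine tendsto_of_tendsto_of_tendsto_of_le_of_le tendsto_const_nhds h2 (fun _ => zero_le)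
    fun N => ?_
  rw [specSq, ← ENNReal.summable.sum_add_tsum_nat_add' (k := N + 1)]
  rw [Finset.sum_eq_zero fun k hk => by
    rw [he.innerL2_sub_specProj, if_pos (Nat.lt_succ_iff.1 (Finset.mem_range.1 hk))]; simp, zero_add]
  refine ENNReal.tsum_le_tsum fun k => ?_
  rw [he.innerL2_sub_specProj]
  split_ifs
  · simp
  · rfl

end Spectral

/-! ### Comparison of norms at integer multiples of the order of `D`. -/

section SpectralSobolev

theorem ENNReal.add_sq_le (a b : ℝ≥0∞) : (a + b) ^ 2 ≤ 2 * (a ^ 2 + b ^ 2) := by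
  have := ENNReal.sq_sum_le_card_mul Finset.univ ![a, b]
  simpa [Fin.sum_univ_two] using this

/-- Absorption of a small multiple of a finite quantity. -/
theorem ENNReal.le_two_mul_of_le_add_half {x y : ℝ≥0∞} (hx : x ≠ ⊤) (h : x ≤ y + x / 2) :
    x ≤ 2 * y := by
  have h1 : x / 2 ≠ ⊤ := (ENNReal.div_lt_top hx two_ne_zero).ne
  have h2 : x / 2 ≤ y := by
    refine ENNReal.le_of_add_le_add_right h1 ?_
    rwa [ENNReal.add_halves]
  calc x = 2 * (x / 2) := (ENNReal.mul_div_cancel two_ne_zero ENNReal.ofNat_ne_top).symm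
    _ ≤ 2 * y := mul_le_mul_right h2 _

variable {m n : ℕ} {M : Set (Euc m)} (𝒜 : SobolevAtlas n M) {μ : ℝ}

theorem exists_sobolevNorm_pow_le {B : SmoothFun M →ₗ[ℂ] SmoothFun M}
    (hB : ∀ s, ∃ C : ℝ≥0, ∀ f, sobolevNorm 𝒜 (s - μ) (B f) ≤ C * sobolevNorm 𝒜 s f) (k : ℕ) :
    ∀ s, ∃ C : ℝ≥0, ∀ f, sobolevNorm 𝒜 (s - k * μ) ((B ^ k) f) ≤ C * sobolevNorm 𝒜 s f := by
  induction k with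
  | zero => exact fun s => ⟨1, fun f => by simp⟩
  | succ k ih =>
    intro s
    obtain ⟨C, hC⟩ := ih s
    obtain ⟨C', hC'⟩ := hB (s - k * μ)
    refine ⟨C' * C, fun f => ?_⟩
    have h1 : s - (k + 1 : ℕ) * μ = s - k * μ - μ := by push_cast; ring
    rw [h1, pow_succ', Module.End.mul_apply]
    push_cast
    rw [mul_assoc]
    exact (hC' _).trans (mul_le_mul_right (hC f) _)

variable {D : SmoothFun M →ₗ[ℂ] SmoothFun M}

/-- The shift by `i` makes the operator injective: the `ev l` are real, so `ev l + i ≠ 0`, and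
powers can be inverted on the span of the eigenfunctions. -/
theorem pow_shift_apply {e : ℕ → SmoothFun M} {ev : ℕ → ℝ} (he : ∀ k, D (e k) = (ev k : ℂ) • e k)
    (k l : ℕ) : ((D + Complex.I • LinearMap.id : SmoothFun M →ₗ[ℂ] SmoothFun M) ^ k) (e l) = ((ev l : ℂ) + Complex.I) ^ k • e l := by
  induction k with
  | zero => simp
  | succ k ih =>
    rw [pow_succ', Module.End.mul_apply, ih, map_smul, LinearMap.add_apply, he,
      LinearMap.smul_apply, LinearMap.id_apply, ← add_smul, smul_smul, pow_succ]

variable [CompactSpace M]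

/-- Ehrling's inequality turns the lower order term into an `L²` norm plus a small multiple of the
left side. The latter is absorbed, being finite for smooth `f`. -/
theorem IsEllipticOp.exists_sobolevNorm_sq_le (hn : 0 < n) (hD : IsPseudoDiff n μ D)
    (hell : IsEllipticOp n μ D) (s : ℝ) : ∃ C : ℝ≥0, ∀ f, sobolevNorm 𝒜 (s + μ) f ^ 2 ≤
      C * (sobolevNorm 𝒜 s (D f) ^ 2 + sobolevNorm 𝒜 0 f ^ 2) := by
  obtain ⟨C, hC⟩ := hell.exists_sobolevNorm_le 𝒜 hn hD s
  -- Makes `C ^ 2 * 2 * ε ≤ 1 / 2`, so that half of the left side absorbs the term.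
  set ε : ℝ := 1 / (4 * (C ^ 2 + 1)) with hε
  have hε0 : 0 < ε := by positivity
  obtain ⟨K, hK⟩ := exists_sobolevNorm_sq_le_add 𝒜 (show s + μ - 1 < s + μ by linarith) hε0
  refine ⟨2 * (C ^ 2 * 2 * (1 + K)), fun f => ?_⟩
  have h1 : sobolevNorm 𝒜 (s + μ) f ^ 2 ≤
      C ^ 2 * 2 * (sobolevNorm 𝒜 s (D f) ^ 2 + K * sobolevNorm 𝒜 0 f ^ 2) +
        sobolevNorm 𝒜 (s + μ) f ^ 2 / 2 := by
    calc sobolevNorm 𝒜 (s + μ) f ^ 2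
        ≤ (C * (sobolevNorm 𝒜 s (D f) + sobolevNorm 𝒜 (s + μ - 1) f)) ^ 2 :=
          pow_le_pow_left₀ zero_le (hC f) 2
      _ ≤ C ^ 2 * (2 * (sobolevNorm 𝒜 s (D f) ^ 2 + (ENNReal.ofReal ε * sobolevNorm 𝒜 (s + μ) f ^ 2 +
            K * sobolevNorm 𝒜 0 f ^ 2))) := by
          rw [mul_pow]
          refine mul_le_mul_right ((ENNReal.add_sq_le _ _).trans ?_) _
          gcongr
          exact hK f
      _ = C ^ 2 * 2 * (sobolevNorm 𝒜 s (D f) ^ 2 + K * sobolevNorm 𝒜 0 f ^ 2) +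
            (C ^ 2 * 2 * ENNReal.ofReal ε) * sobolevNorm 𝒜 (s + μ) f ^ 2 := by ring
      _ ≤ _ := by
          refine add_le_add le_rfl ?_
          rw [div_eq_mul_inv, mul_comm (_ ^ 2) (2⁻¹ : ℝ≥0∞)]
          refine mul_le_mul_left ?_ _
          have e1 : (C : ℝ≥0∞) ^ 2 * 2 = ENNReal.ofReal (C ^ 2 * 2) := by
            rw [ENNReal.ofReal_mul (by positivity), ENNReal.ofReal_pow (by positivity)]
            simp
          have e2 : (2⁻¹ : ℝ≥0∞) = ENNReal.ofReal 2⁻¹ := by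
            rw [ENNReal.ofReal_inv_of_pos two_pos]; simp
          rw [e1, ← ENNReal.ofReal_mul (by positivity), e2]
          refine ENNReal.ofReal_le_ofReal ?_
          rw [hε, mul_one_div, div_le_iff₀ (by positivity)]
          linarith
  have h2 := ENNReal.le_two_mul_of_le_add_half
    (ENNReal.pow_lt_top (sobolevNorm_lt_top 𝒜 (s + μ) f)).ne h1
  refine h2.trans ?_
  push_cast
  rw [mul_assoc 2]
  refine mul_le_mul_right ?_ _
  rw [mul_assoc _ (1 + (K : ℝ≥0∞))]
  refine mul_le_mul_right ?_ _
  rw [mul_add]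
  refine add_le_add (le_mul_of_one_le_left zero_le le_self_add) ?_
  exact mul_le_mul_left le_add_self _

/-- Induction on `k`: the elliptic estimate leads from `f` at the order `(k + 1)μ` to `D f` at the
order `kμ`. -/
theorem IsEllipticOp.exists_sobolevNorm_sq_le_sum (hn : 0 < n) (hD : IsPseudoDiff n μ D)
    (hell : IsEllipticOp n μ D) (k : ℕ) : ∃ C : ℝ≥0, ∀ f, sobolevNorm 𝒜 (k * μ) f ^ 2 ≤
      C * ∑ j ∈ Finset.range (k + 1), l2sq n ((D ^ j) f) := by
  obtain ⟨C₀, hC₀⟩ := exists_sobolevNorm_zero_le 𝒜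
  induction k with
  | zero => exact ⟨C₀, fun f => by simpa using hC₀ f⟩
  | succ k ih =>
    obtain ⟨C, hC⟩ := ih
    obtain ⟨C', hC'⟩ := hell.exists_sobolevNorm_sq_le 𝒜 hn hD (k * μ)
    refine ⟨C' * (C + C₀), fun f => ?_⟩
    have h1 : ((k + 1 : ℕ) : ℝ) * μ = k * μ + μ := by push_cast; ring
    rw [h1, Finset.sum_range_succ']
    refine (hC' f).trans ?_
    push_cast
    rw [mul_assoc]
    refine mul_le_mul_right ?_ _
    have h2 := hC (D f)
    simp only [← Module.End.mul_apply, ← pow_succ] at h2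
    rw [add_mul]
    refine add_le_add (h2.trans (mul_le_mul_right le_self_add _))
      ((hC₀ f).trans (mul_le_mul_right ?_ _))
    simp

theorem IsEllipticOp.exists_sobolevNorm_sq_le_specSq [IsFiniteMeasure (surfaceMeasure n M)]
    (hn : 0 < n) (hD : IsPseudoDiff n μ D) (hell : IsEllipticOp n μ D) (hsa : IsSelfAdjointOp n D)
    (k : ℕ) : ∃ C : ℝ≥0, ∀ e ev, IsEigenbasis n D e ev → ∀ f,
      sobolevNorm 𝒜 (k * μ) f ^ 2 ≤ C * specSq n e ev (2 * k) f := by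
  obtain ⟨C, hC⟩ := hell.exists_sobolevNorm_sq_le_sum 𝒜 hn hD k
  refine ⟨C * (k + 1), fun e ev he f => (hC f).trans ?_⟩
  push_cast
  rw [mul_assoc]
  refine mul_le_mul_right ?_ _
  have := Finset.sum_le_card_nsmul (Finset.range (k + 1)) (fun j => l2sq n ((D ^ j) f)) _
    fun j hj => he.l2sq_pow_apply_le hsa (Nat.lt_succ_iff.1 (Finset.mem_range.1 hj)) f
  simpa using this

theorem IsPseudoDiff.exists_specSq_le [IsFiniteMeasure (surfaceMeasure n M)]
    (hn : 0 < n) (hμ : 0 < μ) (hD : IsPseudoDiff n μ D) (hsa : IsSelfAdjointOp n D) (k : ℕ) :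
    ∃ C : ℝ≥0, ∀ e ev, IsEigenbasis n D e ev → ∀ f,
      specSq n e ev (2 * k) f ≤ C * sobolevNorm 𝒜 (k * μ) f ^ 2 := by
  obtain ⟨C₀, hC₀⟩ := exists_l2sq_le 𝒜
  obtain ⟨C, hC⟩ := exists_sobolevNorm_pow_le 𝒜 (hD.exists_sobolevNorm_le 𝒜 hn) k (k * μ)
  refine ⟨4 ^ k * (C₀ + C₀ * C ^ 2), fun e ev he f => (he.specSq_le hsa k f).trans ?_⟩
  rw [ENNReal.coe_mul, mul_assoc]
  refine mul_le_mul_right ?_ _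
  push_cast
  rw [add_mul, mul_assoc, ← mul_pow]
  refine add_le_add ((hC₀ f).trans (mul_le_mul_right (pow_le_pow_left₀ zero_le
    (sobolevNorm_mono 𝒜 (by positivity) f) 2) _)) ((hC₀ _).trans (mul_le_mul_right
    (pow_le_pow_left₀ zero_le ?_ 2) _))
  have := hC f
  rwa [sub_self] at this

/-- A finite sum of eigenfunctions is `(D + i)^k g` with the coefficients of `g` divided by `(ev l +
i)^k`. Since `(D + i)^k` maps `H⁰` to `H^{-kμ}`, the `L²` norm of `g` controls the negative norm,
and `|ev l + i|² = 1 + (ev l)²` is comparable to `(1 + |ev l|)²`. -/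
theorem IsPseudoDiff.exists_sobolevNorm_neg_sq_le_specSq [IsFiniteMeasure (surfaceMeasure n M)]
    (hn : 0 < n) (hμ : 0 < μ) (hD : IsPseudoDiff n μ D) (k : ℕ) :
    ∃ C : ℝ≥0, ∀ e ev, IsEigenbasis n D e ev → ∀ (I : Finset ℕ) (c : ℕ → ℂ),
      sobolevNorm 𝒜 (-(k * μ)) (∑ l ∈ I, c l • e l) ^ 2 ≤
        C * specSq n e ev (-(2 * k)) (∑ l ∈ I, c l • e l) := by
  obtain ⟨C₀, hC₀⟩ := exists_sobolevNorm_zero_le 𝒜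
  obtain ⟨C, hC⟩ := exists_sobolevNorm_pow_le 𝒜 (μ := μ) (B := D + Complex.I • LinearMap.id)
    (fun s => by
      obtain ⟨C, hC⟩ := hD.exists_sobolevNorm_le 𝒜 hn s
      refine ⟨C + 1, fun f => ?_⟩
      push_cast
      rw [add_mul, one_mul]
      refine (sobolevNorm_add_le 𝒜 _ _ _).trans (add_le_add (hC f) ?_)
      change sobolevNorm 𝒜 (s - μ) (Complex.I • f) ≤ _
      rw [sobolevNorm_smul]
      simpa using sobolevNorm_mono 𝒜 (show s - μ ≤ s by linarith) f) k 0
  refine ⟨C ^ 2 * (C₀ * 2 ^ k), fun e ev he I c => ?_⟩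
  have hne : ∀ l, (ev l : ℂ) + Complex.I ≠ 0 := fun l h => by
    simpa using congrArg Complex.im h
  set d : ℕ → ℂ := fun l => c l * (((ev l : ℂ) + Complex.I) ^ k)⁻¹
  have h1 : ((D + Complex.I • LinearMap.id : SmoothFun M →ₗ[ℂ] SmoothFun M) ^ k) (∑ l ∈ I, d l • e l) = ∑ l ∈ I, c l • e l := by
    rw [map_sum]
    refine Finset.sum_congr rfl fun l _ => ?_
    rw [map_smul, pow_shift_apply he.eigen, smul_smul, mul_assoc,
      inv_mul_cancel₀ (pow_ne_zero _ (hne l)), mul_one]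
  have h2 := hC (∑ l ∈ I, d l • e l)
  rw [h1, zero_sub] at h2
  refine (pow_le_pow_left₀ zero_le h2 2).trans ?_
  rw [mul_pow]
  push_cast
  rw [mul_assoc, mul_assoc]
  refine mul_le_mul_right ((hC₀ _).trans (mul_le_mul_right ?_ _)) _
  rw [← he.tsum_eq, specSq, ← ENNReal.tsum_mul_left]
  refine ENNReal.tsum_le_tsum fun l => ?_
  rw [he.innerL2_sum, he.innerL2_sum]
  split_ifs
  · rw [enorm_mul, mul_pow, mul_comm, ← mul_assoc]
    refine mul_le_mul_left ?_ _
    have e1 : (2 : ℝ≥0∞) ^ k = ENNReal.ofReal (2 ^ k) := by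
      rw [ENNReal.ofReal_pow (by norm_num)]; norm_num
    rw [e1, ← ENNReal.ofReal_mul (by positivity), ← ofReal_norm,
      ← ENNReal.ofReal_pow (norm_nonneg _)]
    refine ENNReal.ofReal_le_ofReal ?_
    have hp := one_add_abs_pos (ev l)
    have h4 : ‖(ev l : ℂ) + Complex.I‖ ^ 2 = 1 + ev l ^ 2 := by
      rw [← Complex.normSq_eq_norm_sq, Complex.normSq_apply]; simp; ring
    have h5 : (1 + |ev l|) ^ (-(2 * (k : ℝ))) = (((1 + |ev l|) ^ 2) ^ k)⁻¹ := by
      rw [Real.rpow_neg hp.le, ← pow_mul, ← Real.rpow_natCast]; push_cast; rfl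
    rw [norm_inv, norm_pow, inv_pow, ← pow_mul, mul_comm k 2, pow_mul, h4, h5, ← div_eq_mul_inv,
      inv_eq_one_div, div_le_div_iff₀ (by positivity) (by positivity), one_mul, ← mul_pow]
    refine pow_le_pow_left₀ (by positivity) ?_ k
    nlinarith [sq_abs (ev l), sq_nonneg (1 - |ev l|)]
  · simp

end SpectralSobolev

/-! ### Comparison of norms at intermediate orders. -/

section SpectralInterpolation

theorem enorm_fourier_add_le {n : ℕ} (u v : 𝓢(Euc n, ℂ)) (ξ : Euc n) :
    ‖𝓕 (⇑(u + v)) ξ‖ₑ ≤ ‖𝓕 (⇑u) ξ‖ₑ + ‖𝓕 (⇑v) ξ‖ₑ := by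
  have : 𝓕 (⇑(u + v)) ξ = 𝓕 (⇑u) ξ + 𝓕 (⇑v) ξ := by
    simp only [← SchwartzMap.fourier_coe, FourierTransform.fourier_add]
    rfl
  rw [this]
  exact enorm_add_le _ _

theorem lintegral_weight_eq {n : ℕ} (s : ℝ) (u : Euc n → ℂ) :
    ∫⁻ ξ, ENNReal.ofReal ((1 + ‖ξ‖ ^ 2) ^ s) * ‖𝓕 u ξ‖ₑ ^ 2 = sobolevNormEuc s u ^ 2 := by
  rw [sobolevNormEuc_eq, wnorm_sq, wsq]

/-- The two costs of the optimal splitting of a coefficient, in the proportions `l * q / (p + l *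
q)` and `p / (p + l * q)`; each is at most the parallel sum of `p` and `l * q`. -/
theorem interp_weight_le {p q l : ℝ} (hp : 0 < p) (hq : 0 < q) (hl : 0 < l) :
    p * (l * q / (p + l * q)) ^ 2 ≤ l * p * q / (p + l * q) ∧
      l * (q * (1 - l * q / (p + l * q)) ^ 2) ≤ l * p * q / (p + l * q) := by
  have h : 0 < p + l * q := by positivity
  have h1 : 1 - l * q / (p + l * q) = p / (p + l * q) := by field_simp; ring
  rw [h1]
  constructor
  · rw [div_pow, mul_div_assoc', div_le_div_iff₀ (by positivity) h]
    have : 0 < p * p * (l * q) * (p + l * q) := by positivity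
    nlinarith
  · rw [div_pow, mul_div_assoc', mul_div_assoc', div_le_div_iff₀ (by positivity) h]
    have : 0 < l * p * q * (l * q) * (p + l * q) := by positivity
    nlinarith

variable {m n : ℕ} {M : Set (Euc m)} (𝒜 : SobolevAtlas n M) {μ : ℝ}
  {D : SmoothFun M →ₗ[ℂ] SmoothFun M} [CompactSpace M]

theorem enorm_fourier_chartPull_add_le (i : Fin 𝒜.size) (f g : SmoothFun M) (ξ : Euc n) :
    ‖𝓕 (chartPull (𝒜.chart i) (𝒜.cutoff i * (f + g))) ξ‖ₑ ≤
      ‖𝓕 (chartPull (𝒜.chart i) (𝒜.cutoff i * f)) ξ‖ₑ +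
      ‖𝓕 (chartPull (𝒜.chart i) (𝒜.cutoff i * g)) ξ‖ₑ := by
  rw [mul_add, chartPull_add]
  exact enorm_fourier_add_le (chartS (𝒜.smooth i) (tsupport_mul_left (𝒜.subordinate i) f))
      (chartS (𝒜.smooth i) (tsupport_mul_left (𝒜.subordinate i) g)) ξ

theorem exists_sobolevNorm_chartPush_le (hM : IsClosed M) {κ : OpenPartialHomeomorph M (Euc n)}
    (hκ : IsSmoothChart κ) {ψ : SmoothFun M} (hψ : tsupport (ψ : M → ℂ) ⊆ κ.source) (s : ℝ) :
    ∃ C : ℝ≥0, ∀ u : 𝓢(Euc n, ℂ),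
      sobolevNorm 𝒜 s (chartPush hM hκ hψ (u.smooth ⊤)) ≤ C * sobolevNormEuc s u := by
  obtain ⟨η, hη, hη1⟩ := exists_cutoff_mul (isClosed_tsupport (ψ : M → ℂ)) κ.open_source hψ
  obtain ⟨C₁, hC₁⟩ := exists_sobolevNorm_le_chartPull 𝒜 hκ hη s
  obtain ⟨C₂, hC₂⟩ := (isCc_chartPull hκ hψ).exists_sobolev_mul_le s
  refine ⟨C₁ * C₂, fun u => ?_⟩
  have h1 := hC₁ (chartPush hM hκ hψ (u.smooth ⊤))
  rw [hη1 _ (closure_mono (Function.support_mul_subset_left _ _))] at h1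
  have h2 : chartPull κ (chartPush hM hκ hψ (u.smooth ⊤)) = fun x => chartPull κ ψ x * u x := by
    ext y
    by_cases hy : y ∈ κ.target
    · simp [chartPull, hy, κ.right_inv hy]
    · simp [chartPull, hy]
  rw [h2] at h1
  push_cast
  rw [mul_assoc]
  exact h1.trans (mul_le_mul_right (hC₂ u) _)

variable [IsFiniteMeasure (surfaceMeasure n M)]

/-- Each coefficient is split in the optimal proportion; one part is estimated at the order `-kμ`,
the other at `kμ`. For finite sums both parts are again smooth functions, and the exponent `2θ - 1`
runs through `(-1, 1)`. -/
theorem IsEigenbasis.lintegral_interp {e : ℕ → SmoothFun M} {ev : ℕ → ℝ}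
    (he : IsEigenbasis n D e ev) {k : ℕ} {C : ℝ≥0}
    (h₀ : ∀ (I : Finset ℕ) (c : ℕ → ℂ), sobolevNorm 𝒜 (-(k * μ)) (∑ l ∈ I, c l • e l) ^ 2 ≤
        C * specSq n e ev (-(2 * k)) (∑ l ∈ I, c l • e l))
    (h₁ : ∀ f, sobolevNorm 𝒜 (k * μ) f ^ 2 ≤ C * specSq n e ev (2 * k) f)
    {θ : ℝ} (hθ0 : 0 < θ) (hθ1 : θ < 1) (I : Finset ℕ) (c : ℕ → ℂ) (i : Fin 𝒜.size) :
    sobolevNormEuc (k * μ * (2 * θ - 1))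
      (chartPull (𝒜.chart i) (𝒜.cutoff i * ∑ l ∈ I, c l • e l)) ^ 2 ≤
      2 * C * specSq n e ev (2 * k * (2 * θ - 1)) (∑ l ∈ I, c l • e l) := by
  have hm : ∀ f : SmoothFun M, Measurable fun ξ =>
      ‖𝓕 (chartPull (𝒜.chart i) (𝒜.cutoff i * f)) ξ‖ₑ := fun f =>
    measurable_enorm_fourier (chartS (𝒜.smooth i) (tsupport_mul_left (𝒜.subordinate i) f))
  have hle : ∀ s f, sobolevNormEuc s (chartPull (𝒜.chart i) (𝒜.cutoff i * f)) ^ 2 ≤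
      sobolevNorm 𝒜 s f ^ 2 := fun s f => pow_le_pow_left₀ zero_le (le_sobolevNorm 𝒜 s i f) 2
  set p : ℕ → ℝ := fun l => (1 + |ev l|) ^ (-(2 * k) : ℝ)
  set q : ℕ → ℝ := fun l => (1 + |ev l|) ^ (2 * k : ℝ)
  have hp : ∀ l, 0 < p l := fun l => Real.rpow_pos_of_pos (one_add_abs_pos _) _
  have hq : ∀ l, 0 < q l := fun l => Real.rpow_pos_of_pos (one_add_abs_pos _) _
  have h := lintegral_interp_le (μ := (Measure.count : Measure ℕ)) (ν := (volume : Measure (Euc n)))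
    (p := p) (q := q) hp hq measurable_from_top measurable_from_top
    (p' := fun ξ => (1 + ‖ξ‖ ^ 2) ^ (-(k * μ))) (q' := fun ξ => (1 + ‖ξ‖ ^ 2) ^ (k * μ))
    (fun ξ => by positivity) (fun ξ => by positivity) (by fun_prop) (by fun_prop)
    (F := fun l => ‖innerL2 n (∑ l ∈ I, c l • e l) (e l)‖ₑ) measurable_from_top
    (hm (∑ l ∈ I, c l • e l)) C hθ0 hθ1 (fun L hL => ?_)
  · rw [lintegral_count] at h
    rw [← lintegral_weight_eq, specSq]
    refine (le_of_eq (lintegral_congr fun ξ => ?_)).trans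
      (h.trans_eq (congrArg _ (tsum_congr fun l => ?_)))
    · rw [← Real.rpow_mul (by positivity), ← Real.rpow_mul (by positivity),
        ← Real.rpow_add (by positivity)]
      congr 3
      ring
    · have hp := one_add_abs_pos (ev l)
      simp only [p, q]
      rw [← Real.rpow_mul hp.le, ← Real.rpow_mul hp.le, ← Real.rpow_add hp]
      congr 3
      ring
  · set w : ℕ → ℝ := fun l => L * q l / (p l + L * q l)
    have hsum : ∑ l ∈ I, c l • e l =
        ∑ l ∈ I, ((w l : ℂ) * c l) • e l + ∑ l ∈ I, ((1 - w l : ℝ) * c l) • e l := by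
      rw [← Finset.sum_add_distrib]
      refine Finset.sum_congr rfl fun l _ => ?_
      rw [← add_smul]
      congr 1
      push_cast
      ring
    refine ⟨_, fun ξ => ‖𝓕 (chartPull (𝒜.chart i) (𝒜.cutoff i *
      ∑ l ∈ I, ((1 - w l : ℝ) * c l) • e l)) ξ‖ₑ, hm (∑ l ∈ I, ((w l : ℂ) * c l) • e l),
      fun ξ => ?_, ?_, ?_⟩
    · conv_lhs => rw [hsum]
      exact enorm_fourier_chartPull_add_le 𝒜 i _ _ ξ
    · rw [lintegral_weight_eq]
      refine (hle _ _).trans ((h₀ I _).trans (mul_le_mul_right ?_ _))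
      rw [lintegral_count, specSq]
      refine ENNReal.tsum_le_tsum fun l => ?_
      rw [he.innerL2_sum, he.innerL2_sum]
      split_ifs
      · rw [enorm_mul, mul_pow, ← mul_assoc]
        refine mul_le_mul_left ?_ _
        rw [← ofReal_norm, ← ENNReal.ofReal_pow (norm_nonneg _), Complex.norm_real,
          Real.norm_eq_abs, sq_abs, ← ENNReal.ofReal_mul (hp l).le]
        exact ENNReal.ofReal_le_ofReal (interp_weight_le (hp l) (hq l) hL).1
      · simp
    · rw [lintegral_weight_eq]
      refine (mul_le_mul_right ((hle _ _).trans (h₁ _)) _).trans ?_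
      rw [mul_left_comm]
      refine mul_le_mul_right ?_ _
      rw [lintegral_count, specSq, ← ENNReal.tsum_mul_left]
      refine ENNReal.tsum_le_tsum fun l => ?_
      rw [he.innerL2_sum, he.innerL2_sum]
      split_ifs
      · rw [enorm_mul, mul_pow, ← mul_assoc, ← mul_assoc]
        refine mul_le_mul_left ?_ _
        rw [← ofReal_norm, ← ENNReal.ofReal_pow (norm_nonneg _), Complex.norm_real,
          Real.norm_eq_abs, sq_abs, ← ENNReal.ofReal_mul hL.le, ← ENNReal.ofReal_mul
          (mul_nonneg hL.le (hq l).le), mul_assoc]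
        exact ENNReal.ofReal_le_ofReal (interp_weight_le (hp l) (hq l) hL).2
      · simp

/-- Sobolev norms are bounded by norms defined by means of the eigenvalues. -/
theorem exists_sobolevNorm_sq_le_specSq (hn : 0 < n) (hμ : 0 < μ) (hD : IsPseudoDiff n μ D)
    (hell : IsEllipticOp n μ D) (hsa : IsSelfAdjointOp n D) (k : ℕ) :
    ∃ C : ℝ≥0, ∀ e ev, IsEigenbasis n D e ev → ∀ s : ℝ, |s| < k * μ → ∀ f,
      sobolevNorm 𝒜 s f ^ 2 ≤ C * specSq n e ev (2 * s / μ) f := by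
  obtain ⟨C₀, hC₀⟩ := hD.exists_sobolevNorm_neg_sq_le_specSq 𝒜 hn hμ k
  obtain ⟨C₁, hC₁⟩ := hell.exists_sobolevNorm_sq_le_specSq 𝒜 hn hD hsa k
  obtain ⟨C₂, hC₂⟩ := hD.exists_specSq_le 𝒜 hn hμ hsa k
  refine ⟨2 * (𝒜.size * (2 * max C₀ C₁)), fun e ev he s hs f => ?_⟩
  have hkμ : 0 < k * μ := (abs_nonneg s).trans_lt hs
  have hk0 : (k : ℝ) ≠ 0 := left_ne_zero_of_mul hkμ.ne'
  rw [abs_lt] at hs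
  -- The solution of `k * μ * (2 * θ - 1) = s`.
  set θ : ℝ := (s / (k * μ) + 1) / 2 with hθ
  have hθ0 : 0 < θ := by
    have : -1 < s / (k * μ) := by rw [lt_div_iff₀ hkμ]; linarith
    rw [hθ]; linarith
  have hθ1 : θ < 1 := by
    have : s / (k * μ) < 1 := by rw [div_lt_iff₀ hkμ]; linarith
    rw [hθ]; linarith
  have hθs : k * μ * (2 * θ - 1) = s := by rw [hθ]; field_simp; ring
  have hθr : 2 * (k : ℝ) * (2 * θ - 1) = 2 * s / μ := by rw [← hθs]; field_simp
  have hfin : ∀ N, sobolevNorm 𝒜 s (specProj n e N f) ^ 2 ≤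
      (𝒜.size * (2 * max C₀ C₁) : ℝ≥0) * specSq n e ev (2 * s / μ) f := by
    intro N
    rw [sobolevNorm_sq]
    have h1 : ∀ i, sobolevNormEuc s (chartPull (𝒜.chart i) (𝒜.cutoff i * specProj n e N f)) ^ 2 ≤
        2 * (max C₀ C₁ : ℝ≥0) * specSq n e ev (2 * s / μ) f := by
      intro i
      have h2 := he.lintegral_interp 𝒜 (μ := μ) (k := k) (C := max C₀ C₁)
        (fun I c => (hC₀ e ev he I c).trans
          (mul_le_mul_left (ENNReal.coe_le_coe.2 (le_max_left _ _)) _))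
        (fun f => (hC₁ e ev he f).trans
          (mul_le_mul_left (ENNReal.coe_le_coe.2 (le_max_right _ _)) _)) hθ0 hθ1
        (Finset.range (N + 1)) (fun l => innerL2 n f (e l)) i
      rw [hθs, hθr] at h2
      exact h2.trans (mul_le_mul_right (he.specSq_specProj_le _ N f) _)
    refine (Finset.sum_le_card_nsmul _ _ _ fun i _ => h1 i).trans_eq ?_
    simp [mul_assoc]
  -- Interpolation gives the bound for `specProj n e N f` only. The remainder tends to zero in
  -- `H^{kμ}`, hence in `H^s`, and disappears as `N → ∞`.
  have hlim := he.tendsto_specSq_sub_specProj (r := 2 * k) (f := f) (ne_of_lt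
    ((hC₂ e ev he f).trans_lt (ENNReal.mul_lt_top ENNReal.coe_lt_top
      (ENNReal.pow_lt_top (sobolevNorm_lt_top 𝒜 _ f)))))
  have hlim2 : Tendsto (fun N => 2 * ((𝒜.size * (2 * max C₀ C₁) : ℝ≥0) *
      specSq n e ev (2 * s / μ) f + C₁ * specSq n e ev (2 * k) (f - specProj n e N f))) atTop
      (𝓝 (2 * ((𝒜.size * (2 * max C₀ C₁) : ℝ≥0) * specSq n e ev (2 * s / μ) f + C₁ * 0))) :=
    ENNReal.Tendsto.const_mul (tendsto_const_nhds.add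
      (ENNReal.Tendsto.const_mul hlim (Or.inr ENNReal.coe_ne_top))) (Or.inr ENNReal.ofNat_ne_top)
  rw [mul_zero, add_zero, ← mul_assoc 2 _ (specSq _ _ _ _ _)] at hlim2
  rw [ENNReal.coe_mul, ENNReal.coe_ofNat]
  refine ge_of_tendsto' hlim2 fun N => ?_
  calc sobolevNorm 𝒜 s f ^ 2
      = sobolevNorm 𝒜 s (specProj n e N f + (f - specProj n e N f)) ^ 2 := by
        rw [add_sub_cancel]
    _ ≤ (sobolevNorm 𝒜 s (specProj n e N f) + sobolevNorm 𝒜 s (f - specProj n e N f)) ^ 2 :=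
        pow_le_pow_left₀ zero_le (sobolevNorm_add_le 𝒜 s _ _) 2
    _ ≤ _ := (ENNReal.add_sq_le _ _).trans (mul_le_mul_right (add_le_add (hfin N)
        ((pow_le_pow_left₀ zero_le (sobolevNorm_mono 𝒜 hs.2.le _) 2).trans (hC₁ e ev he _))) _)

theorem specSq_sum_le {ι : Type*} (e : ℕ → SmoothFun M) (ev : ℕ → ℝ) (r : ℝ) (I : Finset ι)
    (f : ι → SmoothFun M) :
    specSq n e ev r (∑ i ∈ I, f i) ≤ I.card * ∑ i ∈ I, specSq n e ev r (f i) := by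
  unfold specSq
  rw [← Summable.tsum_finsetSum fun _ _ => ENNReal.summable, ← ENNReal.tsum_mul_left]
  refine ENNReal.tsum_le_tsum fun k => ?_
  rw [innerL2_sum_left, ← Finset.mul_sum, mul_left_comm]
  exact mul_le_mul_right ((pow_le_pow_left₀ zero_le (enorm_sum_le _ _) 2).trans
    (ENNReal.sq_sum_le_card_mul I _)) _

/-- Norms defined by means of the eigenvalues are bounded by Sobolev norms. -/
theorem exists_specSq_le_sobolevNorm_sq (hn : 0 < n) (hμ : 0 < μ) (hD : IsPseudoDiff n μ D)
    (hsa : IsSelfAdjointOp n D) (k : ℕ) :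
    ∃ C : ℝ≥0, ∀ e ev, IsEigenbasis n D e ev → ∀ s : ℝ, 0 < s → s < k * μ → ∀ f,
      specSq n e ev (2 * s / μ) f ≤ C * sobolevNorm 𝒜 s f ^ 2 := by
  have hM : IsClosed M := (isCompact_iff_compactSpace.2 inferInstance).isClosed
  choose ψ hψ hψ1 using fun i => exists_cutoff_mul (isClosed_tsupport (𝒜.cutoff i : M → ℂ))
    (𝒜.chart i).open_source (𝒜.subordinate i)
  -- Each `R i` carries Schwartz functions to `M`, and applied to the localizations of `f` they add
  -- up to `f`. Hence the interpolation can take place on `ℝⁿ`, where the optimal decomposition is a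
  -- Fourier multiplier.
  set R : Fin 𝒜.size → 𝓢(Euc n, ℂ) → SmoothFun M := fun i u =>
    chartPush hM (𝒜.smooth i) (hψ i) (u.smooth ⊤)
  obtain ⟨C₀, hC₀⟩ := exists_l2sq_le 𝒜
  obtain ⟨C₁, hC₁⟩ := hD.exists_specSq_le 𝒜 hn hμ hsa k
  choose K₀ hK₀ using fun i => exists_sobolevNorm_chartPush_le 𝒜 hM (𝒜.smooth i) (hψ i) 0
  choose K₁ hK₁ using fun i => exists_sobolevNorm_chartPush_le 𝒜 hM (𝒜.smooth i) (hψ i) (k * μ)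
  set B : Fin 𝒜.size → ℝ≥0 := fun i => C₀ * K₀ i ^ 2 + C₁ * K₁ i ^ 2
  refine ⟨𝒜.size * ∑ i, 2 * B i, fun e ev he s hs0 hs f => ?_⟩
  have hkμ : 0 < k * μ := hs0.trans hs
  have hk0 : (k : ℝ) ≠ 0 := left_ne_zero_of_mul hkμ.ne'
  have hRadd : ∀ i u v, R i (u + v) = R i u + R i v := fun i u v => by
    ext x
    simp [R, mul_add]
  have hf : f = ∑ i, R i (chartS (𝒜.smooth i) (tsupport_mul_left (𝒜.subordinate i) f)) := by
    conv_lhs => rw [← 𝒜.sum_cutoff_mul f]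
    refine Finset.sum_congr rfl fun i _ => ?_
    ext x
    have hx1 : ((𝒜.cutoff i * f : SmoothFun M) : M → ℂ) x =
        (ψ i : M → ℂ) x * ((𝒜.cutoff i * f : SmoothFun M) : M → ℂ) x :=
      (congrArg (fun g : SmoothFun M => (g : M → ℂ) x)
        (hψ1 i (𝒜.cutoff i * f) (tsupport_mul_left le_rfl f))).symm
    simp only [R, chartPush_apply, coe_chartS]
    by_cases hx : x ∈ (𝒜.chart i).source
    · rwa [chartPull, indicator_of_mem ((𝒜.chart i).map_source hx), (𝒜.chart i).left_inv hx]
    · have h0 : (ψ i : M → ℂ) x = 0 := image_eq_zero_of_notMem_tsupport fun h => hx (hψ i h)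
      rw [hx1, h0, zero_mul, zero_mul]
  have key : ∀ i u, specSq n e ev (2 * s / μ) (R i u) ≤ 2 * B i * sobolevNormEuc s u ^ 2 := by
    intro i u
    -- The endpoints are the order `0`, with spectral weight `1` by Parseval, and the order `k * μ`,
    -- with spectral weight `(1 + |ev l|) ^ (2 * k)`.
    have h := sobolev_interp (ν := (Measure.count : Measure ℕ)) (p := fun l => 1)
      (q := fun l => (1 + |ev l|) ^ (2 * k : ℝ)) (fun _ => one_pos)
      (fun l => Real.rpow_pos_of_pos (one_add_abs_pos _) _) measurable_from_top measurable_from_top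
      (T := fun u l => ‖innerL2 n (R i u) (e l)‖ₑ) (fun _ => measurable_from_top)
      (fun u v l => by rw [hRadd, innerL2_add_left]; exact enorm_add_le _ _)
      (a := 0) (b := k * μ) (B i)
      (fun u => by
        rw [lintegral_count]
        simp only [ENNReal.ofReal_one, one_mul]
        rw [he.tsum_eq]
        refine (hC₀ _).trans ((mul_le_mul_right (pow_le_pow_left₀ zero_le (hK₀ i u) 2) _).trans ?_)
        rw [mul_pow, ← mul_assoc]
        refine mul_le_mul_left ?_ _
        simp only [B]
        push_cast
        exact le_self_add)
      (fun u => by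
        rw [lintegral_count]
        refine (hC₁ e ev he _).trans
          ((mul_le_mul_right (pow_le_pow_left₀ zero_le (hK₁ i u) 2) _).trans ?_)
        rw [mul_pow, ← mul_assoc]
        refine mul_le_mul_left ?_ _
        simp only [B]
        push_cast
        exact le_add_self)
      (θ := s / (k * μ)) (by positivity) (by rwa [div_lt_one hkμ]) u
    rw [lintegral_count] at h
    refine (le_of_eq (tsum_congr fun l => ?_)).trans (h.trans_eq ?_)
    · rw [Real.one_rpow, one_mul, ← Real.rpow_mul (one_add_abs_pos _).le]
      congr 3
      field_simp
    · rw [mul_zero, zero_add, div_mul_cancel₀ _ hkμ.ne']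
  conv_lhs => rw [hf]
  refine (specSq_sum_le e ev _ _ _).trans ?_
  push_cast
  rw [mul_assoc, Finset.sum_mul, Finset.card_univ, Fintype.card_fin]
  refine mul_le_mul_right (Finset.sum_le_sum fun i _ => (key i _).trans ?_) _
  exact mul_le_mul_right (pow_le_pow_left₀ zero_le (le_sobolevNorm 𝒜 s i f) 2) _

end SpectralInterpolation

/-! ### A scaled Sobolev embedding and the eigenvalue bound. -/

section Weyl

theorem lintegral_comp_inv_smul {n : ℕ} {ρ : ℝ} (hρ : 0 < ρ) {f : Euc n → ℝ≥0∞} (hf : Measurable f) :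
    ∫⁻ ξ, f (ρ⁻¹ • ξ) = ENNReal.ofReal (ρ ^ n) * ∫⁻ ξ, f ξ := by
  have h := Measure.map_addHaar_smul (volume : Measure (Euc n)) (inv_ne_zero hρ.ne')
  rw [← lintegral_map hf (measurable_const_smul ρ⁻¹), h, lintegral_smul_measure, smul_eq_mul]
  congr 2
  rw [finrank_euclideanSpace_fin, inv_pow, inv_inv, abs_of_pos (by positivity)]

/-- A scaled Sobolev embedding. -/
theorem exists_enorm_sq_le {n : ℕ} {s : ℝ} (hs : (n : ℝ) < 2 * s) : ∃ C : ℝ≥0, ∀ ρ : ℝ, 0 < ρ →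
    ∀ (u : 𝓢(Euc n, ℂ)) (y : Euc n), ‖u y‖ₑ ^ 2 ≤ C * ENNReal.ofReal (ρ ^ n) *
      (sobolevNormEuc 0 u ^ 2 + ENNReal.ofReal (ρ ^ (-(2 * s))) * sobolevNormEuc s u ^ 2) := by
  have hs0 : 0 ≤ s := by have : (0 : ℝ) ≤ n := n.cast_nonneg; linarith
  have hint := integrable_rpow_neg_one_add_norm_sq (E := Euc n) (μ := volume) (r := 2 * s)
    (by rwa [finrank_euclideanSpace_fin])
  set A : ℝ≥0∞ := ∫⁻ ξ : Euc n, ENNReal.ofReal ((1 + ‖ξ‖ ^ 2) ^ (-s)) with hA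
  have hAt : A ≠ ⊤ := by
    refine ne_of_lt (lt_of_eq_of_lt (lintegral_congr fun ξ => ?_) hint.2)
    rw [← ofReal_norm, Real.norm_of_nonneg (by positivity)]
    congr 2
    ring
  refine ⟨A.toNNReal * (2 ^ s : ℝ).toNNReal, fun ρ hρ u y => ?_⟩
  -- The Sobolev weight at frequency scale `ρ`: by dilation the integral of `w ^ (-s)` is `ρ ^ n *
  -- A`, while `w ^ s` is at most a constant times `1 + ρ ^ (-2s) (1 + ‖ξ‖²) ^ s`.
  set w : Euc n → ℝ := fun ξ => 1 + ‖ρ⁻¹ • ξ‖ ^ 2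
  have hw : ∀ ξ, 0 < w ξ := fun ξ => by positivity
  have hwm : Measurable w := by fun_prop
  have h1 : ‖u y‖ₑ ≤ ∫⁻ ξ, ENNReal.ofReal (w ξ ^ (-s)) * (ENNReal.ofReal (w ξ ^ s) * ‖𝓕 (⇑u) ξ‖ₑ) := by
    conv_lhs => rw [← symbolOp_one u]
    refine (enorm_integral_le_lintegral_enorm _).trans (lintegral_mono fun ξ => ?_)
    rw [← mul_assoc, ← ENNReal.ofReal_mul (by have := hw ξ; positivity), ← Real.rpow_add (hw ξ),
      neg_add_cancel, Real.rpow_zero, ENNReal.ofReal_one, one_mul, enorm_mul, enorm_mul, enorm_one,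
      mul_one, ← ofReal_norm, norm_exp_two_pi_mul, ENNReal.ofReal_one, one_mul]
  have h2 := sq_lintegral_mul_le (ν := (volume : Measure (Euc n)))
    (k := fun ξ => ENNReal.ofReal (w ξ ^ (-s))) (V := fun ξ => ENNReal.ofReal (w ξ ^ s) * ‖𝓕 (⇑u) ξ‖ₑ)
    (by fun_prop) ((by fun_prop : Measurable fun ξ => ENNReal.ofReal (w ξ ^ s)).mul
      (measurable_enorm_fourier u))
  have h3 : ∫⁻ ξ, ENNReal.ofReal (w ξ ^ (-s)) = ENNReal.ofReal (ρ ^ n) * A :=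
    lintegral_comp_inv_smul hρ (f := fun ξ => ENNReal.ofReal ((1 + ‖ξ‖ ^ 2) ^ (-s))) (by fun_prop)
  have h4 : ∀ ξ, ENNReal.ofReal (w ξ ^ (-s)) * (ENNReal.ofReal (w ξ ^ s) * ‖𝓕 (⇑u) ξ‖ₑ) ^ 2 ≤
      ENNReal.ofReal (2 ^ s) * (ENNReal.ofReal ((1 + ‖ξ‖ ^ 2) ^ (0 : ℝ)) * ‖𝓕 (⇑u) ξ‖ₑ ^ 2 +
      ENNReal.ofReal (ρ ^ (-(2 * s))) * (ENNReal.ofReal ((1 + ‖ξ‖ ^ 2) ^ s) * ‖𝓕 (⇑u) ξ‖ₑ ^ 2)) := by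
    intro ξ
    have hwξ := hw ξ
    rw [mul_pow, ← mul_assoc, ← ENNReal.ofReal_pow (by positivity),
      ← ENNReal.ofReal_mul (by positivity), sq (w ξ ^ s), ← mul_assoc, ← Real.rpow_add hwξ,
      neg_add_cancel, Real.rpow_zero, one_mul, ← mul_assoc (ENNReal.ofReal (ρ ^ _)), ← add_mul,
      ← mul_assoc, ← ENNReal.ofReal_mul (by positivity), ← ENNReal.ofReal_add (by positivity)
      (by positivity), ← ENNReal.ofReal_mul (by positivity)]
    refine mul_le_mul_left (ENNReal.ofReal_le_ofReal ?_) _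
    set a : ℝ := ‖ρ⁻¹ • ξ‖ ^ 2
    have ha : 0 ≤ a := by positivity
    have h5 : a ^ s ≤ ρ ^ (-(2 * s)) * (1 + ‖ξ‖ ^ 2) ^ s := by
      have h6 : a = ρ ^ (-2 : ℝ) * ‖ξ‖ ^ 2 := by
        simp only [a]
        rw [norm_smul, norm_inv, Real.norm_of_nonneg hρ.le, mul_pow, Real.rpow_neg hρ.le,
          Real.rpow_two, inv_pow]
      rw [h6, Real.mul_rpow (by positivity) (by positivity), ← Real.rpow_mul hρ.le]
      rw [show (-2 : ℝ) * s = -(2 * s) by ring]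
      gcongr
      linarith
    have h7 : w ξ ≤ 2 * max 1 a := by
      have h8 : w ξ = 1 + a := rfl
      linarith [le_max_left 1 a, le_max_right 1 a]
    calc w ξ ^ s ≤ (2 * max 1 a) ^ s := Real.rpow_le_rpow hwξ.le h7 hs0
      _ = 2 ^ s * max 1 a ^ s := Real.mul_rpow (by norm_num) (by positivity)
      _ ≤ 2 ^ s * ((1 + ‖ξ‖ ^ 2) ^ (0 : ℝ) + ρ ^ (-(2 * s)) * (1 + ‖ξ‖ ^ 2) ^ s) := by
          rw [Real.rpow_zero]
          refine mul_le_mul_of_nonneg_left ?_ (by positivity)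
          have h9 : 0 ≤ ρ ^ (-(2 * s)) * (1 + ‖ξ‖ ^ 2) ^ s := by positivity
          rcases max_cases 1 a with h | h
          · rw [h.1, Real.one_rpow]; linarith
          · rw [h.1]; linarith
  have hm : ∀ r : ℝ, Measurable fun ξ : Euc n =>
      ENNReal.ofReal ((1 + ‖ξ‖ ^ 2) ^ r) * ‖𝓕 (⇑u) ξ‖ₑ ^ 2 :=
    fun r => (measurable_weight r).mul ((measurable_enorm_fourier u).pow_const 2)
  have hm2 : Measurable fun ξ : Euc n => ENNReal.ofReal ((1 + ‖ξ‖ ^ 2) ^ (0 : ℝ)) * ‖𝓕 (⇑u) ξ‖ₑ ^ 2 +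
      ENNReal.ofReal (ρ ^ (-(2 * s))) * (ENNReal.ofReal ((1 + ‖ξ‖ ^ 2) ^ s) * ‖𝓕 (⇑u) ξ‖ₑ ^ 2) :=
    (hm 0).add ((hm s).const_mul _)
  calc ‖u y‖ₑ ^ 2 ≤ _ := (pow_le_pow_left₀ zero_le h1 2).trans h2
    _ ≤ (ENNReal.ofReal (ρ ^ n) * A) * (ENNReal.ofReal (2 ^ s) *
        (sobolevNormEuc 0 u ^ 2 + ENNReal.ofReal (ρ ^ (-(2 * s))) * sobolevNormEuc s u ^ 2)) := by
        rw [h3]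
        refine mul_le_mul_right ((lintegral_mono h4).trans_eq ?_) _
        rw [lintegral_const_mul _ hm2, lintegral_add_left (hm 0),
          lintegral_const_mul _ (hm s), lintegral_weight_eq, lintegral_weight_eq]
    _ = _ := by
        rw [ENNReal.coe_mul, ENNReal.coe_toNNReal hAt, ENNReal.ofReal, ENNReal.ofReal,
          ENNReal.ofReal]
        ring

variable {m n : ℕ} {M : Set (Euc m)} (𝒜 : SobolevAtlas n M) [CompactSpace M]

theorem exists_enorm_apply_sq_le {s : ℝ} (hs : (n : ℝ) < 2 * s) : ∃ C : ℝ≥0, ∀ ρ : ℝ, 0 < ρ →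
    ∀ (f : SmoothFun M) (x : M), ‖(f : M → ℂ) x‖ₑ ^ 2 ≤ C * ENNReal.ofReal (ρ ^ n) *
      (sobolevNorm 𝒜 0 f ^ 2 + ENNReal.ofReal (ρ ^ (-(2 * s))) * sobolevNorm 𝒜 s f ^ 2) := by
  obtain ⟨C, hC⟩ := exists_enorm_sq_le hs
  refine ⟨𝒜.size * (𝒜.size * C), fun ρ hρ f x => ?_⟩
  set B := sobolevNorm 𝒜 0 f ^ 2 + ENNReal.ofReal (ρ ^ (-(2 * s))) * sobolevNorm 𝒜 s f ^ 2 with hB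
  have h1 : (f : M → ℂ) x = ∑ i, ((𝒜.cutoff i * f : SmoothFun M) : M → ℂ) x := by
    conv_lhs => rw [← 𝒜.sum_cutoff_mul f]
    simp
  have h2 : ∀ i, ‖((𝒜.cutoff i * f : SmoothFun M) : M → ℂ) x‖ₑ ≤
      ‖chartPull (𝒜.chart i) (𝒜.cutoff i * f) ((𝒜.chart i) x)‖ₑ := by
    intro i
    by_cases hx : x ∈ (𝒜.chart i).source
    · rw [chartPull_apply_of_mem le_rfl hx]
    · rw [image_eq_zero_of_notMem_tsupport fun h => hx (tsupport_mul_left (𝒜.subordinate i) f h)]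
      simp
  have h3 : ∀ i, ‖chartPull (𝒜.chart i) (𝒜.cutoff i * f) ((𝒜.chart i) x)‖ₑ ^ 2 ≤
      C * ENNReal.ofReal (ρ ^ n) * B := fun i => by
    refine (hC ρ hρ (chartS (𝒜.smooth i) (tsupport_mul_left (𝒜.subordinate i) f)) _).trans
      (mul_le_mul_right ?_ _)
    exact add_le_add (pow_le_pow_left₀ zero_le (le_sobolevNorm 𝒜 0 i f) 2)
      (mul_le_mul_right (pow_le_pow_left₀ zero_le (le_sobolevNorm 𝒜 s i f) 2) _)
  rw [h1]
  refine (pow_le_pow_left₀ zero_le ((enorm_sum_le _ _).trans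
    (Finset.sum_le_sum fun i _ => h2 i)) 2).trans ((ENNReal.sq_sum_le_card_mul _ _).trans ?_)
  rw [Finset.card_univ, Fintype.card_fin]
  push_cast
  refine (mul_le_mul_right (Finset.sum_le_card_nsmul _ _ _ fun i _ => h3 i) _).trans_eq ?_
  rw [Finset.card_univ, Fintype.card_fin, nsmul_eq_mul]
  ring

variable {μ : ℝ} {D : SmoothFun M →ₗ[ℂ] SmoothFun M} [IsFiniteMeasure (surfaceMeasure n M)]

theorem IsEigenbasis.specSq_sum_range_le {e : ℕ → SmoothFun M} {ev : ℕ → ℝ}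
    (he : IsEigenbasis n D e ev) {r : ℝ} (hr : 0 ≤ r) (N : ℕ) (c : ℕ → ℂ) :
    specSq n e ev r (∑ k ∈ Finset.range (N + 1), c k • e k) ≤
      ENNReal.ofReal ((1 + |ev N|) ^ r) * ∑ k ∈ Finset.range (N + 1), ‖c k‖ₑ ^ 2 := by
  rw [specSq, tsum_eq_sum (s := Finset.range (N + 1)), Finset.mul_sum]
  · refine Finset.sum_le_sum fun k hk => ?_
    rw [he.innerL2_sum, if_pos hk]
    refine mul_le_mul_left (ENNReal.ofReal_le_ofReal ?_) _
    have h1 : |ev k| ≤ |ev N| := he.mono (Nat.lt_succ_iff.1 (Finset.mem_range.1 hk))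
    exact Real.rpow_le_rpow (one_add_abs_pos _).le (by linarith) hr
  · intro k hk
    rw [he.innerL2_sum, if_neg hk]
    simp

theorem ENNReal.le_of_sq_le_mul {x y : ℝ≥0∞} (hx : x ≠ ⊤) (h : x ^ 2 ≤ y * x) : x ≤ y := by
  rcases eq_or_ne x 0 with rfl | h0
  · exact zero_le
  · rw [sq] at h
    exact (ENNReal.mul_le_mul_iff_left h0 hx).1 h

/-- The upper bound of Weyl's law. -/
theorem exists_le_mul_rpow_eigenvalue (𝒜 : SobolevAtlas n M) (hn : 0 < n) (hμ : 0 < μ) (hD : IsPseudoDiff n μ D)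
    (hell : IsEllipticOp n μ D) (hsa : IsSelfAdjointOp n D) :
    ∃ C : ℝ, 0 < C ∧ ∀ e ev, IsEigenbasis n D e ev → ∀ N : ℕ,
      (N : ℝ) + 1 ≤ C * (1 + |ev N|) ^ (n / μ) := by
  obtain ⟨k, hk⟩ := exists_nat_gt (n / (2 * μ))
  have hs : (n : ℝ) < 2 * (k * μ) := by
    rw [div_lt_iff₀ (by positivity)] at hk; linarith
  obtain ⟨C, hC⟩ := exists_enorm_apply_sq_le 𝒜 hs
  obtain ⟨C₀, hC₀⟩ := exists_sobolevNorm_zero_le 𝒜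
  obtain ⟨C₁, hC₁⟩ := hell.exists_sobolevNorm_sq_le_specSq 𝒜 hn hD hsa k
  set V : ℝ≥0∞ := surfaceMeasure n M univ
  set B : ℝ := (C * (C₀ + C₁) : ℝ≥0) * V.toReal + 1 with hBdef
  refine ⟨B, by positivity, fun e ev he N => ?_⟩
  have hΛ := one_add_abs_pos (ev N)
  set Λ : ℝ := 1 + |ev N|
  set S : M → ℝ≥0∞ := fun x => ∑ k ∈ Finset.range (N + 1), ‖(e k : M → ℂ) x‖ₑ ^ 2 with hS
  have hSle : ∀ x, S x ≤ (C * (C₀ + C₁) : ℝ≥0) * ENNReal.ofReal (Λ ^ (n / μ)) := by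
    intro x
    -- With these coefficients both `f x` and the squared `L²` norm of `f` equal `S x`; a bound of
    -- `|f x|²` by the norm is then a bound of `S x` itself.
    set c : ℕ → ℂ := fun k => conj ((e k : M → ℂ) x)
    set f : SmoothFun M := ∑ k ∈ Finset.range (N + 1), c k • e k
    have hc : ∑ k ∈ Finset.range (N + 1), ‖c k‖ₑ ^ 2 = S x := by
      refine Finset.sum_congr rfl fun k _ => ?_
      simp only [c, ← ofReal_norm, RCLike.norm_conj]
    have hfx : ‖(f : M → ℂ) x‖ₑ = S x := by
      have h1 : (f : M → ℂ) x =
          ((∑ k ∈ Finset.range (N + 1), ‖(e k : M → ℂ) x‖ ^ 2 : ℝ) : ℂ) := by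
        simp only [f, c, AddSubmonoidClass.coe_finsetSum, Finset.sum_apply, Complex.ofReal_sum]
        refine Finset.sum_congr rfl fun k _ => ?_
        change conj ((e k : M → ℂ) x) * (e k : M → ℂ) x = _
        rw [mul_comm, Complex.mul_conj, Complex.normSq_eq_norm_sq]
      rw [h1, ← ofReal_norm, Complex.norm_real, Real.norm_of_nonneg (by positivity),
        ENNReal.ofReal_sum_of_nonneg fun k _ => by positivity]
      refine Finset.sum_congr rfl fun k _ => ?_
      rw [ENNReal.ofReal_pow (norm_nonneg _), ofReal_norm]
    have hSt : S x ≠ ⊤ := by rw [← hfx]; exact enorm_ne_top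
    have h0 : sobolevNorm 𝒜 0 f ^ 2 ≤ C₀ * S x := by
      refine (hC₀ f).trans (mul_le_mul_right ?_ _)
      rw [← he.specSq_zero, ← hc]
      simpa using he.specSq_sum_range_le le_rfl N c
    have h1 : sobolevNorm 𝒜 (k * μ) f ^ 2 ≤ C₁ * (ENNReal.ofReal (Λ ^ (2 * k : ℝ)) * S x) := by
      refine (hC₁ e ev he f).trans (mul_le_mul_right ?_ _)
      rw [← hc]
      exact he.specSq_sum_range_le (by positivity) N c
    refine ENNReal.le_of_sq_le_mul hSt ?_
    -- The scale `ρ = Λ ^ (1 / μ)` balances the two terms: `ρ ^ (-2kμ) = Λ ^ (-2k)` cancels the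
    -- growth of the norm of order `k * μ` on the span, and `ρ ^ n = Λ ^ (n / μ)`.
    have h2 := hC (Λ ^ (1 / μ)) (by positivity) f x
    rw [hfx] at h2
    refine h2.trans ?_
    have e1 : (Λ ^ (1 / μ)) ^ n = Λ ^ (n / μ) := by
      rw [← Real.rpow_natCast, ← Real.rpow_mul hΛ.le]; congr 1; ring
    have e2 : (Λ ^ (1 / μ)) ^ (-(2 * (k * μ))) = Λ ^ (-(2 * k : ℝ)) := by
      rw [← Real.rpow_mul hΛ.le]; congr 1; field_simp
    rw [e1, e2]
    calc _ ≤ C * ENNReal.ofReal (Λ ^ (n / μ)) * (C₀ * S x + ENNReal.ofReal (Λ ^ (-(2 * k : ℝ))) *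
          (C₁ * (ENNReal.ofReal (Λ ^ (2 * k : ℝ)) * S x))) := by gcongr
      _ = C * ENNReal.ofReal (Λ ^ (n / μ)) * (C₀ * S x + ENNReal.ofReal (Λ ^ (-(2 * k : ℝ)) *
          Λ ^ (2 * k : ℝ)) * (C₁ * S x)) := by
          rw [ENNReal.ofReal_mul (by positivity)]; ring
      _ = _ := by
          rw [← Real.rpow_add hΛ, neg_add_cancel, Real.rpow_zero, ENNReal.ofReal_one]
          push_cast
          ring
  -- Each `e k` has `L²` norm one, so integrating `S` counts the eigenfunctions.
  have hsum : ∫⁻ x, S x ∂(surfaceMeasure n M) = (N + 1 : ℕ) := by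
    rw [hS, lintegral_finsetSum _ fun k _ => measurable_enorm_sq (e k)]
    have : ∀ k, ∫⁻ x, ‖(e k : M → ℂ) x‖ₑ ^ 2 ∂(surfaceMeasure n M) = 1 := by
      intro k
      have h1 := innerL2_self (n := n) (e k)
      rw [he.innerL2_eq, if_pos rfl] at h1
      have h2 : (l2sq n (e k)).toReal = 1 := by exact_mod_cast h1.symm
      exact (ENNReal.toReal_eq_one_iff _).1 h2
    simp [this]
  have h3 : ((N + 1 : ℕ) : ℝ≥0∞) ≤ (C * (C₀ + C₁) : ℝ≥0) * ENNReal.ofReal (Λ ^ (n / μ)) * V := by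
    rw [← hsum, ← setLIntegral_univ, ← lintegral_const, setLIntegral_univ]
    exact lintegral_mono hSle
  have hVt : V ≠ ⊤ := measure_ne_top _ _
  have h4 := ENNReal.toReal_mono (by finiteness) h3
  rw [ENNReal.toReal_natCast, ENNReal.toReal_mul, ENNReal.toReal_mul,
    ENNReal.toReal_ofReal (by positivity), ENNReal.coe_toReal] at h4
  push_cast at h4
  refine h4.trans ?_
  have h5 : 0 < Λ ^ (n / μ) := by positivity
  rw [hBdef]
  push_cast
  nlinarith

end Weyl

/-! ### The truncation error. -/

section Truncation

variable {m n : ℕ} {M : Set (Euc m)} (𝒜 : SobolevAtlas n M) [CompactSpace M]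

/-- The infimum defining `opNorm` is attained: divide by the norm of `f` if it is nonzero. If it
vanishes, any admissible constant shows that `A f` has norm zero, and finiteness provides one. -/
theorem sobolevNorm_le_opNorm_mul {s r : ℝ} {A : SmoothFun M → SmoothFun M}
    (hA : opNorm 𝒜 s r A ≠ ⊤) (f : SmoothFun M) :
    sobolevNorm 𝒜 r (A f) ≤ opNorm 𝒜 s r A * sobolevNorm 𝒜 s f := by
  rcases eq_or_ne (sobolevNorm 𝒜 s f) 0 with h0 | h0
  · obtain ⟨C, hC, -⟩ := sInf_lt_iff.1 (lt_top_iff_ne_top.2 hA)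
    have := hC f
    rwa [h0, mul_zero] at this ⊢
  · refine (ENNReal.div_le_iff h0 (sobolevNorm_lt_top 𝒜 s f).ne).1 (le_sInf fun C hC => ?_)
    exact (ENNReal.div_le_iff h0 (sobolevNorm_lt_top 𝒜 s f).ne).2 (hC f)

theorem IsPseudoDiff.opNorm_lt_top {t : ℝ} {A : SmoothFun M →ₗ[ℂ] SmoothFun M}
    (hA : IsPseudoDiff n t A) (hn : 0 < n) (s : ℝ) : opNorm 𝒜 s (s - t) A < ⊤ := by
  obtain ⟨C, hC⟩ := hA.exists_sobolevNorm_le 𝒜 hn s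
  have h : opNorm 𝒜 s (s - t) A ≤ C := sInf_le hC
  exact h.trans_lt ENNReal.coe_lt_top

variable {μ : ℝ} {D : SmoothFun M →ₗ[ℂ] SmoothFun M} [IsFiniteMeasure (surfaceMeasure n M)]

/-- Weyl's bound raised to the power `2 * r / n`. The restriction `r ≤ B` and a base of at least `1`
keep the constant uniform in `r`. -/
theorem exists_rpow_neg_eigenvalue_le (𝒜 : SobolevAtlas n M) (hn : 0 < n) (hμ : 0 < μ) (hD : IsPseudoDiff n μ D)
    (hell : IsEllipticOp n μ D) (hsa : IsSelfAdjointOp n D) (B : ℝ) :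
    ∃ C : ℝ≥0, ∀ e ev, IsEigenbasis n D e ev → ∀ r : ℝ, 0 ≤ r → r ≤ B → ∀ N : ℕ, 1 ≤ N →
      (1 + |ev N|) ^ (-(2 * r / μ)) ≤ C * ((N : ℝ) ^ (-(r / n))) ^ 2 := by
  obtain ⟨W, hW0, hW⟩ := exists_le_mul_rpow_eigenvalue 𝒜 hn hμ hD hell hsa
  have hn' : (0 : ℝ) < n := by exact_mod_cast hn
  refine ⟨(max 1 W ^ (2 * B / n)).toNNReal, fun e ev he r hr hrB N hN => ?_⟩
  have hΛ := one_add_abs_pos (ev N)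
  set Λ : ℝ := 1 + |ev N|
  have hN' : (0 : ℝ) < N := by exact_mod_cast hN
  have h1 : (N : ℝ) ≤ max 1 W * Λ ^ (n / μ) := by
    have h2 : W * Λ ^ (n / μ) ≤ max 1 W * Λ ^ (n / μ) := by gcongr; exact le_max_right _ _
    linarith [hW e ev he N]
  have h3 : (N : ℝ) ^ (2 * r / n) ≤ max 1 W ^ (2 * B / n) * Λ ^ (2 * r / μ) := by
    calc (N : ℝ) ^ (2 * r / n) ≤ (max 1 W * Λ ^ (n / μ)) ^ (2 * r / n) := by gcongr
      _ = max 1 W ^ (2 * r / n) * Λ ^ (2 * r / μ) := by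
          rw [Real.mul_rpow (by positivity) (by positivity), ← Real.rpow_mul hΛ.le]
          congr 2
          field_simp
      _ ≤ _ := by
          gcongr
          exact le_max_left _ _
  have h4 : ((N : ℝ) ^ (-(r / n))) ^ 2 = ((N : ℝ) ^ (2 * r / n))⁻¹ := by
    rw [← Real.rpow_natCast, ← Real.rpow_mul hN'.le, ← Real.rpow_neg hN'.le]
    congr 1
    push_cast
    ring
  rw [h4, Real.rpow_neg hΛ.le, Real.coe_toNNReal _ (by positivity), ← div_eq_mul_inv, ← one_div,
    div_le_div_iff₀ (by positivity) (by positivity), one_mul]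
  exact h3

/-- The norm of order `s` is bounded by its spectral counterpart, which is allowed for negative `s`;
the spectral norm is bounded back by a Sobolev norm only at the order `s + r`, hence `0 < s + r`. -/
theorem exists_sobolevNorm_sub_specProj_le (hn : 0 < n) (hμ : 0 < μ) (hD : IsPseudoDiff n μ D)
    (hell : IsEllipticOp n μ D) (hsa : IsSelfAdjointOp n D) (B : ℝ) :
    ∃ C : ℝ≥0, ∀ e ev, IsEigenbasis n D e ev → ∀ s r : ℝ, |s| ≤ B → 0 ≤ r → r ≤ B → 0 < s + r →
      s + r ≤ B → ∀ N : ℕ, 1 ≤ N → ∀ f, sobolevNorm 𝒜 s (f - specProj n e N f) ≤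
        C * ENNReal.ofReal ((N : ℝ) ^ (-(r / n))) * sobolevNorm 𝒜 (s + r) f := by
  obtain ⟨k, hk⟩ := exists_nat_gt (B / μ)
  rw [div_lt_iff₀ hμ] at hk
  obtain ⟨C₁, hC₁⟩ := exists_sobolevNorm_sq_le_specSq 𝒜 hn hμ hD hell hsa k
  obtain ⟨C₂, hC₂⟩ := exists_specSq_le_sobolevNorm_sq 𝒜 hn hμ hD hsa k
  obtain ⟨C₃, hC₃⟩ := exists_rpow_neg_eigenvalue_le 𝒜 hn hμ hD hell hsa B
  -- `1 + x` serves in place of `√x`, since `x ≤ (1 + x) ^ 2`.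
  refine ⟨1 + C₁ * C₃ * C₂, fun e ev he s r hs hr hrB hsr hsrB N hN f => ?_⟩
  rw [← rpow_half_le_iff]
  have h1 : ENNReal.ofReal ((1 + |ev N|) ^ (-(2 * r / μ))) ≤
      C₃ * ENNReal.ofReal ((N : ℝ) ^ (-(r / n))) ^ 2 := by
    rw [← ENNReal.ofReal_pow (by positivity), ← ENNReal.ofReal_coe_nnreal,
      ← ENNReal.ofReal_mul C₃.coe_nonneg]
    exact ENNReal.ofReal_le_ofReal (hC₃ e ev he r hr hrB N hN)
  have h2 : (C₁ * C₃ * C₂ : ℝ≥0∞) ≤ (1 + C₁ * C₃ * C₂) ^ 2 := by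
    rw [sq]
    exact le_add_self.trans (le_mul_of_one_le_left' le_self_add)
  calc sobolevNorm 𝒜 s (f - specProj n e N f) ^ 2
      ≤ C₁ * specSq n e ev (2 * s / μ) (f - specProj n e N f) := hC₁ e ev he s (hs.trans_lt hk) _
    _ ≤ C₁ * ((C₃ * ENNReal.ofReal ((N : ℝ) ^ (-(r / n))) ^ 2) *
          (C₂ * sobolevNorm 𝒜 (s + r) f ^ 2)) := by
        refine mul_le_mul_right ((he.specSq_sub_specProj_le _ (ρ := 2 * r / μ) (by positivity) N
          f).trans (mul_le_mul' h1 ?_)) _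
        rw [← add_div, ← mul_add]
        exact hC₂ e ev he _ hsr (hsrB.trans_lt hk) f
    _ = (C₁ * C₃ * C₂) * (ENNReal.ofReal ((N : ℝ) ^ (-(r / n))) * sobolevNorm 𝒜 (s + r) f) ^ 2 := by
        ring
    _ ≤ (1 + C₁ * C₃ * C₂) ^ 2 *
        (ENNReal.ofReal ((N : ℝ) ^ (-(r / n))) * sobolevNorm 𝒜 (s + r) f) ^ 2 :=
        mul_le_mul_left h2 _
    _ = _ := by
        push_cast
        ring

theorem exists_sobolevNorm_specProj_le (hn : 0 < n) (hμ : 0 < μ) (hD : IsPseudoDiff n μ D)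
    (hell : IsEllipticOp n μ D) (hsa : IsSelfAdjointOp n D) {s : ℝ} (hs : 0 < s) :
    ∃ C : ℝ≥0, ∀ e ev, IsEigenbasis n D e ev → ∀ (N : ℕ) (f : SmoothFun M),
      sobolevNorm 𝒜 s (specProj n e N f) ≤ C * sobolevNorm 𝒜 s f := by
  obtain ⟨k, hk⟩ := exists_nat_gt (s / μ)
  rw [div_lt_iff₀ hμ] at hk
  obtain ⟨C₁, hC₁⟩ := exists_sobolevNorm_sq_le_specSq 𝒜 hn hμ hD hell hsa k
  obtain ⟨C₂, hC₂⟩ := exists_specSq_le_sobolevNorm_sq 𝒜 hn hμ hD hsa k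
  refine ⟨1 + C₁ * C₂, fun e ev he N f => ?_⟩
  rw [← rpow_half_le_iff]
  have h2 : (C₁ * C₂ : ℝ≥0∞) ≤ (1 + C₁ * C₂) ^ 2 := by
    rw [sq]
    exact le_add_self.trans (le_mul_of_one_le_left' le_self_add)
  calc sobolevNorm 𝒜 s (specProj n e N f) ^ 2
      ≤ C₁ * specSq n e ev (2 * s / μ) (specProj n e N f) :=
        hC₁ e ev he s (by rwa [abs_of_pos hs]) _
    _ ≤ C₁ * (C₂ * sobolevNorm 𝒜 s f ^ 2) :=
        mul_le_mul_right ((he.specSq_specProj_le _ N f).trans (hC₂ e ev he s hs hk f)) _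
    _ = (C₁ * C₂) * sobolevNorm 𝒜 s f ^ 2 := by ring
    _ ≤ (1 + C₁ * C₂) ^ 2 * sobolevNorm 𝒜 s f ^ 2 := mul_le_mul_left h2 _
    _ = _ := by
        push_cast
        ring

theorem specProj_sub (e : ℕ → SmoothFun M) (N : ℕ) (f g : SmoothFun M) :
    specProj n e N (f - g) = specProj n e N f - specProj n e N g := by
  simp only [specProj, innerL2_sub_left, sub_smul, Finset.sum_sub_distrib]

theorem exists_opNorm_sub_truncation_le (hn : 0 < n) (hμ : 0 < μ) (hD : IsPseudoDiff n μ D)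
    (hell : IsEllipticOp n μ D) (hsa : IsSelfAdjointOp n D) (t₀ : ℝ) :
    ∃ C : ℝ, 0 < C ∧ ∀ e ev, IsEigenbasis n D e ev → ∀ t ∈ Icc t₀ 1,
      ∀ τ : SmoothFun M →ₗ[ℂ] SmoothFun M, IsPseudoDiff n t τ → ∀ N : ℕ, 1 ≤ N →
        opNorm 𝒜 (3 / 2) (1 / 2) (fun f => τ f - truncation n e N τ f) ≤
          ENNReal.ofReal C *
            (opNorm 𝒜 (3 / 2) (3 / 2 - t) τ + opNorm 𝒜 (1 / 2 + t) (1 / 2) τ) *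
            ENNReal.ofReal ((N : ℝ) ^ (-((1 - t) / n))) := by
  -- `2 + |t₀|` bounds the absolute values of all orders that occur for `t₀ ≤ t ≤ 1`: `1/2`, `1/2 +
  -- t`, `1 - t`, `3/2 - t` and `3/2`.
  obtain ⟨C₁, hC₁⟩ := exists_sobolevNorm_sub_specProj_le 𝒜 hn hμ hD hell hsa (2 + |t₀|)
  obtain ⟨C₂, hC₂⟩ := exists_sobolevNorm_specProj_le 𝒜 hn hμ hD hell hsa (s := 1 / 2)
    (by norm_num)
  -- The summand `1` only ensures that the constant is positive.
  refine ⟨((1 + C₂) * C₁ + 1 : ℝ≥0), by positivity, fun e ev he t ht τ hτ N hN => sInf_le fun f => ?_⟩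
  have ht1 := ht.2
  have ht0 : -|t₀| ≤ t := (neg_abs_le t₀).trans ht.1
  have h0 := abs_nonneg t₀
  set E : ℝ≥0∞ := ENNReal.ofReal ((N : ℝ) ^ (-((1 - t) / n)))
  set X := opNorm 𝒜 (3 / 2) (3 / 2 - t) τ
  set Y := opNorm 𝒜 (1 / 2 + t) (1 / 2) τ
  have hX : X ≠ ⊤ := (hτ.opNorm_lt_top 𝒜 hn (3 / 2)).ne
  have hY : Y ≠ ⊤ := by
    have := (hτ.opNorm_lt_top 𝒜 hn (1 / 2 + t)).ne
    rwa [add_sub_cancel_right] at this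
  have hsplit : τ f - truncation n e N τ f =
      (τ f - specProj n e N (τ f)) + specProj n e N (τ (f - specProj n e N f)) := by
    rw [truncation_eq, map_sub, specProj_sub]
    abel
  have hA : sobolevNorm 𝒜 (1 / 2) (τ f - specProj n e N (τ f)) ≤
      C₁ * E * (X * sobolevNorm 𝒜 (3 / 2) f) := by
    have h1 := hC₁ e ev he (1 / 2) (1 - t) (by rw [abs_of_pos] <;> linarith) (by linarith)
      (by linarith) (by linarith) (by linarith) N hN (τ f)
    rw [show (1 / 2 : ℝ) + (1 - t) = 3 / 2 - t by ring] at h1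
    exact h1.trans (mul_le_mul_right (sobolevNorm_le_opNorm_mul 𝒜 hX f) _)
  -- Here `1 - P` acts before `τ`, so `1/2 + t` may be negative; the order `3/2` of the source is
  -- positive, as the estimate requires.
  have hB : sobolevNorm 𝒜 (1 / 2) (specProj n e N (τ (f - specProj n e N f))) ≤
      C₂ * (Y * (C₁ * E * sobolevNorm 𝒜 (3 / 2) f)) := by
    have h1 := hC₁ e ev he (1 / 2 + t) (1 - t) (by rw [abs_le]; constructor <;> linarith)
      (by linarith) (by linarith) (by linarith) (by linarith) N hN f
    rw [show (1 / 2 : ℝ) + t + (1 - t) = 3 / 2 by ring] at h1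
    exact (hC₂ e ev he N _).trans (mul_le_mul_right
      ((sobolevNorm_le_opNorm_mul 𝒜 hY _).trans (mul_le_mul_right h1 _)) _)
  change sobolevNorm 𝒜 (1 / 2) (τ f - truncation n e N τ f) ≤ _
  rw [hsplit, ENNReal.ofReal_coe_nnreal]
  push_cast
  refine (sobolevNorm_add_le 𝒜 _ _ _).trans ((add_le_add hA hB).trans ?_)
  have hle : ((C₁ : ℝ≥0∞) * X + C₂ * C₁ * Y) ≤ ((1 + C₂) * C₁ + 1) * (X + Y) := by
    refine le_trans ?_ (mul_le_mul_left le_self_add _)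
    calc (C₁ : ℝ≥0∞) * X + C₂ * C₁ * Y ≤ C₁ * X + C₂ * C₁ * Y + (C₁ * Y + C₂ * C₁ * X) :=
          le_self_add
      _ = _ := by ring
  calc _ = (C₁ * X + C₂ * C₁ * Y) * (E * sobolevNorm 𝒜 (3 / 2) f) := by ring
    _ ≤ ((1 + C₂) * C₁ + 1) * (X + Y) * (E * sobolevNorm 𝒜 (3 / 2) f) := mul_le_mul_left hle _
    _ = _ := by ring

end Truncation

end

theorem mainTheorem10 (d : ℕ) (hd : 1 ≤ d)
    -- the compact domain `K`; its boundary is that of `Ω = ℝ^{2d} \ K`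
    (K : Set (Euc (2 * d))) (hK : IsSmoothCompactDomain K)
    -- the positive order self-adjoint elliptic operator `D` on `∂Ω`
    (μ : ℝ) (hμ : 0 < μ) (D : SmoothFun (frontier Kᶜ) →ₗ[ℂ] SmoothFun (frontier Kᶜ))
    (hD : IsPseudoDiff (2 * d - 1) μ D) (hDell : IsEllipticOp (2 * d - 1) μ D)
    (hDsa : IsSelfAdjointOp (2 * d - 1) D)
    -- the choice of the norms of the Sobolev spaces on `∂Ω`
    (𝒜 : SobolevAtlas (2 * d - 1) (frontier Kᶜ))
    (t₀ : ℝ) :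
    ∃ C : ℝ, 0 < C ∧
      ∀ (e : ℕ → SmoothFun (frontier Kᶜ)) (ev : ℕ → ℝ), IsEigenbasis (2 * d - 1) D e ev →
      ∀ t ∈ Set.Icc t₀ 1,
      ∀ τ : SmoothFun (frontier Kᶜ) →ₗ[ℂ] SmoothFun (frontier Kᶜ),
        IsPseudoDiff (2 * d - 1) t τ →
        opNorm 𝒜 (3 / 2) (3 / 2 - t) τ < ⊤ ∧ opNorm 𝒜 (1 / 2 + t) (1 / 2) τ < ⊤ ∧
        ∀ N : ℕ, 1 ≤ N →
          opNorm 𝒜 (3 / 2) (1 / 2) (fun f => τ f - truncation (2 * d - 1) e N τ f) ≤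
            ENNReal.ofReal C *
              (opNorm 𝒜 (3 / 2) (3 / 2 - t) τ + opNorm 𝒜 (1 / 2 + t) (1 / 2) τ) *
              ENNReal.ofReal ((N : ℝ) ^ (-((1 - t) / (2 * (d : ℝ) - 1)))) := by
  have hn : 0 < 2 * d - 1 := by omega
  have hc : CompactSpace (frontier Kᶜ) := by
    rw [← isCompact_iff_compactSpace, frontier_compl]
    exact hK.1.of_isClosed_subset isClosed_frontier hK.1.isClosed.frontier_subset
  have hfin : IsFiniteMeasure (surfaceMeasure (2 * d - 1) (frontier Kᶜ)) :=
    isFiniteMeasure_surfaceMeasure 𝒜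
  obtain ⟨C, hC0, hC⟩ := exists_opNorm_sub_truncation_le 𝒜 hn hμ hD hDell hDsa t₀
  -- The natural subtraction is a genuine one because `1 ≤ d`.
  have hcast : ((2 * d - 1 : ℕ) : ℝ) = 2 * (d : ℝ) - 1 := by
    rw [Nat.cast_sub (by omega)]
    push_cast
    ring
  rw [hcast] at hC
  refine ⟨C, hC0, fun e ev he t ht τ hτ => ⟨hτ.opNorm_lt_top 𝒜 hn _, ?_, hC e ev he t ht τ hτ⟩⟩
  have h := hτ.opNorm_lt_top 𝒜 hn (1 / 2 + t)
  rwa [add_sub_cancel_right] at h
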